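/- Setting. Let $\bar A\in\{0,\star\}^{n\times n}$ be a structural matrix and let $\mathcal D(\bar A)=(\mathcal X,\mathcal E)$ be its state digraph, with $\mathcal X=\{x_1,\dots,x_n\}$ and an edge $(x_i,x_j)$ whenever $\bar A_{ji}=\star$. A set $S\subseteq\mathcal X$ is *feasible* if some real matrix that vanishes at all zero entries of $\bar A$ is observable when exactly the state variables in $S$ are measured, each by a dedicated sensor. It is *minimal feasible* if it is feasible of the smallest possible size, and *s-robust feasible* if it is feasible and $S\setminus\{x\}$ is feasible for every $x\in S$. A *minimum path-and-cycle decomposition* of $\mathcal D(\bar A)$ is a spanning family of vertex-disjoint directed paths and cycles (single vertices count as paths) with the fewest paths; the *tips* are the last vertices of its paths. Let $\mathcal F$ be a minimal feasible set and $\mathcal T\subseteq\mathcal F$ the set of tips of a minimum path-and-cycle decomposition; put $p=|\mathcal F|$ and $H(p)=\sum_{k=1}^{p}\frac1k$. For $x\in\mathcal F$ define a collection $\Omega(x)$ of *back-ups*. If $x\in\mathcal F\setminus\mathcal T$, then $\Omega(x)$ consists of the sets $\{w\}$ with $w\neq x$ in the same sink strongly connected component (SCC) as $x$. If $x\in\mathcal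 T$, consider each $w\ne x$ such that $(\mathcal T\setminus\{x\})\cup\{w\}$ is the set of tips of a minimum path-and-cycle decomposition: if $(\mathcal T\setminus\{x\})\cup\{w\}\cup(\mathcal F\setminus\mathcal T)$ is feasible, then $\{w\}\in\Omega(x)$; otherwise $\{w,y\}\in\Omega(x)$ for each $y\neq x$ in the SCC of $x$; there are no other members. Let $\mathcal Z_1,\dots,\mathcal Z_N$, $N=\frac{n(n+1)}2$, be the subsets of $\mathcal X$ with one or two elements. Put $\mathcal V_j=\{x\in\mathcal F:\mathcal Z_j\in\Omega(x)\}$ if $|\mathcal Z_j|=1$, and $\mathcal V_j=\{x\in\mathcal F:\mathcal Z_j\in\Omega(x)\text{ or }\{z\}\in\Omega(x)\text{ for some }z\in\mathcal Z_j\}$ if $|\mathcal Z_j|=2$, and let $c_j=|\mathcal Z_j|$. The *back-up instance* is the weighted set covering problem with universal set $\mathcal F$, covering sets $\mathcal V_1,\dots,\mathcal V_N$ and costs $c_1,\dots,c_N$; a *cover* is a set $\mathcal J\subseteq\{1,\dots,N\}$ with $\mathcal F\subseteq\bigcup_{j\in\mathcal J}\mathcal V_j$. Theorem. Running times are those of a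 random access machine with words of $O(\log n)$ bits and unit-cost instructions. 1. There is an algorithm that, given $\bar A$, $\mathcal F$ and $\mathcal T$, constructs the back-up instance in time $O(|\mathcal X|^5)$. 2. The back-up instance has a cover if and only if some s-robust feasible set contains $\mathcal F$. 3. There is an algorithm that, given the back-up instance, computes in time $O(|\mathcal X|^3)$ a set $\mathcal J'\subseteq\{1,\dots,N\}$ such that, whenever a cover exists: $\mathcal J'$ is a cover whose cost $\sum_{j\in\mathcal J'}c_j$ is at most $H(p)$ times the cost of any cover; the set $\mathcal F'=\bigcup_{j\in\mathcal J'}\mathcal Z_j\cup\mathcal F$ is an s-robust feasible set; and $|\mathcal F'|\le H(p)\,|\mathcal F^*|$, where $\mathcal F^*$ is a smallest s-robust feasible set containing $\mathcal F$. -/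

import Mathlib

namespace RobustSensor

/-! ### Structural systems and structural observability

A structural matrix has entries `true` (an independent parameter) and `false` (a fixed zero). -/

/-- The structural pattern of the dynamics matrix of a system with `n` states. -/
abbrev Pattern (n : ℕ) := Matrix (Fin n) (Fin n) Bool

/-- The output matrix of dedicated sensors: the rows of the identity matrix indexed by `S`. -/
def sensorMatrix {n : ℕ} (S : Finset (Fin n)) : Matrix S (Fin n) ℝ :=
  (1 : Matrix (Fin n) (Fin n) ℝ).submatrix Subtype.val id

/-- The observability matrix: the rows of `C`, `C A`, ..., `C A ^ (n - 1)`. -/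
def observabilityMatrix {n : ℕ} (A : Matrix (Fin n) (Fin n) ℝ) (S : Finset (Fin n)) :
    Matrix (Fin n × S) (Fin n) ℝ :=
  fun r i => (sensorMatrix S * A ^ (r.1 : ℕ)) r.2 i

/-- Observability of the pair formed by `A` and the dedicated sensors `S`. -/
def IsObservable {n : ℕ} (A : Matrix (Fin n) (Fin n) ℝ) (S : Finset (Fin n)) : Prop :=
  (observabilityMatrix A S).rank = n

/-- A feasible solution: the pattern with the dedicated sensors `S` is structurally observable,
that is, some real matrix that vanishes at all the fixed zeros is observable through `S`. -/
def IsFeasible {n : ℕ} (P : Pattern n) (S : Finset (Fin n)) : Prop :=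
  ∃ A : Matrix (Fin n) (Fin n) ℝ, (∀ i j, P i j = false → A i j = 0) ∧ IsObservable A S

/-- A feasible solution with the smallest possible number of state variables. -/
def IsMinimalFeasible {n : ℕ} (P : Pattern n) (S : Finset (Fin n)) : Prop :=
  IsFeasible P S ∧ ∀ S' : Finset (Fin n), IsFeasible P S' → S.card ≤ S'.card

/-- An s-robust feasible solution: it is feasible, and stays so when any one sensor is lost. -/
def IsSRobust {n : ℕ} (P : Pattern n) (S : Finset (Fin n)) : Prop :=
  IsFeasible P S ∧ ∀ x ∈ S, IsFeasible P (S.erase x)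

/-! ### The state digraph -/

/-- The state digraph has an edge from `i` to `j` when the entry in row `j`, column `i` is free. -/
def Edge {n : ℕ} (P : Pattern n) (i j : Fin n) : Prop := P j i = true

/-- There is a directed path (possibly of length zero) from `i` to `j`. -/
def Reach {n : ℕ} (P : Pattern n) (i j : Fin n) : Prop := Relation.ReflTransGen (Edge P) i j

/-- `i` and `j` lie in the same strongly connected component. -/
def SameSCC {n : ℕ} (P : Pattern n) (i j : Fin n) : Prop := Reach P i j ∧ Reach P j i

/-- The strongly connected component of `i` is a sink: no edge leaves it. -/
def InSinkSCC {n : ℕ} (P : Pattern n) (i : Fin n) : Prop :=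
  ∀ u w, SameSCC P i u → Edge P u w → SameSCC P i w

/-- A decomposition of the state digraph into vertex-disjoint paths and cycles that span it.
A path is the nonempty list of its vertices from its root to its tip. A cycle is such a list with
an additional edge from the last vertex to the first one. -/
structure PCDecomposition {n : ℕ} (P : Pattern n) where
  paths : List (List (Fin n))
  cycles : List (List (Fin n))
  path_ne_nil : ∀ l ∈ paths, l ≠ []
  path_chain : ∀ l ∈ paths, l.IsChain (Edge P)
  cycle_ne_nil : ∀ l ∈ cycles, l ≠ []
  cycle_chain : ∀ l ∈ cycles, l.IsChain (Edge P)
  cycle_closed : ∀ l ∈ cycles, ∀ a ∈ l.getLast?, ∀ b ∈ l.head?, Edge P a b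
  disjoint : (paths.flatten ++ cycles.flatten).Nodup
  spanning : ∀ v, v ∈ paths.flatten ++ cycles.flatten

/-- A minimum decomposition has the smallest possible number of paths. -/
def PCDecomposition.IsMinimum {n : ℕ} {P : Pattern n} (D : PCDecomposition P) : Prop :=
  ∀ D' : PCDecomposition P, D.paths.length ≤ D'.paths.length

/-- `T` is the set of the tips of the paths of some minimum path and cycle decomposition. -/
def IsTipSet {n : ℕ} (P : Pattern n) (T : Finset (Fin n)) : Prop :=
  ∃ D : PCDecomposition P, D.IsMinimum ∧ ∀ v, v ∈ T ↔ ∃ l ∈ D.paths, v ∈ l.getLast?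

/-! ### Alternatives and back-ups

Here `F` is a minimal feasible solution, `T ⊆ F` is the set of tips of a minimum decomposition, and
the rest `F \ T` of `F` takes care of the sink components that contain no tip. -/

/-- The sink-alternatives to `x`. -/
def sinkAlternatives {n : ℕ} (P : Pattern n) (x : Fin n) : Set (Fin n) :=
  {w | w ≠ x ∧ InSinkSCC P x ∧ SameSCC P x w}

/-- The tip-alternatives to the tip `x`. -/
def tipAlternatives {n : ℕ} (P : Pattern n) (T : Finset (Fin n)) (x : Fin n) : Set (Fin n) :=
  {w | w ≠ x ∧ IsTipSet P (insert w (T.erase x))}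

/-- The solution in which the tip `x` is interchanged with `w`. -/
def interchanged {n : ℕ} (F T : Finset (Fin n)) (x w : Fin n) : Finset (Fin n) :=
  insert w (T.erase x) ∪ (F \ T)

open Classical in
/-- The set of back-ups to `x ∈ F`. -/
noncomputable def backups {n : ℕ} (P : Pattern n) (F T : Finset (Fin n)) (x : Fin n) :
    Set (Finset (Fin n)) :=
  if x ∈ T then
    {z | ∃ w ∈ tipAlternatives P T x,
      (IsFeasible P (interchanged F T x w) ∧ z = {w}) ∨
      (¬ IsFeasible P (interchanged F T x w) ∧ ∃ y, y ≠ x ∧ SameSCC P x y ∧ z = {w, y})}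
  else {z | ∃ w ∈ sinkAlternatives P x, z = {w}}

/-! ### The weighted set covering problem -/

/-- An instance of the weighted set covering problem: a universal set and a finite indexed family
of sets with costs. -/
structure SetCover (ι α : Type) where
  universal : Finset α
  index : Finset ι
  sets : ι → Finset α
  cost : ι → ℕ

/-- The subfamily indexed by `J` covers the universal set. -/
def SetCover.IsCover {ι α : Type} (I : SetCover ι α) (J : Finset ι) : Prop :=
  J ⊆ I.index ∧ ∀ u ∈ I.universal, ∃ j ∈ J, u ∈ I.sets j

/-- The cost of a subfamily. -/
def SetCover.totalCost {ι α : Type} (I : SetCover ι α) (J : Finset ι) : ℕ := ∑ j ∈ J, I.cost j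

/-- The sets with one or two state variables are indexed by the pairs `(a, b)` with `a ≤ b`; the
pair stands for `{a, b}`, which is a singleton when `a = b`. -/
def zset {n : ℕ} (j : Fin n × Fin n) : Finset (Fin n) := {j.1, j.2}

open Classical in
/-- The elements of `F` to which the set with index `j` is itself a back-up. -/
noncomputable def directCover {n : ℕ} (P : Pattern n) (F T : Finset (Fin n)) (j : Fin n × Fin n) :
    Finset (Fin n) :=
  F.filter (fun x => zset j ∈ backups P F T x)

/-- The covering set with index `j`. -/
noncomputable def coverSet {n : ℕ} (P : Pattern n) (F T : Finset (Fin n)) (j : Fin n × Fin n) :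
    Finset (Fin n) :=
  if j.1 = j.2 then directCover P F T j
  else directCover P F T j ∪ (zset j).biUnion (fun k => directCover P F T (k, k))

/-- The weighted set covering instance of `F` and `T`. The universal set is `F`, whose elements
stand for their indices, and the cost of a set of state variables is its size. -/
noncomputable def backupInstance {n : ℕ} (P : Pattern n) (F T : Finset (Fin n)) :
    SetCover (Fin n × Fin n) (Fin n) where
  universal := F
  index := Finset.univ.filter (fun j => j.1 ≤ j.2)
  sets := coverSet P F T
  cost := fun j => (zset j).card

/-- The solution given by `F` together with the sets of state variables selected by `J`. -/
def augmented {n : ℕ} (F : Finset (Fin n)) (J : Finset (Fin n × Fin n)) : Finset (Fin n) :=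
  J.biUnion zset ∪ F

/-! ### Programs for a random access machine with bounded words -/

/-- The memory: registers, and arrays (memory banks) that are addressed indirectly. A program names
only finitely many registers and arrays. -/
structure MachineState where
  reg : ℕ → ℕ
  arr : ℕ → ℕ → ℕ

/-- Change one register. -/
def MachineState.setReg (s : MachineState) (d v : ℕ) : MachineState :=
  { s with reg := Function.update s.reg d v }

/-- Change one array cell. -/
def MachineState.setArr (s : MachineState) (k i v : ℕ) : MachineState :=
  { s with arr := Function.update s.arr k (Function.update (s.arr k) i v) }

/-- Structured programs for the machine. -/
inductive Program where
  /-- `R_d := c` -/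
  | const (d c : ℕ)
  /-- `R_d := R_a + R_b` -/
  | add (d a b : ℕ)
  /-- `R_d := R_a - R_b`, truncated at zero -/
  | sub (d a b : ℕ)
  /-- `R_d := R_a * R_b` -/
  | mul (d a b : ℕ)
  /-- `R_d := M_k[R_a]` -/
  | load (d k a : ℕ)
  /-- `M_k[R_a] := R_b` -/
  | store (k a b : ℕ)
  /-- first `p`, then `q` -/
  | seq (p q : Program)
  /-- `p` if `R_a` is nonzero, `q` otherwise -/
  | branch (a : ℕ) (p q : Program)
  /-- repeat `p` as long as `R_a` is nonzero -/
  | loop (a : ℕ) (p : Program)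

/-- `Exec W p s t s'`: on a machine whose largest word is `W`, the program `p`, started in `s`,
halts in `s'` after `t` steps. Every elementary instruction and every test takes one step. A run in
which a constant, a sum or a product exceeds `W` is not admitted. -/
inductive Exec (W : ℕ) : Program → MachineState → ℕ → MachineState → Prop where
  | const (s : MachineState) (d c : ℕ) (h : c ≤ W) : Exec W (.const d c) s 1 (s.setReg d c)
  | add (s : MachineState) (d a b : ℕ) (h : s.reg a + s.reg b ≤ W) :
      Exec W (.add d a b) s 1 (s.setReg d (s.reg a + s.reg b))
  | sub (s : MachineState) (d a b : ℕ) :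
      Exec W (.sub d a b) s 1 (s.setReg d (s.reg a - s.reg b))
  | mul (s : MachineState) (d a b : ℕ) (h : s.reg a * s.reg b ≤ W) :
      Exec W (.mul d a b) s 1 (s.setReg d (s.reg a * s.reg b))
  | load (s : MachineState) (d k a : ℕ) :
      Exec W (.load d k a) s 1 (s.setReg d (s.arr k (s.reg a)))
  | store (s : MachineState) (k a b : ℕ) :
      Exec W (.store k a b) s 1 (s.setArr k (s.reg a) (s.reg b))
  | seq {p q : Program} {s s₁ s₂ : MachineState} {t₁ t₂ : ℕ}
      (hp : Exec W p s t₁ s₁) (hq : Exec W q s₁ t₂ s₂) : Exec W (.seq p q) s (t₁ + t₂) s₂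
  | branch_true {a : ℕ} {p q : Program} {s s' : MachineState} {t : ℕ}
      (ha : s.reg a ≠ 0) (hp : Exec W p s t s') : Exec W (.branch a p q) s (t + 1) s'
  | branch_false {a : ℕ} {p q : Program} {s s' : MachineState} {t : ℕ}
      (ha : s.reg a = 0) (hq : Exec W q s t s') : Exec W (.branch a p q) s (t + 1) s'
  | loop_done {a : ℕ} {p : Program} {s : MachineState}
      (ha : s.reg a = 0) : Exec W (.loop a p) s 1 s
  | loop_step {a : ℕ} {p : Program} {s s₁ s₂ : MachineState} {t₁ t₂ : ℕ}
      (ha : s.reg a ≠ 0) (hp : Exec W p s t₁ s₁) (hl : Exec W (.loop a p) s₁ t₂ s₂) :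
      Exec W (.loop a p) s (t₁ + t₂ + 1) s₂

/-! ### Input and output formats

The number `n` of states is in register 0. The arrays 0, 1, 2 hold the pattern (row by row) and the
indicators of `F` and `T`; the arrays 1, 3, 4 hold a set covering instance (the indicator of the
universal set, the incidence table of the family, the costs); array 5 holds the indicator of a
subfamily. All the other contents of the memory are arbitrary. -/

/-- The state holds the pattern `P`, the solution `F` and the set of tips `T`. -/
structure HoldsInput {n : ℕ} (P : Pattern n) (F T : Finset (Fin n)) (s : MachineState) : Prop where
  size : s.reg 0 = n
  pattern : ∀ i j : Fin n, s.arr 0 ((i : ℕ) * n + j) = if P i j = true then 1 else 0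
  solution : ∀ i : Fin n, s.arr 1 i = if i ∈ F then 1 else 0
  tips : ∀ i : Fin n, s.arr 2 i = if i ∈ T then 1 else 0

/-- The state holds the set covering instance `I`. -/
structure HoldsInstance {n : ℕ} (I : SetCover (Fin n × Fin n) (Fin n)) (s : MachineState) :
    Prop where
  size : s.reg 0 = n
  universal : ∀ i : Fin n, s.arr 1 i = if i ∈ I.universal then 1 else 0
  sets : ∀ j ∈ I.index, ∀ i : Fin n,
    s.arr 3 (((j.1 : ℕ) * n + j.2) * n + i) = if i ∈ I.sets j then 1 else 0
  cost : ∀ j ∈ I.index, s.arr 4 ((j.1 : ℕ) * n + j.2) = I.cost j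

/-- The state holds the subfamily `J` of the family of `I`. -/
def HoldsSubfamily {n : ℕ} (I : SetCover (Fin n × Fin n) (Fin n)) (J : Finset (Fin n × Fin n))
    (s : MachineState) : Prop :=
  J ⊆ I.index ∧ ∀ j ∈ I.index, s.arr 5 ((j.1 : ℕ) * n + j.2) = if j ∈ J then 1 else 0

end RobustSensor

open RobustSensor

/-!
A sensor set is feasible if and only if every state variable has a path to it (`Covers`) and the
state variables outside it can be matched along edges to distinct state variables (`Matchable`);
this is `isFeasible_iff`. Sufficiency is proved with explicit weights: the cycles of the matching
permutation carry pairwise different weights, every cycle without a sensor gets one more edge that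
leads closer to the sensors, and then no complex eigenvector is unobservable. Necessity is the
marriage theorem together with a dimension count. Likewise the tip sets of minimum decompositions
are exactly the smallest matchable sets (`isTipSet_iff`), so alternating paths give them an
exchange property (`IsTipSet.exchange`).

With these two characterizations a back-up makes up for the loss of its element
(`isFeasible_of_backup`), which turns covers into s-robust solutions. Conversely an s-robust
solution `S` that contains `F` contains a back-up to each element of `F` (`exists_backup`). The
elements that have only back-ups of two elements in `S` each own a sink component, so that the
cover obtained from `S` costs at most `m + d`, where `m = |S \ F|` and `d` is the number of these
elements (`exists_cover_of_isSRobust`).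

The greedy algorithm has the harmonic ratio, and each element of `F` pays at most the cost of a
cheapest set that contains it, so its cost is also at most `p + d` with `p = |F|`. Since `|F| + |S
\ F| = |S|`, the two bounds for the cost give the bound for the size (`size_bound`).

The running times come from a small total language in which all loops run `n` times. Its
compilation to the machine takes time `O(n ^ m)` when the loops are nested `m` deep, and cannot
overflow, because only values that are syntactically bounded are added or multiplied
(`St.exec_program`). The construction of the instance needs reachability, by the algorithm of
Floyd and Warshall, and for each pair `(x, w)` the test whether `T \ {x} ∪ {w}` is matchable. An
auction with `n ^ 2` rounds of linear time decides it (`AuctionRound.matchableBelow_iff`), which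
makes depth five in total. The greedy program covers the elements of a selected set one by one and
updates the number of uncovered elements of every set each time; at most `2 n` steps of quadratic
time are needed (`GreedyState.step`).
-/

namespace RobustSensor

/-! ### A small total language with bounded loops -/

/-- The arrays of a machine state. -/
abbrev Mem := ℕ → ℕ → ℕ

/-- Change one cell of one array. -/
def Mem.set (M : Mem) (k a v : ℕ) : Mem := Function.update M k (Function.update (M k) a v)

theorem Mem.set_same (M : Mem) (k a v : ℕ) : M.set k a v k a = v := by simp [Mem.set]

theorem Mem.set_ne_arr (M : Mem) {k k' : ℕ} (a v : ℕ) (h : k' ≠ k) : M.set k a v k' = M k' := by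
  simp [Mem.set, h]

theorem Mem.set_apply (M : Mem) (k a v k' a' : ℕ) :
    M.set k a v k' a' = if k' = k ∧ a' = a then v else M k' a' := by
  by_cases h : k' = k
  · subst h
    by_cases h' : a' = a <;> simp [Mem.set, h']
  · simp [Mem.set, h]

theorem Mem.set_set (M : Mem) (k a v w : ℕ) : (M.set k a v).set k a w = M.set k a w := by
  simp [Mem.set]

/-- Expressions. Variables are positions in an environment, and `get k e` reads cell `e` of
array `k`. -/
inductive Ex where
  | var (r : ℕ)
  | lit (c : ℕ)
  | plus (a b : Ex)
  | minus (a b : Ex)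
  | times (a b : Ex)
  | get (k : ℕ) (a : Ex)
  | ite (c a b : Ex)

namespace Ex

/-- The value of an expression. -/
def eval (ρ : List ℕ) (M : Mem) : Ex → ℕ
  | var r => ρ.getD r 0
  | lit c => c
  | plus a b => a.eval ρ M + b.eval ρ M
  | minus a b => a.eval ρ M - b.eval ρ M
  | times a b => a.eval ρ M * b.eval ρ M
  | get k a => M k (a.eval ρ M)
  | ite c a b => if c.eval ρ M ≠ 0 then a.eval ρ M else b.eval ρ M

/-- The code that leaves the value of an expression in register `d`. It touches no register
below `d`. -/
def code : Ex → ℕ → Program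
  | var r, d => .seq (.const d 0) (.sub d r d)
  | lit c, d => .const d c
  | plus a b, d => .seq (a.code d) (.seq (b.code (d + 1)) (.add d d (d + 1)))
  | minus a b, d => .seq (a.code d) (.seq (b.code (d + 1)) (.sub d d (d + 1)))
  | times a b, d => .seq (a.code d) (.seq (b.code (d + 1)) (.mul d d (d + 1)))
  | get k a, d => .seq (a.code d) (.load d k d)
  | ite c a b, d => .seq (c.code d) (.branch d (a.code d) (b.code d))

/-- The number of steps that the code of an expression takes at most. -/
def cost : Ex → ℕ
  | var _ => 2
  | lit _ => 1
  | plus a b => a.cost + b.cost + 1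
  | minus a b => a.cost + b.cost + 1
  | times a b => a.cost + b.cost + 1
  | get _ a => a.cost + 1
  | ite c a b => c.cost + a.cost + b.cost + 1

/-- Expressions whose value is polynomially bounded whatever the memory contains. A cell that is
read has no such bound, but a truncated difference has the bound of its minuend. -/
def bdd : Ex → Bool
  | var _ => true
  | lit _ => true
  | plus a b => a.bdd && b.bdd
  | minus a _ => a.bdd
  | times a b => a.bdd && b.bdd
  | get _ _ => false
  | ite _ a b => a.bdd && b.bdd

/-- The exponent of a polynomial bound for the values that occur in an evaluation. -/
def deg : Ex → ℕ
  | var _ => 1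
  | lit c => c
  | plus a b => a.deg + b.deg + 1
  | minus a b => a.deg + b.deg
  | times a b => a.deg + b.deg
  | get _ a => a.deg
  | ite c a b => c.deg + a.deg + b.deg

/-- Well-formed expressions over an environment of length `L`: the variables are in scope, and only
bounded values are added or multiplied. -/
def wf (L : ℕ) : Ex → Bool
  | var r => decide (r < L)
  | lit _ => true
  | plus a b => a.wf L && b.wf L && a.bdd && b.bdd
  | minus a b => a.wf L && b.wf L
  | times a b => a.wf L && b.wf L && a.bdd && b.bdd
  | get _ a => a.wf L
  | ite c a b => c.wf L && a.wf L && b.wf L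

theorem eval_le {n : ℕ} {ρ : List ℕ} (hρ : ∀ r, ρ.getD r 0 ≤ n) (M : Mem) (e : Ex)
    (h : e.bdd = true) : e.eval ρ M ≤ (n + 2) ^ e.deg := by
  have mono : ∀ {a b : ℕ}, a ≤ b → (n + 2) ^ a ≤ (n + 2) ^ b := fun hab =>
    Nat.pow_le_pow_right (by omega) hab
  induction e with
  | var r => simpa [eval, deg] using (hρ r).trans (by omega)
  | lit c =>
    calc c ≤ 2 ^ c := Nat.lt_two_pow_self.le
      _ ≤ (n + 2) ^ c := Nat.pow_le_pow_left (by omega) c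
  | plus a b iha ihb =>
    simp only [bdd, Bool.and_eq_true] at h
    have ha := (iha h.1).trans (mono (Nat.le_add_right a.deg b.deg))
    have hb := (ihb h.2).trans (mono (Nat.le_add_left b.deg a.deg))
    simp only [eval, deg, pow_succ]
    nlinarith [Nat.zero_le ((n + 2) ^ (a.deg + b.deg))]
  | minus a b iha ihb =>
    simp only [eval, deg]
    exact (Nat.sub_le _ _).trans ((iha h).trans (mono (by omega)))
  | times a b iha ihb =>
    simp only [bdd, Bool.and_eq_true] at h
    simp only [eval, deg, pow_add]
    exact Nat.mul_le_mul (iha h.1) (ihb h.2)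
  | get k a ih => simp [bdd] at h
  | ite c a b ihc iha ihb =>
    simp only [bdd, Bool.and_eq_true] at h
    simp only [eval, deg]
    split_ifs
    · exact (iha h.1).trans (mono (by omega))
    · exact (ihb h.2).trans (mono (by omega))

/-- The code of a well-formed expression computes its value, and no overflow occurs. -/
theorem exec_code {n C : ℕ} {ρ : List ℕ} (hρ : ∀ r, ρ.getD r 0 ≤ n) (e : Ex)
    (hwf : e.wf ρ.length = true) (hC : e.deg ≤ C) (d : ℕ) (hd : ρ.length ≤ d) (s : MachineState)
    (hs : ∀ r < ρ.length, s.reg r = ρ.getD r 0) :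
    ∃ t s', Exec ((n + 2) ^ C) (e.code d) s t s' ∧ t ≤ e.cost ∧ s'.reg d = e.eval ρ s.arr ∧
      (∀ r < d, s'.reg r = s.reg r) ∧ s'.arr = s.arr := by
  have mono : ∀ {a b : ℕ}, a ≤ b → (n + 2) ^ a ≤ (n + 2) ^ b := fun hab =>
    Nat.pow_le_pow_right (by omega) hab
  -- the two operands of a binary operation end up in registers `d` and `d + 1`
  have binary : ∀ a b : Ex,
      (∀ d, ρ.length ≤ d → ∀ s : MachineState, (∀ r < ρ.length, s.reg r = ρ.getD r 0) →
        ∃ t s', Exec ((n + 2) ^ C) (a.code d) s t s' ∧ t ≤ a.cost ∧ s'.reg d = a.eval ρ s.arr ∧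
          (∀ r < d, s'.reg r = s.reg r) ∧ s'.arr = s.arr) →
      (∀ d, ρ.length ≤ d → ∀ s : MachineState, (∀ r < ρ.length, s.reg r = ρ.getD r 0) →
        ∃ t s', Exec ((n + 2) ^ C) (b.code d) s t s' ∧ t ≤ b.cost ∧ s'.reg d = b.eval ρ s.arr ∧
          (∀ r < d, s'.reg r = s.reg r) ∧ s'.arr = s.arr) →
      ∀ d, ρ.length ≤ d → ∀ s : MachineState, (∀ r < ρ.length, s.reg r = ρ.getD r 0) →
      ∃ t₁ t₂ s₁ s₂, Exec ((n + 2) ^ C) (a.code d) s t₁ s₁ ∧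
        Exec ((n + 2) ^ C) (b.code (d + 1)) s₁ t₂ s₂ ∧ t₁ + t₂ ≤ a.cost + b.cost ∧
        s₂.reg d = a.eval ρ s.arr ∧ s₂.reg (d + 1) = b.eval ρ s.arr ∧
        (∀ r < d, s₂.reg r = s.reg r) ∧ s₂.arr = s.arr := by
    intro a b iha ihb d hd s hs
    obtain ⟨t₁, s₁, h₁, ht₁, hv₁, hr₁, hm₁⟩ := iha d hd s hs
    obtain ⟨t₂, s₂, h₂, ht₂, hv₂, hr₂, hm₂⟩ := ihb (d + 1) (by omega) s₁
      (fun r hr => (hr₁ r (by omega)).trans (hs r hr))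
    refine ⟨t₁, t₂, s₁, s₂, h₁, h₂, by omega, ?_, ?_, ?_, ?_⟩
    · rw [hr₂ d (by omega), hv₁]
    · rw [hv₂, hm₁]
    · intro r hr; rw [hr₂ r (by omega), hr₁ r hr]
    · rw [hm₂, hm₁]
  induction e generalizing d s with
  | var r =>
    simp only [wf, decide_eq_true_eq] at hwf
    refine ⟨_, _, .seq (.const _ _ _ (Nat.zero_le _)) (.sub _ _ _ _), le_refl _, ?_, ?_, ?_⟩
    · have : r ≠ d := by omega
      simp [MachineState.setReg, eval, this, hs r hwf]
    · intro r' hr'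
      have : r' ≠ d := by omega
      simp [MachineState.setReg, this]
    · simp [MachineState.setReg]
  | lit c =>
    refine ⟨_, _, .const _ _ _ ?_, le_refl _, ?_, ?_, ?_⟩
    · exact (eval_le hρ s.arr (lit c) rfl).trans (mono hC)
    · simp [MachineState.setReg, eval]
    · intro r' hr'
      have : r' ≠ d := by omega
      simp [MachineState.setReg, this]
    · simp [MachineState.setReg]
  | plus a b iha ihb =>
    simp only [wf, Bool.and_eq_true] at hwf
    simp only [deg] at hC
    obtain ⟨t₁, t₂, s₁, s₂, h₁, h₂, ht, hv, hv', hr, hm⟩ := binary a b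
      (fun d hd s hs => iha hwf.1.1.1 (by omega) d hd s hs)
      (fun d hd s hs => ihb hwf.1.1.2 (by omega) d hd s hs) d hd s hs
    refine ⟨_, _, .seq h₁ (.seq h₂ (.add _ _ _ _ ?_)), ?_, ?_, ?_, ?_⟩
    · rw [hv, hv']
      exact (eval_le hρ s.arr (plus a b) (by simp [bdd, hwf])).trans (mono hC)
    · simp only [cost]; omega
    · simp [MachineState.setReg, eval, hv, hv']
    · intro r' hr'
      have : r' ≠ d := by omega
      simp [MachineState.setReg, this, hr r' hr']
    · simp [MachineState.setReg, hm]
  | minus a b iha ihb =>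
    simp only [wf, Bool.and_eq_true] at hwf
    simp only [deg] at hC
    obtain ⟨t₁, t₂, s₁, s₂, h₁, h₂, ht, hv, hv', hr, hm⟩ := binary a b
      (fun d hd s hs => iha hwf.1 (by omega) d hd s hs)
      (fun d hd s hs => ihb hwf.2 (by omega) d hd s hs) d hd s hs
    refine ⟨_, _, .seq h₁ (.seq h₂ (.sub _ _ _ _)), ?_, ?_, ?_, ?_⟩
    · simp only [cost]; omega
    · simp [MachineState.setReg, eval, hv, hv']
    · intro r' hr'
      have : r' ≠ d := by omega
      simp [MachineState.setReg, this, hr r' hr']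
    · simp [MachineState.setReg, hm]
  | times a b iha ihb =>
    simp only [wf, Bool.and_eq_true] at hwf
    simp only [deg] at hC
    obtain ⟨t₁, t₂, s₁, s₂, h₁, h₂, ht, hv, hv', hr, hm⟩ := binary a b
      (fun d hd s hs => iha hwf.1.1.1 (by omega) d hd s hs)
      (fun d hd s hs => ihb hwf.1.1.2 (by omega) d hd s hs) d hd s hs
    refine ⟨_, _, .seq h₁ (.seq h₂ (.mul _ _ _ _ ?_)), ?_, ?_, ?_, ?_⟩
    · rw [hv, hv']
      exact (eval_le hρ s.arr (times a b) (by simp [bdd, hwf])).trans (mono hC)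
    · simp only [cost]; omega
    · simp [MachineState.setReg, eval, hv, hv']
    · intro r' hr'
      have : r' ≠ d := by omega
      simp [MachineState.setReg, this, hr r' hr']
    · simp [MachineState.setReg, hm]
  | get k a ih =>
    obtain ⟨t₁, s₁, h₁, ht₁, hv₁, hr₁, hm₁⟩ := ih hwf hC d hd s hs
    refine ⟨_, _, .seq h₁ (.load _ _ _ _), ?_, ?_, ?_, ?_⟩
    · simp only [cost]; omega
    · simp [MachineState.setReg, eval, hv₁, hm₁]
    · intro r' hr'
      have : r' ≠ d := by omega
      simp [MachineState.setReg, this, hr₁ r' hr']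
    · simp [MachineState.setReg, hm₁]
  | ite c a b ihc iha ihb =>
    simp only [wf, Bool.and_eq_true] at hwf
    simp only [deg] at hC
    obtain ⟨t₁, s₁, h₁, ht₁, hv₁, hr₁, hm₁⟩ := ihc hwf.1.1 (by omega) d hd s hs
    have hs₁ : ∀ r < ρ.length, s₁.reg r = ρ.getD r 0 := fun r hr =>
      (hr₁ r (by omega)).trans (hs r hr)
    by_cases hc : c.eval ρ s.arr = 0
    · obtain ⟨t₂, s₂, h₂, ht₂, hv₂, hr₂, hm₂⟩ := ihb hwf.2 (by omega) d hd s₁ hs₁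
      refine ⟨_, _, .seq h₁ (.branch_false (hv₁.trans hc) h₂), ?_, ?_, ?_, ?_⟩
      · simp only [cost]; omega
      · simp [eval, hc, hv₂, hm₁]
      · intro r' hr'; rw [hr₂ r' hr', hr₁ r' hr']
      · rw [hm₂, hm₁]
    · obtain ⟨t₂, s₂, h₂, ht₂, hv₂, hr₂, hm₂⟩ := iha hwf.1.2 (by omega) d hd s₁ hs₁
      refine ⟨_, _, .seq h₁ (.branch_true (fun h => hc (hv₁.symm.trans h)) h₂), ?_, ?_, ?_, ?_⟩
      · simp only [cost]; omega
      · simp [eval, hc, hv₂, hm₁]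
      · intro r' hr'; rw [hr₂ r' hr', hr₁ r' hr']
      · rw [hm₂, hm₁]

end Ex

/-- `iter m f M` applies `f 0`, ..., `f (m - 1)` to `M`, in this order. -/
def iter {α : Type*} (m : ℕ) (f : ℕ → α → α) (M : α) : α :=
  Nat.rec M (fun i x => f i x) m

theorem iter_zero {α : Type*} (f : ℕ → α → α) (M : α) : iter 0 f M = M := rfl

theorem iter_succ {α : Type*} (m : ℕ) (f : ℕ → α → α) (M : α) :
    iter (m + 1) f M = f m (iter m f M) := rfl

/-- The invariant rule for bounded loops. -/
theorem iter_invariant {α : Type*} {m : ℕ} {f : ℕ → α → α} {M : α} (I : ℕ → α → Prop)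
    (zero : I 0 M) (succ : ∀ i < m, ∀ x, I i x → I (i + 1) (f i x)) : I m (iter m f M) := by
  have : ∀ k ≤ m, I k (iter k f M) := by
    intro k
    induction k with
    | zero => intro _; exact zero
    | succ k ih => intro hk; exact succ k (by omega) _ (ih (by omega))
  exact this m le_rfl

/-- Statements. `put k a v` stores `v` in cell `a` of array `k`, and `loop b` runs `b` once for each
value below `n` of a new variable, which is appended to the environment. -/
inductive St where
  | put (k : ℕ) (a v : Ex)
  | skip
  | seq (p q : St)
  | ite (c : Ex) (p q : St)
  | loop (b : St)

namespace St

/-- The effect of a statement on the memory. Entry `0` of the environment is `n`. -/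
def run (ρ : List ℕ) : St → Mem → Mem
  | put k a v, M => M.set k (a.eval ρ M) (v.eval ρ M)
  | skip, M => M
  | seq p q, M => q.run ρ (p.run ρ M)
  | ite c p q, M => if c.eval ρ M ≠ 0 then p.run ρ M else q.run ρ M
  | loop b, M => iter (ρ.getD 0 0) (fun i M => b.run (ρ ++ [i]) M) M

/-- The code of a statement. Register `d` is the first one that is not occupied by the
environment. The test register of a loop is recomputed after each round, so that the body may use
it freely. -/
def code : St → ℕ → Program
  | put k a v, d => .seq (a.code d) (.seq (v.code (d + 1)) (.store k d (d + 1)))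
  | skip, d => .const d 0
  | seq p q, d => .seq (p.code d) (q.code d)
  | ite c p q, d => .seq (c.code d) (.branch d (p.code d) (q.code d))
  | loop b, d => .seq (.const d 0) (.seq (.sub (d + 1) 0 d) (.loop (d + 1)
      (.seq (b.code (d + 1)) (.seq (.const (d + 1) 1) (.seq (.add d d (d + 1))
        (.sub (d + 1) 0 d))))))

/-- The nesting depth of the loops. -/
def nest : St → ℕ
  | put _ _ _ => 0
  | skip => 0
  | seq p q => max p.nest q.nest
  | ite _ p q => max p.nest q.nest
  | loop b => b.nest + 1

/-- The constant factor of the running time. -/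
def factor : St → ℕ
  | put _ a v => a.cost + v.cost + 1
  | skip => 1
  | seq p q => p.factor + q.factor
  | ite c p q => c.cost + 1 + p.factor + q.factor
  | loop b => b.factor + 7

/-- The exponent of a bound for the words that the code uses. -/
def deg : St → ℕ
  | put _ a v => a.deg + v.deg
  | skip => 1
  | seq p q => p.deg + q.deg
  | ite c p q => c.deg + p.deg + q.deg
  | loop b => b.deg + 1

/-- Well-formed statements over an environment of length `L`. -/
def wf (L : ℕ) : St → Bool
  | put _ a v => a.wf L && v.wf L
  | skip => true
  | seq p q => p.wf L && q.wf L
  | ite c p q => c.wf L && p.wf L && q.wf L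
  | loop b => b.wf (L + 1)

/-- The code of a well-formed statement runs without overflow, has the effect `run` on the memory,
and takes time of the order `n ^ nest`. -/
theorem exec_code {n C : ℕ} (p : St) (hC : p.deg ≤ C) (ρ : List ℕ) (hρ : ∀ r, ρ.getD r 0 ≤ n)
    (h0 : ρ.getD 0 0 = n) (hlen : 0 < ρ.length)
    (hwf : p.wf ρ.length = true) (s : MachineState) (hs : ∀ r < ρ.length, s.reg r = ρ.getD r 0) :
    ∃ t s', Exec ((n + 2) ^ C) (p.code ρ.length) s t s' ∧ t ≤ p.factor * (n + 1) ^ p.nest ∧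
      (∀ r < ρ.length, s'.reg r = s.reg r) ∧ s'.arr = p.run ρ s.arr := by
  have one_le : ∀ k, 1 ≤ (n + 1) ^ k := fun k => Nat.one_le_pow _ _ (by omega)
  have mono : ∀ {a b : ℕ}, a ≤ b → (n + 1) ^ a ≤ (n + 1) ^ b := fun hab =>
    Nat.pow_le_pow_right (by omega) hab
  induction p generalizing ρ s with
  | put k a v =>
    simp only [wf, Bool.and_eq_true] at hwf
    simp only [deg] at hC
    obtain ⟨t₁, s₁, h₁, ht₁, hv₁, hr₁, hm₁⟩ := a.exec_code (C := C) hρ hwf.1 (by omega) _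
      le_rfl s hs
    obtain ⟨t₂, s₂, h₂, ht₂, hv₂, hr₂, hm₂⟩ := v.exec_code hρ hwf.2 (C := C) (by omega)
      (ρ.length + 1) (by omega) s₁ (fun r hr => (hr₁ r hr).trans (hs r hr))
    refine ⟨_, _, .seq h₁ (.seq h₂ (.store _ _ _ _)), ?_, ?_, ?_⟩
    · simp only [factor, nest, pow_zero, mul_one]; omega
    · intro r hr
      simp only [MachineState.setArr]
      rw [hr₂ r (by omega), hr₁ r hr]
    · have e : s₂.reg ρ.length = a.eval ρ s.arr := by rw [hr₂ _ (by omega), hv₁]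
      simp only [MachineState.setArr, run, Mem.set, e, hv₂, hm₂, hm₁]
  | skip =>
    refine ⟨_, _, .const _ _ _ (Nat.zero_le _), by simp [factor, nest], ?_, rfl⟩
    intro r hr
    have : r ≠ ρ.length := by omega
    simp [MachineState.setReg, this]
  | seq p q ihp ihq =>
    simp only [wf, Bool.and_eq_true] at hwf
    simp only [deg] at hC
    obtain ⟨t₁, s₁, h₁, ht₁, hr₁, hm₁⟩ := ihp (by omega) ρ hρ h0 hlen hwf.1 s hs
    obtain ⟨t₂, s₂, h₂, ht₂, hr₂, hm₂⟩ := ihq (by omega) ρ hρ h0 hlen hwf.2 s₁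
      (fun r hr => (hr₁ r hr).trans (hs r hr))
    refine ⟨_, _, .seq h₁ h₂, ?_, fun r hr => (hr₂ r hr).trans (hr₁ r hr), ?_⟩
    · simp only [factor, nest, add_mul]
      exact add_le_add (ht₁.trans (Nat.mul_le_mul_left _ (mono (le_max_left _ _))))
        (ht₂.trans (Nat.mul_le_mul_left _ (mono (le_max_right _ _))))
    · rw [hm₂, hm₁]; rfl
  | ite c p q ihp ihq =>
    simp only [wf, Bool.and_eq_true] at hwf
    simp only [deg] at hC
    obtain ⟨t₁, s₁, h₁, ht₁, hv₁, hr₁, hm₁⟩ := c.exec_code hρ hwf.1.1 (C := C) (by omega) _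
      le_rfl s hs
    have hs₁ : ∀ r < ρ.length, s₁.reg r = ρ.getD r 0 := fun r hr => (hr₁ r hr).trans (hs r hr)
    have bound : c.cost + 1 ≤ (c.cost + 1) * (n + 1) ^ max p.nest q.nest :=
      Nat.le_mul_of_pos_right _ (one_le _)
    by_cases hc : c.eval ρ s.arr = 0
    · obtain ⟨t₂, s₂, h₂, ht₂, hr₂, hm₂⟩ := ihq (by omega) ρ hρ h0 hlen hwf.2 s₁ hs₁
      refine ⟨_, _, .seq h₁ (.branch_false (hv₁.trans hc) h₂), ?_,
        fun r hr => (hr₂ r hr).trans (hr₁ r hr), ?_⟩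
      · simp only [factor, nest, add_mul] at *
        have := Nat.mul_le_mul_left q.factor (mono (le_max_right p.nest q.nest))
        omega
      · simp [run, hc, hm₂, hm₁]
    · obtain ⟨t₂, s₂, h₂, ht₂, hr₂, hm₂⟩ := ihp (by omega) ρ hρ h0 hlen hwf.1.2 s₁ hs₁
      refine ⟨_, _, .seq h₁ (.branch_true (fun h => hc (hv₁.symm.trans h)) h₂), ?_,
        fun r hr => (hr₂ r hr).trans (hr₁ r hr), ?_⟩
      · simp only [factor, nest, add_mul] at *
        have := Nat.mul_le_mul_left p.factor (mono (le_max_left p.nest q.nest))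
        omega
      · simp [run, hc, hm₂, hm₁]
  | loop b ih =>
    simp only [deg] at hC
    simp only [wf] at hwf
    set d := ρ.length with hd
    have hWn : n + 2 ≤ (n + 2) ^ C := Nat.le_self_pow (by omega) _
    set T := b.factor * (n + 1) ^ b.nest with hT
    -- the loop, from round `i` on
    have key : ∀ k i, i + k = n → ∀ s₁ : MachineState, s₁.reg d = i → s₁.reg (d + 1) = k →
        (∀ r < d, s₁.reg r = s.reg r) →
        s₁.arr = iter i (fun i M => b.run (ρ ++ [i]) M) s.arr →
        ∃ t s', Exec ((n + 2) ^ C) (.loop (d + 1) (.seq (b.code (d + 1))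
          (.seq (.const (d + 1) 1) (.seq (.add d d (d + 1)) (.sub (d + 1) 0 d))))) s₁ t s' ∧
          t ≤ k * (T + 4) + 1 ∧ (∀ r < d, s'.reg r = s.reg r) ∧
          s'.arr = iter n (fun i M => b.run (ρ ++ [i]) M) s.arr := by
      intro k
      induction k with
      | zero =>
        intro i hi s₁ _ h2 h3 h4
        exact ⟨_, _, .loop_done h2, by omega, h3, by rw [h4, ← hi, add_zero]⟩
      | succ k ihk =>
        intro i hi s₁ h1 h2 h3 h4
        have hlen' : (ρ ++ [i]).length = d + 1 := by simp [hd]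
        obtain ⟨t, s₂, he, ht, hr, hm⟩ := ih (by omega) (ρ ++ [i])
          (by
            intro r
            rcases lt_trichotomy r ρ.length with h | h | h
            · rw [List.getD_append _ _ _ _ h]; exact hρ r
            · rw [List.getD_append_right _ _ _ _ h.ge, h]; simp; omega
            · rw [List.getD_eq_default _ _ (by simp; omega)]; omega)
          (by rw [List.getD_append _ _ _ _ hlen]; exact h0) (by simp)
          (by rw [hlen']; exact hwf) s₁
          (by
            intro r hr
            rw [hlen'] at hr
            rcases Nat.lt_succ_iff_lt_or_eq.mp hr with h | h
            · rw [List.getD_append _ _ _ _ h, h3 r h, hs r h]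
            · rw [List.getD_append_right _ _ _ _ h.ge, h, h1]; simp [hd])
        rw [hlen'] at he hr
        have e1 : s₂.reg d = i := by rw [hr d (by omega), h1]
        have e0 : s₂.reg 0 = n := by
          rw [hr 0 (by omega), h3 0 hlen, hs 0 hlen, h0]
        have hd0 : (0 : ℕ) ≠ d := hlen.ne
        obtain ⟨t', s', he', ht', hr', hm'⟩ := ihk (i + 1) (by omega)
          ((((s₂.setReg (d + 1) 1).setReg d (i + 1))).setReg (d + 1) (n - (i + 1)))
          (by simp [MachineState.setReg]) (by simp [MachineState.setReg]; omega)
          (by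
            intro r hr'
            have h1 : r ≠ d := by omega
            have h2 : r ≠ d + 1 := by omega
            simp [MachineState.setReg, h1, h2, hr r (by omega), h3 r hr'])
          (by rw [iter_succ, ← h4]; simpa [MachineState.setReg] using hm)
        have step : Exec ((n + 2) ^ C) (.seq (b.code (d + 1))
            (.seq (.const (d + 1) 1) (.seq (.add d d (d + 1)) (.sub (d + 1) 0 d)))) s₁
            (t + (1 + (1 + 1)))
            ((((s₂.setReg (d + 1) 1).setReg d (i + 1))).setReg (d + 1) (n - (i + 1))) := by
          refine .seq he (.seq (.const _ _ _ (by omega)) (.seq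
            (s₁ := (s₂.setReg (d + 1) 1).setReg d (i + 1)) ?_ ?_))
          · have := Exec.add (W := (n + 2) ^ C) (s₂.setReg (d + 1) 1) d d (d + 1)
              (by simp [MachineState.setReg, e1]; omega)
            simpa [MachineState.setReg, e1] using this
          · have := Exec.sub (W := (n + 2) ^ C) ((s₂.setReg (d + 1) 1).setReg d (i + 1))
              (d + 1) 0 d
            simpa [MachineState.setReg, e0, hd0] using this
        refine ⟨_, _, .loop_step (by omega) step he', ?_, hr', hm'⟩
        have : (k + 1) * (T + 4) = k * (T + 4) + (T + 4) := by ring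
        omega
    have hd0 : (0 : ℕ) ≠ d := hlen.ne
    have e0 : s.reg 0 = n := by rw [hs 0 hlen, h0]
    obtain ⟨t, s', he, ht, hr, hm⟩ := key n 0 (by omega)
      ((s.setReg d 0).setReg (d + 1) n)
      (by simp [MachineState.setReg]) (by simp [MachineState.setReg])
      (by
        intro r hr'
        have h1 : r ≠ d := by omega
        have h2 : r ≠ d + 1 := by omega
        simp [MachineState.setReg, h1, h2])
      (by simp [MachineState.setReg, iter_zero])
    refine ⟨_, s', .seq (.const _ _ _ (Nat.zero_le _)) (.seq (t₁ := 1) (t₂ := t)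
      (s₁ := (s.setReg d 0).setReg (d + 1) n) ?_ he), ?_, hr, ?_⟩
    · have := Exec.sub (W := (n + 2) ^ C) (s.setReg d 0) (d + 1) 0 d
      simpa [MachineState.setReg, e0, hd0] using this
    · have h1 : n * (T + 4) + 3 ≤ (b.factor + 7) * (n + 1) ^ (b.nest + 1) := by
        have := one_le b.nest
        rw [pow_succ, hT]
        generalize (n + 1) ^ b.nest = X at *
        nlinarith [Nat.zero_le (b.factor * X), Nat.zero_le (n * (X - 1)),
          Nat.mul_le_mul_left n this]
      simp only [factor, nest]
      omega
    · rw [hm, run, h0]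

end St

/-- The program of a statement over the environment that consists of `n` alone. -/
def St.program (p : St) : Program := p.code 1

/-- A well-formed statement whose loops are nested `m` deep yields a program that runs in time
`O(n ^ m)` on words of `O(log n)` bits. -/
theorem St.exec_program (p : St) (hwf : p.wf 1 = true) :
    ∃ C₀, ∀ C ≥ C₀, ∀ (n : ℕ) (s : MachineState), s.reg 0 = n →
      ∃ t s', Exec ((n + 2) ^ C) p.program s t s' ∧ t ≤ C * (n ^ p.nest + 1) ∧
        s'.reg 0 = n ∧ s'.arr = p.run [n] s.arr := by
  refine ⟨p.deg + p.factor * 2 ^ p.nest, fun C hC n s hs => ?_⟩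
  obtain ⟨t, s', he, ht, hr, hm⟩ := p.exec_code (n := n) (C := C) (by omega) [n]
    (by
      intro r
      rcases r with _ | r <;> simp)
    rfl (by simp) hwf s (by
      intro r hr
      obtain rfl : r = 0 := by simpa using hr
      simpa using hs)
  refine ⟨t, s', he, ?_, by rw [hr 0 (by simp), hs], hm⟩
  have hpow : (n + 1) ^ p.nest ≤ 2 ^ p.nest * (n ^ p.nest + 1) := by
    rcases Nat.eq_zero_or_pos n with h | h
    · subst h
      have : 1 ≤ 2 ^ p.nest := Nat.one_le_two_pow
      simp only [zero_add, one_pow]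
      nlinarith [Nat.zero_le (0 ^ p.nest)]
    · calc (n + 1) ^ p.nest ≤ (2 * n) ^ p.nest := Nat.pow_le_pow_left (by omega) _
        _ = 2 ^ p.nest * n ^ p.nest := mul_pow _ _ _
        _ ≤ _ := Nat.mul_le_mul_left _ (Nat.le_succ _)
  calc t ≤ p.factor * (n + 1) ^ p.nest := ht
    _ ≤ p.factor * (2 ^ p.nest * (n ^ p.nest + 1)) := Nat.mul_le_mul_left _ hpow
    _ = (p.factor * 2 ^ p.nest) * (n ^ p.nest + 1) := by ring
    _ ≤ C * (n ^ p.nest + 1) := Nat.mul_le_mul_right _ (by omega)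

/-! ### Structural observability -/

/-- Every state variable has a directed path to `S`. -/
def Covers {n : ℕ} (P : Pattern n) (S : Finset (Fin n)) : Prop := ∀ v, ∃ s ∈ S, Reach P v s

/-- The state variables outside `S` can be matched, along edges that leave them, to distinct state
variables. The matching is recorded as a permutation, whose values on `S` are irrelevant. -/
def Matchable {n : ℕ} (P : Pattern n) (S : Finset (Fin n)) : Prop :=
  ∃ π : Equiv.Perm (Fin n), ∀ i, i ∉ S → Edge P i (π i)

theorem observabilityMatrix_mulVec {n : ℕ} (A : Matrix (Fin n) (Fin n) ℝ) (S : Finset (Fin n))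
    (v : Fin n → ℝ) (k : Fin n) (s : S) :
    (observabilityMatrix A S).mulVec v (k, s) = ((A ^ (k : ℕ)).mulVec v) s := by
  simp only [Matrix.mulVec, dotProduct, observabilityMatrix, sensorMatrix]
  refine Finset.sum_congr rfl fun i _ => ?_
  congr 1
  simp [Matrix.mul_apply, Matrix.one_apply]

theorem isObservable_iff {n : ℕ} (A : Matrix (Fin n) (Fin n) ℝ) (S : Finset (Fin n)) :
    IsObservable A S ↔
      ∀ v : Fin n → ℝ, (∀ k < n, ∀ s ∈ S, ((A ^ k).mulVec v) s = 0) → v = 0 := by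
  have hker : IsObservable A S ↔ LinearMap.ker (observabilityMatrix A S).mulVecLin = ⊥ := by
    have h := LinearMap.finrank_range_add_finrank_ker (observabilityMatrix A S).mulVecLin
    simp only [Module.finrank_fintype_fun_eq_card, Fintype.card_fin] at h
    rw [IsObservable, Matrix.rank, ← Submodule.finrank_eq_zero (R := ℝ)]
    omega
  rw [hker, LinearMap.ker_eq_bot']
  refine forall_congr' fun v => imp_congr_left ?_
  rw [Matrix.mulVecLin_apply]
  constructor
  · intro h k hk s hs
    have := congrFun h (⟨k, hk⟩, ⟨s, hs⟩)
    rwa [observabilityMatrix_mulVec] at this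
  · intro h
    funext ⟨k, s⟩
    rw [observabilityMatrix_mulVec]
    exact h k k.2 s s.2

/-- By the Cayley–Hamilton theorem, an output that vanishes for the powers below `n` vanishes for
all powers. -/
theorem pow_mulVec_eq_zero {n : ℕ} (A : Matrix (Fin n) (Fin n) ℝ) (v : Fin n → ℝ) (s : Fin n)
    (h : ∀ k < n, ((A ^ k).mulVec v) s = 0) (k : ℕ) : ((A ^ k).mulVec v) s = 0 := by
  have hn : 0 < n := Fin.pos s
  have hmonic := A.charpoly_monic
  have hdeg : A.charpoly.natDegree = n := by
    rw [Matrix.charpoly_natDegree_eq_dim, Fintype.card_fin]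
  have hlt : (Polynomial.X ^ k %ₘ A.charpoly).natDegree < n := by
    have := Polynomial.natDegree_modByMonic_lt (Polynomial.X ^ k) hmonic (by
      intro h1
      rw [h1, Polynomial.natDegree_one] at hdeg
      omega)
    omega
  rw [Matrix.pow_eq_aeval_mod_charpoly A k, Polynomial.aeval_eq_sum_range' hlt,
    Matrix.sum_mulVec, Finset.sum_apply]
  refine Finset.sum_eq_zero fun i hi => ?_
  rw [Matrix.smul_mulVec, Pi.smul_apply, h i (Finset.mem_range.mp hi), smul_zero]

/-- The Popov–Belevitch–Hautus test: a system without an unobservable complex eigenvector is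
observable. -/
theorem isObservable_of_eigenvector {n : ℕ} (A : Matrix (Fin n) (Fin n) ℝ) (S : Finset (Fin n))
    (h : ∀ (μ : ℂ) (v : Fin n → ℂ), (A.map Complex.ofReal).mulVec v = μ • v →
      (∀ s ∈ S, v s = 0) → v = 0) : IsObservable A S := by
  rw [isObservable_iff]
  intro u hu
  by_contra hne
  set B := A.map Complex.ofReal with hB
  let N : Submodule ℂ (Fin n → ℂ) :=
    { carrier := {v | ∀ k : ℕ, ∀ s ∈ S, ((B ^ k).mulVec v) s = 0}
      add_mem' := by
        intro a b ha hb k s hs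
        rw [Matrix.mulVec_add, Pi.add_apply, ha k s hs, hb k s hs, add_zero]
      zero_mem' := by intro k s _; simp
      smul_mem' := by
        intro c a ha k s hs
        rw [Matrix.mulVec_smul, Pi.smul_apply, ha k s hs, smul_zero] }
  have huN : (fun i => (u i : ℂ)) ∈ N := by
    intro k s hs
    have h1 := pow_mulVec_eq_zero A u s (fun k hk => hu k hk s hs) k
    have h2 : B ^ k = (A ^ k).map Complex.ofRealHom := by
      rw [Matrix.map_pow]; rfl
    have h3 := RingHom.map_mulVec Complex.ofRealHom (A ^ k) u s
    rw [h1, map_zero] at h3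
    rw [h2]
    exact h3.symm
  have hnt : Nontrivial N := by
    refine ⟨⟨⟨_, huN⟩, 0, fun h0 => hne ?_⟩⟩
    funext i
    have := congrFun (congrArg Subtype.val h0) i
    simpa using this
  have hmaps : ∀ v ∈ N, Matrix.toLin' B v ∈ N := by
    intro v hv k s hs
    rw [Matrix.toLin'_apply, Matrix.mulVec_mulVec, ← pow_succ]
    exact hv (k + 1) s hs
  obtain ⟨μ, hμ⟩ := Module.End.exists_eigenvalue ((Matrix.toLin' B).restrict hmaps)
  obtain ⟨v, hv⟩ := hμ.exists_hasEigenvector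
  refine hv.2 (Subtype.ext (h μ v.1 ?_ ?_))
  · have := congrArg Subtype.val hv.apply_eq_smul
    simpa using this
  · intro s hs
    simpa using v.2 0 s hs

theorem Covers.exists_height {n : ℕ} {P : Pattern n} {S : Finset (Fin n)} (h : Covers P S) :
    ∃ ht : Fin n → ℕ, ∀ i, i ∉ S → ∃ j, Edge P i j ∧ ht j < ht i := by
  classical
  let D : ℕ → Fin n → Prop := fun k => Nat.rec (· ∈ S) (fun _ p i => p i ∨ ∃ j, Edge P i j ∧ p j) k
  have hD : ∀ i, ∃ k, D k i := by
    intro i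
    obtain ⟨s, hs, hr⟩ := h i
    induction hr using Relation.ReflTransGen.head_induction_on with
    | refl => exact ⟨0, hs⟩
    | head hab _ ih =>
      obtain ⟨k, hk⟩ := ih
      exact ⟨k + 1, Or.inr ⟨_, hab, hk⟩⟩
  refine ⟨fun i => sInf {k | D k i}, fun i hi => ?_⟩
  have hspec : D (sInf {k | D k i}) i := Nat.sInf_mem (s := {k | D k i}) (hD i)
  rcases hk : sInf {k | D k i} with _ | k
  · rw [hk] at hspec
    exact absurd hspec hi
  · rw [hk] at hspec
    rcases hspec with hp | ⟨j, hj, hp⟩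
    · exact absurd hp (Nat.notMem_of_lt_sInf (s := {k | D k i}) (by omega))
    · refine ⟨j, hj, ?_⟩
      change sInf {k | D k j} < sInf {k | D k i}
      rw [hk]
      exact Nat.lt_succ_of_le (Nat.sInf_le hp)

/-- Every permutation has a system `c` of representatives of its cycles that minimize a given
height. -/
theorem exists_cycle_representative {n : ℕ} (π : Equiv.Perm (Fin n)) (ht : Fin n → ℕ) :
    ∃ c : Fin n → Fin n, (∀ i, π.SameCycle i (c i)) ∧ (∀ i j, π.SameCycle i j → c i = c j) ∧
      ∀ i, ht (c i) ≤ ht i := by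
  classical
  have hex : ∀ q : Quotient (Equiv.Perm.SameCycle.setoid π), ∃ i : Fin n,
      Quotient.mk (Equiv.Perm.SameCycle.setoid π) i = q ∧
      ∀ j, Quotient.mk (Equiv.Perm.SameCycle.setoid π) j = q → ht i ≤ ht j := by
    intro q
    obtain ⟨i₀, rfl⟩ := Quotient.exists_rep q
    obtain ⟨i, hi, hmin⟩ := Finset.exists_min_image
      (Finset.univ.filter (fun i => Quotient.mk (Equiv.Perm.SameCycle.setoid π) i =
        Quotient.mk (Equiv.Perm.SameCycle.setoid π) i₀)) ht ⟨i₀, by simp⟩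
    exact ⟨i, by simpa using hi, fun j hj => hmin j (by simpa using hj)⟩
  choose src h1 h2 using hex
  refine ⟨fun i => src (Quotient.mk _ i), fun i => ?_, fun i j hij => ?_, fun i => h2 _ i rfl⟩
  · exact (Quotient.exact (h1 (Quotient.mk _ i)) : π.SameCycle _ _).symm
  · exact congrArg src (Quotient.sound hij)

/-- An unobservable eigenvector is impossible for the following weights. The cycles of `π` have
pairwise different weights `w`, and the representative `q` of every cycle that avoids `S` has one
link, to a vertex `next q` on a cycle of smaller height. The cycles on which an eigenvector does not
vanish are all reached by links from the only cycle whose weight is the modulus of the eigenvalue,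
hence form a chain, and on each of them the eigenvector has no zero. Below the lowest one the
eigenvector vanishes, which contradicts the equation at the end of the link that leaves it. -/
theorem eigenvector_eq_zero {n : ℕ} (S : Finset (Fin n)) (π : Equiv.Perm (Fin n))
    (ht : Fin n → ℕ) (c next : Fin n → Fin n) (hc₁ : ∀ i, π.SameCycle i (c i))
    (hc₂ : ∀ i j, π.SameCycle i j → c i = c j) (hc₃ : ∀ i, ht (c i) ≤ ht i)
    (hnext : ∀ i, i ∉ S → ht (next i) < ht i) (μ : ℂ) (v : Fin n → ℂ)
    (hS : ∀ s ∈ S, v s = 0)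
    (heq : ∀ i, μ * v (π i) = ((c i : ℕ) + 1 : ℝ) * v i +
      ∑ q, if c q = q ∧ q ∉ S ∧ next q = π i then v q else 0) : v = 0 := by
  classical
  have hcc : ∀ i, c (c i) = c i := fun i => (hc₂ _ _ (hc₁ i)).symm
  have hcπ : ∀ i, c (π i) = c i := fun i => (hc₂ i (π i) ⟨1, by simp⟩).symm
  let NZ : Fin n → Prop := fun q => ∃ i, c i = q ∧ v i ≠ 0
  let Lk : Fin n → Fin n → Prop := fun a b => c a = a ∧ a ∉ S ∧ c (next a) = b
  have hNZc : ∀ q, NZ q → c q = q := by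
    rintro q ⟨i, rfl, _⟩; exact hcc i
  have hLk : ∀ a b, Lk a b → ht b < ht a := by
    rintro a b ⟨_, ha, rfl⟩
    exact (hc₃ _).trans_lt (hnext a ha)
  have hpath : ∀ a b, Relation.ReflTransGen Lk a b → ht b ≤ ht a := by
    intro a b h
    induction h with
    | refl => exact le_rfl
    | tail _ h ih => exact (hLk _ _ h).le.trans ih
  have huniq : Relator.RightUnique Lk := fun a b b' h h' => h.2.2.symm.trans h'.2.2
  -- a link that contributes to the equation at a vertex of the cycle of `q`
  have hcontr : ∀ i q', (c q' = q' ∧ q' ∉ S ∧ next q' = π i) → Lk q' (c i) := by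
    rintro i q' ⟨h1, h2, h3⟩
    exact ⟨h1, h2, by rw [h3, hcπ]⟩
  have ha : ∀ q, NZ q → ‖μ‖ = (q : ℕ) + 1 ∨ ∃ q', Lk q' q ∧ v q' ≠ 0 := by
    rintro q ⟨i₀, hi₀, hv₀⟩
    by_contra hcon
    push Not at hcon
    obtain ⟨hcon₁, hcon₂⟩ := hcon
    have h1 : ∀ i, c i = q → μ * v (π i) = ((q : ℕ) + 1 : ℝ) * v i := by
      intro i hi
      rw [heq i, Finset.sum_eq_zero, add_zero, hi]
      intro q' _
      split_ifs with h
      · exact hcon₂ q' (hi ▸ hcontr i q' h)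
      · rfl
    have h2 : ∑ i ∈ Finset.univ.filter (fun i => c i = q), ‖v (π i)‖ =
        ∑ i ∈ Finset.univ.filter (fun i => c i = q), ‖v i‖ :=
      Finset.sum_equiv π (by simp [hcπ]) (by simp)
    have h3 : ‖μ‖ * ∑ i ∈ Finset.univ.filter (fun i => c i = q), ‖v i‖ =
        ((q : ℕ) + 1 : ℝ) * ∑ i ∈ Finset.univ.filter (fun i => c i = q), ‖v i‖ := by
      conv_lhs => rw [← h2]
      rw [Finset.mul_sum, Finset.mul_sum]
      refine Finset.sum_congr rfl fun i hi => ?_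
      have h4 := congrArg norm (h1 i (by simpa using hi))
      rw [norm_mul, norm_mul, Complex.norm_real, Real.norm_of_nonneg (by positivity)] at h4
      exact h4
    have h5 : 0 < ∑ i ∈ Finset.univ.filter (fun i => c i = q), ‖v i‖ :=
      Finset.sum_pos' (fun i _ => norm_nonneg _) ⟨i₀, by simpa using hi₀, norm_pos_iff.mpr hv₀⟩
    exact hcon₁ (mul_right_cancel₀ h5.ne' h3)
  have hb : ∀ (m : ℕ) (q : Fin n), (∑ i, ht i) - ht q = m → NZ q → ∃ q₀ : Fin n,
      ‖μ‖ = (q₀ : ℕ) + 1 ∧ Relation.ReflTransGen Lk q₀ q := by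
    intro m
    induction m using Nat.strong_induction_on with
    | _ m ih =>
      intro q hm hq
      rcases ha q hq with h | ⟨q', hl, hv⟩
      · exact ⟨q, h, .refl⟩
      · have h1 := hLk _ _ hl
        have h2 : ht q' ≤ ∑ i, ht i := Finset.single_le_sum (f := ht) (fun _ _ => Nat.zero_le _)
          (Finset.mem_univ q')
        obtain ⟨q₀, h3, h4⟩ := ih ((∑ i, ht i) - ht q') (by omega) q' rfl ⟨q', hl.1, hv⟩
        exact ⟨q₀, h3, h4.tail hl⟩
  have hchain : ∀ q q₁ q₂, NZ q₁ → NZ q₂ → Lk q₁ q → Lk q₂ q → q₁ = q₂ := by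
    intro q q₁ q₂ hn₁ hn₂ hl₁ hl₂
    obtain ⟨a, ha₁, hp₁⟩ := hb _ q₁ rfl hn₁
    obtain ⟨b, hb₁, hp₂⟩ := hb _ q₂ rfl hn₂
    obtain rfl : a = b := by
      have : ((a : ℕ) : ℝ) = (b : ℕ) := by linarith
      exact Fin.ext (by exact_mod_cast this)
    have aux : ∀ x y, Lk x q → Lk y q → Relation.ReflTransGen Lk x y → x = y := by
      intro x y hx hy h
      rcases Relation.ReflTransGen.cases_head h with h | ⟨z, hz, hzy⟩
      · exact h
      · have e := huniq hz hx
        subst e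
        have := hpath _ _ hzy
        have := hLk _ _ hy
        omega
    rcases Relation.ReflTransGen.total_of_right_unique huniq hp₁ hp₂ with h | h
    · exact aux _ _ hl₁ hl₂ h
    · exact (aux _ _ hl₂ hl₁ h).symm
  have hfull : ∀ q, NZ q → ∀ i, c i = q → v i ≠ 0 := by
    intro q hq
    have hμ : μ ≠ 0 := by
      obtain ⟨q₀, h1, _⟩ := hb _ q rfl hq
      rw [← norm_pos_iff, h1]
      positivity
    obtain ⟨y, hy, hprop⟩ : ∃ y, c y = q ∧ ∀ i, c i = q → π i ≠ y →
        μ * v (π i) = ((c i : ℕ) + 1 : ℝ) * v i := by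
      by_cases hex : ∃ q₁, Lk q₁ q ∧ v q₁ ≠ 0
      · obtain ⟨q₁, hl, hv⟩ := hex
        refine ⟨next q₁, hl.2.2, fun i hi hne => ?_⟩
        rw [heq i, Finset.sum_eq_zero, add_zero]
        intro q' _
        split_ifs with h
        · by_contra hv'
          obtain rfl := hchain q q₁ q' ⟨q₁, hl.1, hv⟩ ⟨q', h.1, hv'⟩ hl (hi ▸ hcontr i q' h)
          exact hne h.2.2.symm
        · rfl
      · push Not at hex
        refine ⟨q, hNZc q hq, fun i hi _ => ?_⟩
        rw [heq i, Finset.sum_eq_zero, add_zero]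
        intro q' _
        split_ifs with h
        · exact hex q' (hi ▸ hcontr i q' h)
        · rfl
    have hpow : ∀ k : ℕ, c ((π ^ k) y) = q ∧ (v ((π ^ k) y) = 0 ↔ v y = 0) := by
      intro k
      induction k with
      | zero => simp [hy]
      | succ k ih =>
        rw [pow_succ', Equiv.Perm.mul_apply]
        refine ⟨by rw [hcπ, ih.1], ?_⟩
        by_cases h : π ((π ^ k) y) = y
        · rw [h]
        · rw [← ih.2]
          have h1 := hprop _ ih.1 h
          have h2 : (((c ((π ^ k) y) : ℕ) + 1 : ℝ) : ℂ) ≠ 0 := by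
            rw [Complex.ofReal_ne_zero]; positivity
          constructor
          · intro h0
            rw [h0, mul_zero] at h1
            exact (mul_eq_zero.mp h1.symm).resolve_left h2
          · intro h0
            rw [h0, mul_zero] at h1
            exact (mul_eq_zero.mp h1).resolve_left hμ
    have hall : ∀ i, c i = q → (v i = 0 ↔ v y = 0) := by
      intro i hi
      have hsame : π.SameCycle y i :=
        (hc₁ y).trans (by rw [hy, ← hi]; exact (hc₁ i).symm)
      obtain ⟨k, _, hk⟩ := hsame.exists_pow_eq'
      rw [← hk]
      exact (hpow k).2
    obtain ⟨i₀, hi₀, hv₀⟩ := hq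
    intro i hi hv
    exact hv₀ ((hall i₀ hi₀).mpr ((hall i hi).mp hv))
  by_contra hne
  obtain ⟨i₀, hi₀⟩ := Function.ne_iff.mp hne
  obtain ⟨q, hq, hmin⟩ := Finset.exists_min_image (Finset.univ.filter NZ) ht
    ⟨c i₀, by simpa using ⟨i₀, rfl, hi₀⟩⟩
  simp only [Finset.mem_filter, Finset.mem_univ, true_and] at hq hmin
  have hcq := hNZc q hq
  have hvq : v q ≠ 0 := hfull q hq q hcq
  have hqS : q ∉ S := fun h => hvq (hS q h)
  have hl : Lk q (c (next q)) := ⟨hcq, hqS, rfl⟩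
  have hzero : ∀ i, c i = c (next q) → v i = 0 := by
    intro i hi
    by_contra hv
    have := hmin _ ⟨i, hi, hv⟩
    have := hLk _ _ hl
    omega
  have h1 := heq (π.symm (next q))
  have h2 : c (π.symm (next q)) = c (next q) := by
    rw [← hcπ, Equiv.apply_symm_apply]
  rw [Equiv.apply_symm_apply, hzero _ rfl, hzero _ h2, mul_zero, mul_zero, zero_add,
    Finset.sum_eq_single q] at h1
  · rw [if_pos ⟨hcq, hqS, rfl⟩] at h1
    exact hvq h1.symm
  · intro q' _ hne'
    split_ifs with h
    · by_contra hv'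
      exact hne' (hchain (c (next q)) q' q ⟨q', h.1, hv'⟩ hq ⟨h.1, h.2.1, by rw [h.2.2]⟩ hl)
    · rfl
  · simp

theorem isFeasible_of_matchable_of_covers {n : ℕ} {P : Pattern n} {S : Finset (Fin n)}
    (hm : Matchable P S) (hr : Covers P S) : IsFeasible P S := by
  classical
  obtain ⟨π, hπ⟩ := hm
  obtain ⟨ht, hht⟩ := hr.exists_height
  obtain ⟨c, hc₁, hc₂, hc₃⟩ := exists_cycle_representative π ht
  choose! next hnext using hht
  let A : Matrix (Fin n) (Fin n) ℝ := fun j i =>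
    (if π i = j ∧ i ∉ S then ((c i : ℕ) + 1 : ℝ) else 0) +
      (if c i = i ∧ i ∉ S ∧ next i = j then 1 else 0)
  refine ⟨A, ?_, isObservable_of_eigenvector A S ?_⟩
  · intro j i hji
    have h1 : ¬ (π i = j ∧ i ∉ S) := by
      rintro ⟨rfl, hi⟩
      have := hπ i hi
      rw [Edge, hji] at this
      exact Bool.false_ne_true this
    have h2 : ¬ (c i = i ∧ i ∉ S ∧ next i = j) := by
      rintro ⟨_, hi, rfl⟩
      have := (hnext i hi).1
      rw [Edge, hji] at this
      exact Bool.false_ne_true this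
    simp only [A, if_neg h1, if_neg h2, add_zero]
  · intro μ v hv hS
    refine eigenvector_eq_zero S π ht c next hc₁ hc₂ hc₃ (fun i hi => (hnext i hi).2) μ v hS ?_
    intro i
    have h1 := congrFun hv (π i)
    rw [Pi.smul_apply, smul_eq_mul] at h1
    have hent : ∀ j q, A.map Complex.ofReal j q * v q =
        (if π q = j ∧ q ∉ S then ((c q : ℕ) + 1 : ℝ) * v q else 0) +
          if c q = q ∧ q ∉ S ∧ next q = j then v q else 0 := by
      intro j q
      rw [Matrix.map_apply]
      simp only [A, Complex.ofReal_add, add_mul]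
      congr 1 <;> split_ifs <;> push_cast <;> ring
    rw [← h1]
    simp only [Matrix.mulVec, dotProduct, hent, Finset.sum_add_distrib]
    congr 1
    rw [Finset.sum_eq_single i]
    · by_cases hi : i ∈ S
      · simp [hi, hS i hi]
      · simp [hi]
    · intro b _ hb
      simp [hb]
    · simp

theorem covers_of_isFeasible {n : ℕ} {P : Pattern n} {S : Finset (Fin n)} (h : IsFeasible P S) :
    Covers P S := by
  classical
  obtain ⟨A, hA, hobs⟩ := h
  rw [isObservable_iff] at hobs
  intro v
  by_contra hcon
  push Not at hcon
  have key : ∀ (k : ℕ) (j : Fin n), ((A ^ k).mulVec (Pi.single v 1)) j ≠ 0 → Reach P v j := by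
    intro k
    induction k with
    | zero =>
      intro j hj
      simp only [pow_zero, Matrix.one_mulVec] at hj
      have : j = v := by
        by_contra hne
        exact hj (Pi.single_eq_of_ne hne _)
      subst this
      exact .refl
    | succ k ih =>
      intro j hj
      rw [pow_succ', ← Matrix.mulVec_mulVec] at hj
      obtain ⟨i, _, hi⟩ := Finset.exists_ne_zero_of_sum_ne_zero
        (show ∑ i, A j i * ((A ^ k).mulVec (Pi.single v 1)) i ≠ 0 from hj)
      refine (ih i (right_ne_zero_of_mul hi)).tail ?_
      by_contra he
      exact left_ne_zero_of_mul hi (hA j i (by simpa [Edge] using he))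
  have h0 := hobs (Pi.single v 1) (fun k _ s hs => by
    by_contra hne
    exact hcon s hs (key k s hne))
  have := congrFun h0 v
  simp at this

/-- Necessity of the matching: by the marriage theorem and a dimension count, since a vector
supported on `X` is determined by its image under `A`, which is supported on the out-neighbours of
`X`, and its entries at the sensors. -/
theorem matchable_of_isFeasible {n : ℕ} {P : Pattern n} {S : Finset (Fin n)}
    (h : IsFeasible P S) : Matchable P S := by
  classical
  obtain ⟨A, hA, hobs⟩ := h
  rw [isObservable_iff] at hobs
  have hinj : ∀ w : Fin n → ℝ, A.mulVec w = 0 → (∀ s ∈ S, w s = 0) → w = 0 := by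
    intro w h1 h2
    refine hobs w fun k _ s hs => ?_
    rcases k with _ | k
    · simpa using h2 s hs
    · rw [pow_succ, ← Matrix.mulVec_mulVec, h1, Matrix.mulVec_zero, Pi.zero_apply]
  let t : Fin n → Finset (Fin n ⊕ Fin n) := fun i =>
    (Finset.univ.filter (Edge P i)).disjSum (if i ∈ S then {i} else ∅)
  obtain ⟨g, hg, hgt⟩ := (Finset.all_card_le_biUnion_card_iff_exists_injective t).mp (by
    intro X
    let Y := X.biUnion t
    let f : (Fin n → ℝ) →ₗ[ℝ] (Fin n ⊕ Fin n → ℝ) :=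
      LinearMap.pi (Sum.elim (fun j => LinearMap.proj j ∘ₗ A.mulVecLin)
        (fun j => LinearMap.proj j))
    let e : (X → ℝ) →ₗ[ℝ] (Fin n → ℝ) := Function.ExtendByZero.linearMap ℝ Subtype.val
    have he : ∀ u : X → ℝ, ∀ i, i ∉ X → e u i = 0 := by
      intro u i hi
      refine Function.extend_apply' _ _ _ ?_
      rintro ⟨a, rfl⟩
      exact hi a.2
    let F : (X → ℝ) →ₗ[ℝ] (Y → ℝ) :=
      LinearMap.funLeft ℝ ℝ (Subtype.val : Y → Fin n ⊕ Fin n) ∘ₗ f ∘ₗ e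
    have hF : Function.Injective F := by
      rw [← LinearMap.ker_eq_bot, LinearMap.ker_eq_bot']
      intro u hu
      have hY : ∀ y ∈ Y, f (e u) y = 0 := fun y hy => congrFun hu ⟨y, hy⟩
      have h0 : e u = 0 := by
        refine hinj _ ?_ ?_
        · funext j
          by_contra hj
          obtain ⟨i, _, hi⟩ := Finset.exists_ne_zero_of_sum_ne_zero
            (show ∑ i, A j i * e u i ≠ 0 from hj)
          have hiX : i ∈ X := by
            by_contra hiX
            exact right_ne_zero_of_mul hi (he u i hiX)
          have hed : Edge P i j := by
            by_contra hed
            exact left_ne_zero_of_mul hi (hA j i (by simpa [Edge] using hed))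
          refine hj (hY (Sum.inl j) (Finset.mem_biUnion.mpr ⟨i, hiX, ?_⟩))
          simpa [t] using hed
        · intro s hs
          by_cases hsX : s ∈ X
          · exact hY (Sum.inr s) (Finset.mem_biUnion.mpr ⟨s, hsX, by simp [t, hs]⟩)
          · exact he u s hsX
      funext a
      have h1 := congrFun h0 a.1
      have h2 : e u a.1 = u a := Subtype.val_injective.extend_apply u 0 a
      rw [← h2, h1]; rfl
    have hfin := LinearMap.finrank_le_finrank_of_injective hF
    simpa [Module.finrank_fintype_fun_eq_card] using hfin)
  let p : Fin n → Prop := fun i => (g i).isLeft = true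
  let q : Fin n → Prop := fun j => ∃ i, g i = Sum.inl j
  have hp : ∀ i : {i // p i}, ∃ j, g i = Sum.inl j := fun i => Sum.isLeft_iff.mp i.2
  choose m hm using hp
  let φ : {i // p i} ≃ {j // q j} := Equiv.ofBijective (fun i => ⟨m i, i, hm i⟩) (by
    constructor
    · intro a b hab
      have : m a = m b := congrArg Subtype.val hab
      exact Subtype.ext (hg (by rw [hm a, hm b, this]))
    · rintro ⟨j, i, hi⟩
      have hpi : p i := by simp [p, hi]
      refine ⟨⟨i, hpi⟩, Subtype.ext ?_⟩
      have := hm ⟨i, hpi⟩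
      rw [hi] at this
      exact (Sum.inl_injective this).symm)
  refine ⟨φ.extendSubtype, fun i hi => ?_⟩
  have hti := hgt i
  have hpi : p i := by
    rcases hgi : g i with j | j
    · simp [p, hgi]
    · rw [hgi] at hti
      simp [t, hi] at hti
  rw [Equiv.extendSubtype_apply_of_mem φ i hpi]
  rw [hm ⟨i, hpi⟩] at hti
  change Edge P i (m ⟨i, hpi⟩)
  simpa [t] using hti

/-- A set of dedicated sensors is feasible if and only if every state variable has a path to it and
the state variables outside it can be matched. -/
theorem isFeasible_iff {n : ℕ} {P : Pattern n} {S : Finset (Fin n)} :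
    IsFeasible P S ↔ Matchable P S ∧ Covers P S :=
  ⟨fun h => ⟨matchable_of_isFeasible h, covers_of_isFeasible h⟩,
    fun h => isFeasible_of_matchable_of_covers h.1 h.2⟩

/-! ### Decompositions and matchings -/

namespace PCDecomposition

variable {n : ℕ} {P : Pattern n}

theorem eq_of_mem (D : PCDecomposition P) {l l' : List (Fin n)} (hl : l ∈ D.paths ++ D.cycles)
    (hl' : l' ∈ D.paths ++ D.cycles) {v : Fin n} (hv : v ∈ l) (hv' : v ∈ l') : l = l' := by
  by_contra hne
  have h := D.disjoint
  rw [← List.flatten_append, List.nodup_flatten] at h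
  have : Std.Symm (List.Disjoint (α := Fin n)) := ⟨fun _ _ hab => hab.symm⟩
  exact h.2.forall hl hl' hne hv hv'

theorem nodup_of_mem (D : PCDecomposition P) {l : List (Fin n)} (hl : l ∈ D.paths ++ D.cycles) :
    l.Nodup := by
  have h := D.disjoint
  rw [← List.flatten_append, List.nodup_flatten] at h
  exact h.1 l hl

theorem card_tips (D : PCDecomposition P) {T : Finset (Fin n)}
    (hT : ∀ v, v ∈ T ↔ ∃ l ∈ D.paths, v ∈ l.getLast?) : T.card = D.paths.length := by
  classical
  have hnd : D.paths.Nodup := by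
    have h := D.disjoint
    rw [← List.flatten_append, List.nodup_flatten, List.pairwise_append] at h
    refine h.2.1.imp_of_mem fun {a b} ha _ hab => ?_
    rintro rfl
    obtain ⟨v, hv⟩ := List.exists_mem_of_ne_nil a (D.path_ne_nil a ha)
    exact hab hv hv
  rw [← List.toFinset_card_of_nodup hnd]
  symm
  refine Finset.card_bij (fun l hl => l.getLast (D.path_ne_nil l (List.mem_toFinset.mp hl)))
    ?_ ?_ ?_
  · intro l hl
    exact (hT _).mpr ⟨l, List.mem_toFinset.mp hl, List.getLast?_eq_some_getLast _⟩
  · intro l hl l' hl' h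
    refine D.eq_of_mem (v := l.getLast (D.path_ne_nil l (List.mem_toFinset.mp hl)))
      (List.mem_append_left _ (List.mem_toFinset.mp hl))
      (List.mem_append_left _ (List.mem_toFinset.mp hl')) (List.getLast_mem _) ?_
    rw [h]
    exact List.getLast_mem _
  · intro v hv
    obtain ⟨l, hl, hvl⟩ := (hT v).mp hv
    exact ⟨l, List.mem_toFinset.mpr hl, (List.getLast_eq_iff_getLast?_eq_some _).mpr hvl⟩

/-- The successor map of a decomposition, closed up along each path, is a permutation. -/
theorem matchable_tips (D : PCDecomposition P) {T : Finset (Fin n)}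
    (hT : ∀ v, v ∈ T ↔ ∃ l ∈ D.paths, v ∈ l.getLast?) : Matchable P T := by
  have hex : ∀ v, ∃ l ∈ D.paths ++ D.cycles, v ∈ l := by
    intro v
    have := D.spanning v
    rwa [← List.flatten_append, List.mem_flatten] at this
  choose L hL hvL using hex
  have hmem : ∀ v, (L v).formPerm v ∈ L v := fun v =>
    List.formPerm_apply_mem_of_mem (hvL v)
  have hinj : Function.Injective fun v => (L v).formPerm v := by
    intro v w hvw
    have hvw' : (L v).formPerm v = (L w).formPerm w := hvw
    have h1 : L v = L w := D.eq_of_mem (hL v) (hL w) (hmem v) (hvw' ▸ hmem w)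
    rw [h1] at hvw'
    exact (L w).formPerm.injective hvw'
  refine ⟨Equiv.ofBijective _ (Finite.injective_iff_bijective.mp hinj), fun i hi => ?_⟩
  rw [Equiv.ofBijective_apply]
  obtain ⟨k, hk, hik⟩ := List.getElem_of_mem (hvL i)
  have hchain : (L i).IsChain (Edge P) := by
    rcases List.mem_append.mp (hL i) with h | h
    · exact D.path_chain _ h
    · exact D.cycle_chain _ h
  by_cases hlt : k + 1 < (L i).length
  · have h1 := List.formPerm_apply_lt_getElem (L i) (D.nodup_of_mem (hL i)) k hlt
    rw [hik] at h1
    rw [h1]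
    have h2 := List.isChain_iff_getElem.mp hchain k hlt
    rwa [hik] at h2
  · have hlast : i ∈ (L i).getLast? := by
      rw [List.getLast?_eq_getElem?]
      have : (L i).length - 1 = k := by omega
      rw [this]
      exact List.getElem?_eq_some_iff.mpr ⟨hk, hik⟩
    rcases List.mem_append.mp (hL i) with h | h
    · exact absurd ((hT i).mpr ⟨_, h, hlast⟩) hi
    · have h1 := List.formPerm_apply_getElem (L i) (D.nodup_of_mem (hL i)) k hk
      rw [hik] at h1
      rw [h1]
      refine D.cycle_closed _ h i hlast _ ?_
      have : (k + 1) % (L i).length = 0 := by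
        have : k + 1 = (L i).length := by omega
        rw [this, Nat.mod_self]
      simp only [this, List.head?_eq_getElem?]
      exact List.getElem?_eq_some_iff.mpr ⟨by omega, rfl⟩

end PCDecomposition

/-- The edges from the vertices of `X` to distinct vertices form a decomposition into paths and
cycles. It is assembled edge by edge: the source of a new edge is a tip and its target a root, so
the edge closes a path to a cycle or joins two paths. -/
theorem exists_decomposition {n : ℕ} {P : Pattern n} (g : Fin n → Fin n)
    (X : Finset (Fin n)) (hg : ∀ i ∈ X, Edge P i (g i)) (hinj : Set.InjOn g X) :
    ∃ D : PCDecomposition P, (∀ v, v ∉ X ↔ ∃ l ∈ D.paths, v ∈ l.getLast?) ∧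
      ∀ v, v ∈ X.image g ∨ ∃ l ∈ D.paths, v ∈ l.head? := by
  classical
  induction X using Finset.induction_on with
  | empty =>
    refine ⟨⟨(List.finRange n).map (fun i => [i]), [], ?_, ?_, ?_, ?_, ?_, ?_, ?_⟩, ?_, ?_⟩
    · simp
    · simp
    · simp
    · simp
    · simp
    · have : ((List.finRange n).map (fun i => [i])).flatten = List.finRange n := by
        rw [← List.flatMap_def]; simp
      simp [this, List.nodup_finRange]
    · simp
    · simp
    · simp
  | insert x X hx ih =>
    obtain ⟨D, htip, hroot⟩ := ih (fun i hi => hg i (Finset.mem_insert_of_mem hi))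
      (hinj.mono (by simp))
    obtain ⟨l, hl, hxl⟩ := (htip x).mp hx
    have hy : g x ∉ X.image g := by
      intro h
      obtain ⟨z, hz, hzx⟩ := Finset.mem_image.mp h
      have := hinj (by simp [hz]) (by simp) hzx
      exact hx (this ▸ hz)
    obtain ⟨l', hl', hyl'⟩ := (hroot (g x)).resolve_left hy
    have hedge : Edge P x (g x) := hg x (Finset.mem_insert_self _ _)
    have hxl_mem : x ∈ l := List.mem_of_getLast? hxl
    have hlast : ∀ {m : List (Fin n)} {v}, v ∈ m.getLast? → v ∈ m := fun h =>
      List.mem_of_getLast? h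
    obtain ⟨ps, hps⟩ : ∃ ps, D.paths.Perm (l :: ps) := ⟨_, List.perm_cons_erase hl⟩
    have hnd := D.disjoint
    have hspan := D.spanning
    rw [((hps.flatten).append_right _).nodup_iff] at hnd
    simp only [((hps.flatten).append_right _).mem_iff] at hspan
    have hmem : ∀ {m}, m ∈ D.paths ↔ m = l ∨ m ∈ ps := by
      intro m; rw [hps.mem_iff, List.mem_cons]
    -- the tip `x` lies on no other path
    have hother : ∀ m ∈ ps, x ∉ m := by
      intro m hm hxm
      rw [List.flatten_cons, List.append_assoc, List.nodup_append] at hnd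
      exact hnd.2.2 x hxl_mem x (List.mem_append_left _ (List.mem_flatten.mpr ⟨m, hm, hxm⟩)) rfl
    by_cases hll : l = l'
    · subst hll
      refine ⟨⟨ps, l :: D.cycles, ?_, ?_, ?_, ?_, ?_, ?_, ?_⟩, ?_, ?_⟩
      · exact fun m hm => D.path_ne_nil m (hmem.mpr (.inr hm))
      · exact fun m hm => D.path_chain m (hmem.mpr (.inr hm))
      · intro m hm
        rcases List.mem_cons.mp hm with rfl | hm
        · exact D.path_ne_nil _ hl
        · exact D.cycle_ne_nil m hm
      · intro m hm
        rcases List.mem_cons.mp hm with rfl | hm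
        · exact D.path_chain _ hl
        · exact D.cycle_chain m hm
      · intro m hm
        rcases List.mem_cons.mp hm with rfl | hm
        · intro a ha b hb
          rw [Option.mem_unique ha hxl, Option.mem_unique hb hyl']
          exact hedge
        · exact D.cycle_closed m hm
      · refine (List.Perm.nodup_iff ?_).mp hnd
        simp only [List.flatten_cons, ← List.append_assoc]
        exact List.perm_append_comm.append_right _
      · intro v
        have := hspan v
        simp only [List.flatten_cons, List.mem_append] at this ⊢
        tauto
      · intro v
        rw [Finset.mem_insert, not_or, htip]
        constructor
        · rintro ⟨hvx, m, hm, hvm⟩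
          rcases hmem.mp hm with rfl | hm
          · exact absurd (Option.mem_unique hvm hxl) hvx
          · exact ⟨m, hm, hvm⟩
        · rintro ⟨m, hm, hvm⟩
          refine ⟨?_, m, hmem.mpr (.inr hm), hvm⟩
          rintro rfl
          exact hother m hm (hlast hvm)
      · intro v
        rcases hroot v with h | ⟨m, hm, hvm⟩
        · exact .inl (Finset.image_subset_image (Finset.subset_insert _ _) h)
        · rcases hmem.mp hm with rfl | hm
          · rw [Option.mem_unique hvm hyl']
            exact .inl (Finset.mem_image_of_mem _ (Finset.mem_insert_self _ _))
          · exact .inr ⟨m, hm, hvm⟩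
    · have hl'ps : l' ∈ ps := (hmem.mp hl').resolve_left (Ne.symm hll)
      obtain ⟨qs, hqs⟩ : ∃ qs, ps.Perm (l' :: qs) := ⟨_, List.perm_cons_erase hl'ps⟩
      have hmem' : ∀ {m}, m ∈ ps ↔ m = l' ∨ m ∈ qs := by
        intro m; rw [hqs.mem_iff, List.mem_cons]
      have hlne := D.path_ne_nil l hl
      have hl'ne := D.path_ne_nil l' hl'
      have hp2 : (l :: ps).flatten.Perm ((l ++ l') :: qs).flatten := by
        rw [List.flatten_cons, List.flatten_cons, List.append_assoc, ← List.flatten_cons]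
        exact hqs.flatten.append_left _
      have htl : (l ++ l').getLast? = l'.getLast? := List.getLast?_append_of_ne_nil _ hl'ne
      have hhd : (l ++ l').head? = l.head? := List.head?_append_of_ne_nil _ hlne
      refine ⟨⟨(l ++ l') :: qs, D.cycles, ?_, ?_, D.cycle_ne_nil, D.cycle_chain, D.cycle_closed,
        ?_, ?_⟩, ?_, ?_⟩
      · intro m hm
        rcases List.mem_cons.mp hm with rfl | hm
        · simp [hlne]
        · exact D.path_ne_nil m (hmem.mpr (.inr (hmem'.mpr (.inr hm))))
      · intro m hm
        rcases List.mem_cons.mp hm with rfl | hm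
        · rw [List.isChain_append]
          refine ⟨D.path_chain l hl, D.path_chain l' hl', ?_⟩
          intro a ha b hb
          rw [Option.mem_unique ha hxl, Option.mem_unique hb hyl']
          exact hedge
        · exact D.path_chain m (hmem.mpr (.inr (hmem'.mpr (.inr hm))))
      · exact ((hp2.append_right _).nodup_iff).mp hnd
      · intro v
        exact ((hp2.append_right _).mem_iff).mp (hspan v)
      · intro v
        rw [Finset.mem_insert, not_or, htip]
        constructor
        · rintro ⟨hvx, m, hm, hvm⟩
          rcases hmem.mp hm with rfl | hm
          · exact absurd (Option.mem_unique hvm hxl) hvx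
          · rcases hmem'.mp hm with rfl | hm
            · exact ⟨_, List.mem_cons_self, by rw [htl]; exact hvm⟩
            · exact ⟨m, List.mem_cons_of_mem _ hm, hvm⟩
        · rintro ⟨m, hm, hvm⟩
          rcases List.mem_cons.mp hm with rfl | hm'
          · rw [htl] at hvm
            refine ⟨?_, l', hl', hvm⟩
            rintro rfl
            exact hother l' hl'ps (hlast hvm)
          · refine ⟨?_, m, hmem.mpr (.inr (hmem'.mpr (.inr hm'))), hvm⟩
            rintro rfl
            exact hother m (hmem'.mpr (.inr hm')) (hlast hvm)
      · intro v
        rcases hroot v with h | ⟨m, hm, hvm⟩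
        · exact .inl (Finset.image_subset_image (Finset.subset_insert _ _) h)
        · rcases hmem.mp hm with rfl | hm
          · exact .inr ⟨_, List.mem_cons_self, by rw [hhd]; exact hvm⟩
          · rcases hmem'.mp hm with rfl | hm
            · rw [Option.mem_unique hvm hyl']
              exact .inl (Finset.mem_image_of_mem _ (Finset.mem_insert_self _ _))
            · exact .inr ⟨m, List.mem_cons_of_mem _ hm, hvm⟩

theorem Matchable.exists_decomposition {n : ℕ} {P : Pattern n} {S : Finset (Fin n)}
    (h : Matchable P S) :
    ∃ D : PCDecomposition P, ∀ v, v ∈ S ↔ ∃ l ∈ D.paths, v ∈ l.getLast? := by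
  obtain ⟨π, hπ⟩ := h
  obtain ⟨D, hD, _⟩ := RobustSensor.exists_decomposition π Sᶜ
    (fun i hi => hπ i (Finset.mem_compl.mp hi)) π.injective.injOn
  exact ⟨D, fun v => by rw [← hD]; simp⟩

/-- The tip sets of minimum decompositions are the smallest matchable sets. -/
theorem isTipSet_iff {n : ℕ} {P : Pattern n} {T : Finset (Fin n)} :
    IsTipSet P T ↔ Matchable P T ∧ ∀ S : Finset (Fin n), Matchable P S → T.card ≤ S.card := by
  classical
  constructor
  · rintro ⟨D, hmin, hD⟩
    refine ⟨D.matchable_tips hD, fun S hS => ?_⟩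
    obtain ⟨D', hD'⟩ := hS.exists_decomposition
    rw [D.card_tips hD, D'.card_tips hD']
    exact hmin D'
  · rintro ⟨hm, hmin⟩
    obtain ⟨D, hD⟩ := hm.exists_decomposition
    refine ⟨D, fun D' => ?_, hD⟩
    have hD' : ∀ v, v ∈ Finset.univ.filter (fun v => ∃ l ∈ D'.paths, v ∈ l.getLast?) ↔
        ∃ l ∈ D'.paths, v ∈ l.getLast? := by simp
    rw [← D.card_tips hD, ← D'.card_tips hD']
    exact hmin _ (D'.matchable_tips hD')

theorem Matchable.mono {n : ℕ} {P : Pattern n} {S S' : Finset (Fin n)} (h : Matchable P S)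
    (hs : S ⊆ S') : Matchable P S' := by
  obtain ⟨π, hπ⟩ := h
  exact ⟨π, fun i hi => hπ i (fun h => hi (hs h))⟩

/-! ### The exchange of tips -/

theorem exists_nodup_chain {α : Type*} {r : α → α → Prop} {a b : α}
    (h : Relation.ReflTransGen r a b) :
    ∃ l : List α, (a :: l).Nodup ∧ (a :: l).IsChain r ∧
      (a :: l).getLast (List.cons_ne_nil _ _) = b := by
  classical
  induction h using Relation.ReflTransGen.head_induction_on with
  | refl => exact ⟨[], by simp, by simp, by simp⟩
  | @head a c hac _ ih =>
    obtain ⟨l, hnd, hch, hlast⟩ := ih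
    by_cases ha : a ∈ c :: l
    · obtain ⟨s, t, hst⟩ := List.append_of_mem ha
      refine ⟨t, ?_, ?_, ?_⟩
      · rw [hst] at hnd; exact (List.nodup_append.mp hnd).2.1
      · rw [hst] at hch; exact (List.isChain_append.mp hch).2.1
      · simp only [hst] at hlast
        rwa [List.getLast_append_of_ne_nil _ (by simp)] at hlast
    · exact ⟨c :: l, List.nodup_cons.mpr ⟨ha, hnd⟩, List.isChain_cons_cons.mpr ⟨hac, hch⟩,
        by rw [List.getLast_cons (by simp)]; exact hlast⟩

/-- Alternating paths. Along a path from `x` on which every vertex can take over the partner of the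
next one, the partners are shifted by the cyclic permutation of the path. -/
theorem exists_shift {n : ℕ} {P : Pattern n} {T : Finset (Fin n)} {π : Equiv.Perm (Fin n)}
    (hπ : ∀ i, i ∉ T → Edge P i (π i)) {x w : Fin n}
    (h : Relation.ReflTransGen (fun a b => Edge P a (π b)) x w) :
    ∃ σ : Equiv.Perm (Fin n), σ w = x ∧
      ∀ i, i ∉ T.erase x → i ≠ w → Edge P i (π (σ i)) := by
  obtain ⟨l, hnd, hch, hlast⟩ := exists_nodup_chain h
  refine ⟨(x :: l).formPerm, ?_, fun i hi hiw => ?_⟩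
  · rw [← hlast]
    exact List.formPerm_apply_getLast x l
  · by_cases hil : i ∈ x :: l
    · obtain ⟨k, hk, rfl⟩ := List.getElem_of_mem hil
      have hlt : k + 1 < (x :: l).length := by
        by_contra hge
        apply hiw
        rw [← hlast, List.getLast_eq_getElem]
        congr 1
        omega
      rw [List.formPerm_apply_lt_getElem _ hnd k hlt]
      exact List.isChain_iff_getElem.mp hch k hlt
    · rw [List.formPerm_apply_of_notMem hil]
      refine hπ i fun hiT => hi (Finset.mem_erase.mpr ⟨?_, hiT⟩)
      rintro rfl
      exact hil List.mem_cons_self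

/-- The exchange property of tip sets. The vertices that alternating paths from `x` reach contain
an element of `S`: otherwise the matching of the complement of `S` would map them into the partners
of themselves, and `x` could be matched in addition. -/
theorem IsTipSet.exchange {n : ℕ} {P : Pattern n} {T S : Finset (Fin n)} (hT : IsTipSet P T)
    {x : Fin n} (hx : x ∈ T) (hS : Matchable P S) (hxS : x ∉ S) :
    ∃ w ∈ S, w ∉ T ∧ IsTipSet P (insert w (T.erase x)) := by
  classical
  rw [isTipSet_iff] at hT
  obtain ⟨⟨π, hπ⟩, hmin⟩ := hT
  have hsmall : ¬ Matchable P (T.erase x) := by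
    intro h
    have h1 := hmin _ h
    have h2 := Finset.card_erase_lt_of_mem hx
    omega
  let G : Fin n → Fin n → Prop := fun a b => Edge P a (π b)
  have hswap : ∀ w, Relation.ReflTransGen G x w → Matchable P (insert w (T.erase x)) := by
    intro w hw
    obtain ⟨σ, _, hσ⟩ := exists_shift hπ hw
    refine ⟨σ.trans π, fun i hi => ?_⟩
    rw [Finset.mem_insert, not_or] at hi
    exact hσ i hi.2 hi.1
  by_cases hw : ∃ w ∈ S, Relation.ReflTransGen G x w
  · obtain ⟨w, hwS, hw⟩ := hw
    have hwx : w ≠ x := by rintro rfl; exact hxS hwS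
    have hm := hswap w hw
    have hwT : w ∉ T := by
      intro hwT
      rw [Finset.insert_eq_of_mem (Finset.mem_erase.mpr ⟨hwx, hwT⟩)] at hm
      exact hsmall hm
    refine ⟨w, hwS, hwT, isTipSet_iff.mpr ⟨hm, fun S' hS' => ?_⟩⟩
    rw [Finset.card_insert_of_notMem (fun h => hwT (Finset.mem_of_mem_erase h)),
      Finset.card_erase_add_one hx]
    exact hmin S' hS'
  · exfalso
    push Not at hw
    obtain ⟨ρ, hρ⟩ := hS
    let R := Finset.univ.filter (fun a => Relation.ReflTransGen G x a)
    have hR : ∀ a ∈ R, π.symm (ρ a) ∈ R := by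
      intro a ha
      simp only [R, Finset.mem_filter, Finset.mem_univ, true_and] at ha ⊢
      refine ha.tail ?_
      have := hρ a (fun h => hw a h ha)
      simpa [G] using this
    have himg : R.image (fun a => π.symm (ρ a)) = R := by
      refine Finset.eq_of_subset_of_card_le (Finset.image_subset_iff.mpr hR) ?_
      exact (Finset.card_image_of_injective R (ρ.trans π.symm).injective).ge
    have hxR : x ∈ R := by simp [R, Relation.ReflTransGen.refl]
    rw [← himg] at hxR
    obtain ⟨a, ha, hax⟩ := Finset.mem_image.mp hxR
    simp only [R, Finset.mem_filter, Finset.mem_univ, true_and] at ha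
    obtain ⟨σ, hσw, hσ⟩ := exists_shift hπ ha
    refine hsmall ⟨σ.trans π, fun i hi => ?_⟩
    by_cases hia : i = a
    · have h1 : ρ a = π x := by rw [← hax, Equiv.apply_symm_apply]
      rw [Equiv.trans_apply, hia, hσw, ← h1]
      exact hρ a (fun h => hw a h ha)
    · exact hσ i hi hia

/-! ### Back-ups and robustness -/

section Backups

variable {n : ℕ} {P : Pattern n} {F T S : Finset (Fin n)}

theorem IsFeasible.mono (h : IsFeasible P F) (hs : F ⊆ S) : IsFeasible P S := by
  rw [isFeasible_iff] at h ⊢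
  exact ⟨h.1.mono hs, fun v => (h.2 v).imp fun s hv => ⟨hs hv.1, hv.2⟩⟩

theorem IsMinimalFeasible.not_isFeasible_erase (hF : IsMinimalFeasible P F) {x : Fin n}
    (hx : x ∈ F) : ¬ IsFeasible P (F.erase x) := by
  intro h
  have h1 := hF.2 _ h
  have h2 := Finset.card_erase_lt_of_mem hx
  omega

theorem Covers.replace (h : Covers P F) {x y : Fin n} (hxy : Reach P x y) (hy : y ∈ S)
    (hs : F.erase x ⊆ S) : Covers P S := by
  intro v
  obtain ⟨s, hsF, hvs⟩ := h v
  by_cases hsx : s = x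
  · subst hsx
    exact ⟨y, hy, hvs.trans hxy⟩
  · exact ⟨s, hs (Finset.mem_erase.mpr ⟨hsx, hsF⟩), hvs⟩

/-- A sensor whose loss leaves some state variable without a path to a sensor lies in a sink
component, which contains no other sensor. -/
theorem Covers.sink (h : Covers P F) {x : Fin n} (hx : ¬ Covers P (F.erase x)) :
    (∀ w, Reach P x w → Reach P w x) ∧ ∀ s ∈ F, Reach P x s → s = x := by
  rw [Covers] at hx
  push Not at hx
  obtain ⟨v, hv⟩ := hx
  have key : ∀ s ∈ F, Reach P v s → s = x := by
    intro s hs hvs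
    by_contra hne
    exact hv s (Finset.mem_erase.mpr ⟨hne, hs⟩) hvs
  have hvx : Reach P v x := by
    obtain ⟨s, hs, hvs⟩ := h v
    rwa [key s hs hvs] at hvs
  refine ⟨fun w hw => ?_, fun s hs hxs => key s hs (hvx.trans hxs)⟩
  obtain ⟨s, hs, hws⟩ := h w
  rwa [key s hs ((hvx.trans hw).trans hws)] at hws

theorem IsMinimalFeasible.not_covers_erase (hF : IsMinimalFeasible P F) (hTF : T ⊆ F)
    (hT : IsTipSet P T) {x : Fin n} (hx : x ∈ F) (hxT : x ∉ T) : ¬ Covers P (F.erase x) := by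
  intro h
  refine hF.not_isFeasible_erase hx (isFeasible_iff.mpr ⟨?_, h⟩)
  refine (isTipSet_iff.mp hT).1.mono fun i hi => Finset.mem_erase.mpr ⟨?_, hTF hi⟩
  rintro rfl
  exact hxT hi

theorem interchanged_eq (hTF : T ⊆ F) {x : Fin n} (hx : x ∈ T) (w : Fin n) :
    interchanged F T x w = insert w (F.erase x) := by
  ext i
  simp only [interchanged, Finset.mem_union, Finset.mem_insert, Finset.mem_erase,
    Finset.mem_sdiff]
  have h1 : i ∈ T → i ∈ F := fun h => hTF h
  have h2 : i = x → i ∈ T := by rintro rfl; exact hx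
  tauto

theorem isTipSet_insert_erase_iff (hT : IsTipSet P T) {x w : Fin n} (hx : x ∈ T) (hwx : w ≠ x) :
    IsTipSet P (insert w (T.erase x)) ↔ w ∉ T ∧ Matchable P (insert w (T.erase x)) := by
  rw [isTipSet_iff] at hT
  constructor
  · intro h
    rw [isTipSet_iff] at h
    refine ⟨fun hw => ?_, h.1⟩
    rw [Finset.insert_eq_of_mem (Finset.mem_erase.mpr ⟨hwx, hw⟩)] at h
    have h1 := hT.2 _ h.1
    have h2 := Finset.card_erase_lt_of_mem hx
    omega
  · rintro ⟨hw, hm⟩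
    refine isTipSet_iff.mpr ⟨hm, ?_⟩
    rw [Finset.card_insert_of_notMem (fun h => hw (Finset.mem_of_mem_erase h)),
      Finset.card_erase_add_one hx]
    exact hT.2

theorem mem_backups_tip {x : Fin n} (hx : x ∈ T) {z : Finset (Fin n)} :
    z ∈ backups P F T x ↔ ∃ w, w ≠ x ∧ IsTipSet P (insert w (T.erase x)) ∧
      ((IsFeasible P (interchanged F T x w) ∧ z = {w}) ∨
        (¬ IsFeasible P (interchanged F T x w) ∧ ∃ y, y ≠ x ∧ SameSCC P x y ∧ z = {w, y})) := by
  simp [backups, hx, tipAlternatives, and_assoc]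

theorem mem_backups_sink {x : Fin n} (hx : x ∉ T) {z : Finset (Fin n)} :
    z ∈ backups P F T x ↔ ∃ w, w ≠ x ∧ InSinkSCC P x ∧ SameSCC P x w ∧ z = {w} := by
  simp [backups, hx, sinkAlternatives, and_assoc]

theorem matchable_of_tip_alternative {x w : Fin n} (hTF : T ⊆ F)
    (hw : IsTipSet P (insert w (T.erase x))) (hs : F.erase x ⊆ S) (hwS : w ∈ S) :
    Matchable P S := by
  refine (isTipSet_iff.mp hw).1.mono fun i hi => ?_
  rcases Finset.mem_insert.mp hi with rfl | hi
  · exact hwS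
  · exact hs (Finset.erase_subset_erase _ hTF hi)

/-- A back-up makes up for the loss of its sensor. -/
theorem isFeasible_of_backup (hF : IsFeasible P F) (hTF : T ⊆ F) (hT : IsTipSet P T)
    {x : Fin n} {z : Finset (Fin n)} (hz : z ∈ backups P F T x)
    (hs : F.erase x ⊆ S) (hzS : z ⊆ S) : IsFeasible P S := by
  have hcov := (isFeasible_iff.mp hF).2
  by_cases hxT : x ∈ T
  · obtain ⟨w, hwx, hw, h | ⟨_, y, hyx, hxy, rfl⟩⟩ := (mem_backups_tip hxT).mp hz
    · obtain ⟨hfeas, rfl⟩ := h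
      rw [interchanged_eq hTF hxT] at hfeas
      exact hfeas.mono (Finset.insert_subset (by simpa using hzS) hs)
    · exact isFeasible_iff.mpr
        ⟨matchable_of_tip_alternative hTF hw hs (hzS (by simp)),
          hcov.replace hxy.1 (hzS (by simp)) hs⟩
  · obtain ⟨w, hwx, _, hxw, rfl⟩ := (mem_backups_sink hxT).mp hz
    refine isFeasible_iff.mpr ⟨(isTipSet_iff.mp hT).1.mono fun i hi => hs ?_,
      hcov.replace hxw.1 (by simpa using hzS) hs⟩
    refine Finset.mem_erase.mpr ⟨?_, hTF hi⟩
    rintro rfl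
    exact hxT hi

theorem notMem_of_mem_backups {x : Fin n} {z : Finset (Fin n)} (hz : z ∈ backups P F T x) :
    x ∉ z := by
  by_cases hxT : x ∈ T
  · obtain ⟨w, hwx, _, ⟨_, rfl⟩ | ⟨_, y, hyx, _, rfl⟩⟩ := (mem_backups_tip hxT).mp hz
    · simpa using hwx.symm
    · simp [hwx.symm, hyx.symm]
  · obtain ⟨w, hwx, _, _, rfl⟩ := (mem_backups_sink hxT).mp hz
    simpa using hwx.symm

/-- A feasible solution without `x` that contains the other elements of `F` contains a back-up to
`x`. If it contains no back-up with one element, then `x` is the only element of `F` in a sink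
component, and a back-up `{w, y}` with `y` in this component is contained. -/
theorem exists_backup (hF : IsMinimalFeasible P F) (hTF : T ⊆ F) (hT : IsTipSet P T)
    {x : Fin n} (hx : x ∈ F) (hS : IsFeasible P S) (hxS : x ∉ S) :
    (∃ w ∈ S, {w} ∈ backups P F T x) ∨
      (x ∈ T ∧ (∀ s ∈ F, Reach P x s → s = x) ∧ ∃ w ∈ S, ∃ y ∈ S, {w, y} ∈ backups P F T x ∧
        w ≠ x ∧ w ∉ T ∧ y ≠ x ∧ SameSCC P x y) := by
  have hcovF := (isFeasible_iff.mp hF.1).2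
  obtain ⟨hmS, hcovS⟩ := isFeasible_iff.mp hS
  by_cases hxT : x ∈ T
  · obtain ⟨w, hwS, hwT, hw⟩ := hT.exchange hxT hmS hxS
    have hwx : w ≠ x := by rintro rfl; exact hxS hwS
    by_cases hfeas : IsFeasible P (interchanged F T x w)
    · exact .inl ⟨w, hwS, (mem_backups_tip hxT).mpr ⟨w, hwx, hw, .inl ⟨hfeas, rfl⟩⟩⟩
    · right
      have hnc : ¬ Covers P (F.erase x) := by
        intro hc
        rw [interchanged_eq hTF hxT] at hfeas
        exact hfeas (isFeasible_iff.mpr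
          ⟨matchable_of_tip_alternative hTF hw (Finset.subset_insert _ _)
            (Finset.mem_insert_self _ _),
          fun v => (hc v).imp fun s hv => ⟨Finset.mem_insert_of_mem hv.1, hv.2⟩⟩)
      obtain ⟨hsink, honly⟩ := hcovF.sink hnc
      obtain ⟨y, hyS, hxy⟩ := hcovS x
      have hyx : y ≠ x := by rintro rfl; exact hxS hyS
      refine ⟨hxT, honly, w, hwS, y, hyS, ?_, hwx, hwT, hyx, hxy, hsink y hxy⟩
      exact (mem_backups_tip hxT).mpr
        ⟨w, hwx, hw, .inr ⟨hfeas, y, hyx, ⟨hxy, hsink y hxy⟩, rfl⟩⟩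
  · left
    obtain ⟨hsink, _⟩ := hcovF.sink (hF.not_covers_erase hTF hT hx hxT)
    obtain ⟨w, hwS, hxw⟩ := hcovS x
    have hwx : w ≠ x := by rintro rfl; exact hxS hwS
    refine ⟨w, hwS, (mem_backups_sink hxT).mpr ⟨w, hwx, ?_, ⟨hxw, hsink w hxw⟩, rfl⟩⟩
    intro u v hxu huv
    have hxv : Reach P x v := hxu.1.tail huv
    exact ⟨hxv, hsink v hxv⟩

theorem notMem_of_singleton_mem_backups (hF : IsMinimalFeasible P F) (hTF : T ⊆ F)
    (hT : IsTipSet P T) {x w : Fin n} (hx : x ∈ F) (hw : {w} ∈ backups P F T x) : w ∉ F := by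
  intro hwF
  have hne : w ≠ x := by
    rintro rfl
    exact notMem_of_mem_backups hw (Finset.mem_singleton_self _)
  refine hF.not_isFeasible_erase hx (isFeasible_of_backup hF.1 hTF hT hw subset_rfl ?_)
  simpa using ⟨hne, hwF⟩

theorem mem_zset {j : Fin n × Fin n} {i : Fin n} : i ∈ zset j ↔ i = j.1 ∨ i = j.2 := by
  simp [zset]

theorem mem_coverSet {j : Fin n × Fin n} {x : Fin n} :
    x ∈ coverSet P F T j ↔
      x ∈ F ∧ (zset j ∈ backups P F T x ∨ ∃ k ∈ zset j, {k} ∈ backups P F T x) := by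
  have hz : ∀ k : Fin n, zset (k, k) = {k} := fun k => by simp [zset]
  obtain ⟨a, b⟩ := j
  by_cases h : a = b
  · subst h
    simp [coverSet, directCover, hz]
  · simp only [coverSet, directCover, h, if_false, Finset.mem_union, Finset.mem_filter,
      Finset.mem_biUnion, hz]
    tauto

/-- The index of the set `{w, y}`. -/
def pairIndex (w y : Fin n) : Fin n × Fin n := (min w y, max w y)

theorem zset_pairIndex (w y : Fin n) : zset (pairIndex w y) = {w, y} := by
  rcases le_total w y with h | h
  · simp [zset, pairIndex, h]
  · simp [zset, pairIndex, h, Finset.pair_comm]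

theorem pairIndex_mem (w y : Fin n) : pairIndex w y ∈ (backupInstance P F T).index := by
  simp [backupInstance, pairIndex]

theorem diag_mem (w : Fin n) : (w, w) ∈ (backupInstance P F T).index := by
  simp [backupInstance]

theorem cost_le_two (j : Fin n × Fin n) : (backupInstance P F T).cost j ≤ 2 :=
  Finset.card_le_two

theorem cost_diag (w : Fin n) : (backupInstance P F T).cost (w, w) = 1 := by
  simp [backupInstance, zset]

/-- The union of `F` and the sets of a cover is robust. -/
theorem isSRobust_augmented (hF : IsFeasible P F) (hTF : T ⊆ F) (hT : IsTipSet P T)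
    {J : Finset (Fin n × Fin n)} (hJ : (backupInstance P F T).IsCover J) :
    IsSRobust P (augmented F J) := by
  have hsub : F ⊆ augmented F J := Finset.subset_union_right
  refine ⟨hF.mono hsub, fun x _ => ?_⟩
  by_cases hxF : x ∈ F
  · obtain ⟨j, hj, hxj⟩ := hJ.2 x hxF
    have hjs : zset j ⊆ augmented F J :=
      (Finset.subset_biUnion_of_mem zset hj).trans Finset.subset_union_left
    have key : ∀ z, z ∈ backups P F T x → z ⊆ zset j →
        IsFeasible P ((augmented F J).erase x) := by
      intro z hz hzj
      refine isFeasible_of_backup hF hTF hT hz (Finset.erase_subset_erase _ hsub) fun i hi =>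
        Finset.mem_erase.mpr ⟨?_, hjs (hzj hi)⟩
      rintro rfl
      exact notMem_of_mem_backups hz hi
    obtain ⟨_, h | ⟨k, hk, h⟩⟩ := mem_coverSet.mp hxj
    · exact key _ h subset_rfl
    · exact key _ h (Finset.singleton_subset_iff.mpr hk)
  · refine hF.mono fun i hi => Finset.mem_erase.mpr ⟨?_, hsub hi⟩
    rintro rfl
    exact hxF hi

/-- A robust extension `S` of `F` yields a cover. Let `D` be the set of the elements of `F` without
a back-up of one element in `S`. Each of them has a back-up `{w, y}` in `S` with `y` in its own sink
component, so that the elements `y` are distinct and outside `F`; the remaining elements of `S \ F`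
are selected one by one. -/
theorem exists_cover_of_isSRobust (hF : IsMinimalFeasible P F) (hTF : T ⊆ F)
    (hT : IsTipSet P T) (hFS : F ⊆ S) (hS : IsSRobust P S) :
    ∃ (D : Finset (Fin n)) (K : Finset (Fin n × Fin n)), D ⊆ F ∧
      (backupInstance P F T).IsCover K ∧
      (backupInstance P F T).totalCost K ≤ (S \ F).card + D.card ∧
      D.card ≤ (S \ F).card ∧ (0 < D.card → 2 ≤ (S \ F).card) ∧
      ∀ x ∈ F, x ∉ D → ∃ j ∈ (backupInstance P F T).index,
        x ∈ (backupInstance P F T).sets j ∧ (backupInstance P F T).cost j = 1 := by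
  classical
  let D := F.filter (fun x => ¬ ∃ w ∈ S, {w} ∈ backups P F T x)
  have hback := fun x (hx : x ∈ F) => exists_backup hF hTF hT hx (hS.2 x (hFS hx))
    (Finset.notMem_erase x S)
  have hD : ∀ x ∈ D, x ∈ T ∧ (∀ s ∈ F, Reach P x s → s = x) ∧
      ∃ w ∈ S, ∃ y ∈ S, {w, y} ∈ backups P F T x ∧ w ≠ x ∧ w ∉ T ∧ y ≠ x ∧ SameSCC P x y := by
    intro x hx
    obtain ⟨hxF, hno⟩ := Finset.mem_filter.mp hx
    rcases hback x hxF with ⟨w, hw, hb⟩ | ⟨h1, h2, w, hw, y, hy, h3⟩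
    · exact absurd ⟨w, Finset.mem_of_mem_erase hw, hb⟩ hno
    · exact ⟨h1, h2, w, Finset.mem_of_mem_erase hw, y, Finset.mem_of_mem_erase hy, h3⟩
  have hDF : D ⊆ F := Finset.filter_subset _ _
  have hsingle : ∀ x ∈ F, x ∉ D → ∃ w ∈ S \ F, {w} ∈ backups P F T x := by
    intro x hx hxD
    have : ∃ w ∈ S, {w} ∈ backups P F T x := by
      by_contra h
      exact hxD (Finset.mem_filter.mpr ⟨hx, h⟩)
    obtain ⟨w, hw, hb⟩ := this
    exact ⟨w, Finset.mem_sdiff.mpr ⟨hw, notMem_of_singleton_mem_backups hF hTF hT hx hb⟩, hb⟩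
  choose! hDT honly w hwS y hyS hb hwx hwT hyx hscc using hD
  have hyF : ∀ x ∈ D, y x ∈ S \ F := fun x hx => Finset.mem_sdiff.mpr
    ⟨hyS x hx, fun h => hyx x hx (honly x hx _ h (hscc x hx).1)⟩
  have hyinj : Set.InjOn y D := by
    intro a ha b hb' hab
    refine (honly a ha b (hDF hb') ?_).symm
    exact (hscc a ha).1.trans (hab ▸ (hscc b hb').2)
  have hYsub : D.image y ⊆ S \ F := Finset.image_subset_iff.mpr hyF
  have hYcard : (D.image y).card = D.card := Finset.card_image_of_injOn hyinj
  let K₁ := ((S \ F) \ D.image y).image (fun w => (w, w))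
  let K₂ := D.image (fun x => pairIndex (w x) (y x))
  refine ⟨D, K₁ ∪ K₂, hDF, ⟨?_, ?_⟩, ?_, ?_, ?_, ?_⟩
  · refine Finset.union_subset (Finset.image_subset_iff.mpr fun i _ => diag_mem i)
      (Finset.image_subset_iff.mpr fun i _ => pairIndex_mem _ _)
  · intro x hx
    by_cases hxD : x ∈ D
    · refine ⟨_, Finset.mem_union_right _ (Finset.mem_image_of_mem _ hxD),
        mem_coverSet.mpr ⟨hx, .inl ?_⟩⟩
      rw [zset_pairIndex]
      exact hb x hxD
    · obtain ⟨v, hv, hvb⟩ := hsingle x hx hxD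
      by_cases hvY : v ∈ D.image y
      · obtain ⟨u, hu, rfl⟩ := Finset.mem_image.mp hvY
        refine ⟨_, Finset.mem_union_right _ (Finset.mem_image_of_mem _ hu),
          mem_coverSet.mpr ⟨hx, .inr ⟨y u, ?_, hvb⟩⟩⟩
        rw [zset_pairIndex]
        simp
      · refine ⟨(v, v), Finset.mem_union_left _ (Finset.mem_image_of_mem _
          (Finset.mem_sdiff.mpr ⟨hv, hvY⟩)), mem_coverSet.mpr ⟨hx, .inr ⟨v, ?_, hvb⟩⟩⟩
        simp [zset]
  · have h1 : (backupInstance P F T).totalCost (K₁ ∪ K₂) ≤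
        (backupInstance P F T).totalCost K₁ + (backupInstance P F T).totalCost K₂ := by
      simp only [SetCover.totalCost]
      rw [← Finset.sum_union_inter]
      exact Nat.le_add_right _ _
    have h2 : (backupInstance P F T).totalCost K₁ ≤ (S \ F).card - D.card := by
      refine (Finset.sum_le_card_nsmul K₁ _ 1 ?_).trans ?_
      · intro j hj
        obtain ⟨v, _, rfl⟩ := Finset.mem_image.mp hj
        exact (cost_diag v).le
      · rw [smul_eq_mul, mul_one, ← hYcard, ← Finset.card_sdiff_of_subset hYsub]
        exact Finset.card_image_le
    have h3 : (backupInstance P F T).totalCost K₂ ≤ D.card * 2 := by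
      refine (Finset.sum_le_card_nsmul K₂ _ 2 fun j _ => cost_le_two j).trans ?_
      rw [smul_eq_mul]
      exact Nat.mul_le_mul_right _ Finset.card_image_le
    have h4 : D.card ≤ (S \ F).card := hYcard ▸ Finset.card_le_card hYsub
    omega
  · exact hYcard ▸ Finset.card_le_card hYsub
  · intro hpos
    obtain ⟨x, hx⟩ := Finset.card_pos.mp hpos
    -- a second element of `S \ F` besides `y x`
    obtain ⟨v, hv, hvy⟩ : ∃ v ∈ S \ F, v ≠ y x := by
      by_cases hwF : w x ∈ F
      · have hwD : w x ∉ D := fun h => hwT x hx (hDT _ h)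
        obtain ⟨v, hv, hvb⟩ := hsingle _ hwF hwD
        refine ⟨v, hv, ?_⟩
        rintro rfl
        obtain ⟨v', _, _, hscc', heq⟩ := (mem_backups_sink (hwT x hx)).mp hvb
        obtain rfl : y x = v' := by simpa using heq
        exact hwx x hx (honly x hx _ hwF ((hscc x hx).1.trans hscc'.2))
      · refine ⟨w x, Finset.mem_sdiff.mpr ⟨hwS x hx, hwF⟩, fun h => ?_⟩
        have hbx := hb x hx
        rw [h, Finset.pair_eq_singleton] at hbx
        exact (Finset.mem_filter.mp hx).2 ⟨y x, hyS x hx, hbx⟩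
    exact Finset.one_lt_card.mpr ⟨v, hv, y x, hyF x hx, hvy⟩
  · intro x hx hxD
    obtain ⟨v, hv, hvb⟩ := hsingle x hx hxD
    exact ⟨(v, v), diag_mem v, mem_coverSet.mpr ⟨hx, .inr ⟨v, by simp [zset], hvb⟩⟩, cost_diag v⟩

theorem exists_cover_iff (hF : IsMinimalFeasible P F) (hTF : T ⊆ F) (hT : IsTipSet P T) :
    (∃ J, (backupInstance P F T).IsCover J) ↔ ∃ S : Finset (Fin n), F ⊆ S ∧ IsSRobust P S := by
  constructor
  · rintro ⟨J, hJ⟩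
    exact ⟨_, Finset.subset_union_right, isSRobust_augmented hF.1 hTF hT hJ⟩
  · rintro ⟨S, hFS, hS⟩
    obtain ⟨_, K, _, hK, _⟩ := exists_cover_of_isSRobust hF hTF hT hFS hS
    exact ⟨K, hK⟩

end Backups

/-! ### Greedy covers -/

theorem div_le_harmonic_sub (k m : ℕ) (h : m ≤ k) :
    (m : ℚ) / k ≤ harmonic k - harmonic (k - m) := by
  induction m with
  | zero => simp
  | succ m ih =>
    have ih' := ih (by omega)
    have e : k - m = (k - (m + 1)) + 1 := by omega
    rw [e, harmonic_succ] at ih'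
    have hpos : (0 : ℚ) < ((k - (m + 1) + 1 : ℕ) : ℚ) := by positivity
    have hle : ((k - (m + 1) + 1 : ℕ) : ℚ) ≤ k := by
      exact_mod_cast (by omega : k - (m + 1) + 1 ≤ k)
    have h1 : (1 : ℚ) / k ≤ (((k - (m + 1) + 1 : ℕ) : ℚ))⁻¹ := by
      rw [← one_div]
      exact one_div_le_one_div_of_le hpos hle
    push_cast at *
    rw [add_div]
    linarith

namespace SetCover

variable {ι α : Type} [DecidableEq α]

/-- What holds during the greedy algorithm when the family `J` has been selected and `A` is the set
of the elements that are not yet covered. The first bound is Chvátal's; in the second one each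
element `x` pays at most the cost `β x` of some set that contains it. -/
structure GreedyInvariant (I : SetCover ι α) (A : Finset α) (J : Finset ι) : Prop where
  subset_index : J ⊆ I.index
  subset_universal : A ⊆ I.universal
  covered : ∀ x ∈ I.universal, x ∉ A → ∃ j ∈ J, x ∈ I.sets j
  cost_le : ∀ K, I.IsCover K → (I.totalCost J : ℚ) ≤
    I.totalCost K * (harmonic I.universal.card - harmonic A.card)
  cost_le_sum : ∀ β : α → ℕ, (∀ x ∈ I.universal, ∃ j ∈ I.index, x ∈ I.sets j ∧ I.cost j ≤ β x) →
    I.totalCost J ≤ ∑ x ∈ I.universal \ A, β x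

theorem GreedyInvariant.start (I : SetCover ι α) : I.GreedyInvariant I.universal ∅ where
  subset_index := by simp
  subset_universal := subset_rfl
  covered := fun x hx hx' => absurd hx hx'
  cost_le := fun K _ => by simp [totalCost]
  cost_le_sum := fun β _ => by simp [totalCost]

/-- The greedy choice: `q` has the largest number of new elements per cost. -/
theorem GreedyInvariant.step [DecidableEq ι] {I : SetCover ι α} {A : Finset α} {J : Finset ι}
    (h : I.GreedyInvariant A J) {q : ι} (hq : q ∈ I.index) (hpos : (I.sets q ∩ A).Nonempty)
    (hbest : ∀ j ∈ I.index,
      (I.sets j ∩ A).card * I.cost q ≤ (I.sets q ∩ A).card * I.cost j) :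
    I.GreedyInvariant (A \ I.sets q) (insert q J) := by
  have hinsert : I.totalCost (insert q J) ≤ I.cost q + I.totalCost J := by
    by_cases hqJ : q ∈ J
    · rw [Finset.insert_eq_of_mem hqJ]; omega
    · simp only [totalCost]
      rw [Finset.sum_insert hqJ]
  have hcardpos := Finset.card_pos.mpr hpos
  have hle : (I.sets q ∩ A).card ≤ A.card := Finset.card_le_card Finset.inter_subset_right
  have hcard : (A \ I.sets q).card = A.card - (I.sets q ∩ A).card := by
    rw [Finset.card_sdiff]
  refine ⟨Finset.insert_subset hq h.subset_index, Finset.sdiff_subset.trans h.subset_universal,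
    ?_, ?_, ?_⟩
  · intro x hx hxA
    by_cases hxA' : x ∈ A
    · refine ⟨q, Finset.mem_insert_self _ _, ?_⟩
      by_contra hxq
      exact hxA (Finset.mem_sdiff.mpr ⟨hxA', hxq⟩)
    · obtain ⟨j, hj, hxj⟩ := h.covered x hx hxA'
      exact ⟨j, Finset.mem_insert_of_mem hj, hxj⟩
  · intro K hK
    have h1 : A.card ≤ ∑ j ∈ K, (I.sets j ∩ A).card := by
      refine (Finset.card_le_card (t := K.biUnion fun j => I.sets j ∩ A) ?_).trans
        Finset.card_biUnion_le
      intro x hx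
      obtain ⟨j, hj, hxj⟩ := hK.2 x (h.subset_universal hx)
      exact Finset.mem_biUnion.mpr ⟨j, hj, Finset.mem_inter.mpr ⟨hxj, hx⟩⟩
    have h2 : A.card * I.cost q ≤ (I.sets q ∩ A).card * I.totalCost K := by
      calc A.card * I.cost q ≤ (∑ j ∈ K, (I.sets j ∩ A).card) * I.cost q :=
            Nat.mul_le_mul_right _ h1
        _ = ∑ j ∈ K, (I.sets j ∩ A).card * I.cost q := Finset.sum_mul _ _ _
        _ ≤ ∑ j ∈ K, (I.sets q ∩ A).card * I.cost j :=
            Finset.sum_le_sum fun j hj => hbest j (hK.1 hj)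
        _ = _ := (Finset.mul_sum _ _ _).symm
    have hA : (0 : ℚ) < A.card := by exact_mod_cast hcardpos.trans_le hle
    have h3 : (I.cost q : ℚ) ≤ I.totalCost K * (((I.sets q ∩ A).card : ℚ) / A.card) := by
      rw [mul_div_assoc', le_div_iff₀ hA]
      have : ((A.card * I.cost q : ℕ) : ℚ) ≤ ((I.sets q ∩ A).card * I.totalCost K : ℕ) := by
        exact_mod_cast h2
      push_cast at this
      linarith
    have h4 := div_le_harmonic_sub A.card _ hle
    have h5 : (I.totalCost K : ℚ) * (((I.sets q ∩ A).card : ℚ) / A.card) ≤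
        I.totalCost K * (harmonic A.card - harmonic (A.card - (I.sets q ∩ A).card)) :=
      mul_le_mul_of_nonneg_left h4 (Nat.cast_nonneg _)
    have h6 := h.cost_le K hK
    have h7 : (I.totalCost (insert q J) : ℚ) ≤ I.cost q + I.totalCost J := by
      exact_mod_cast hinsert
    rw [hcard]
    linarith
  · intro β hβ
    have h1 : I.cost q ≤ ∑ x ∈ I.sets q ∩ A, β x := by
      refine Nat.le_of_mul_le_mul_left ?_ hcardpos
      calc (I.sets q ∩ A).card * I.cost q = ∑ x ∈ I.sets q ∩ A, I.cost q := by simp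
        _ ≤ ∑ x ∈ I.sets q ∩ A, (I.sets q ∩ A).card * β x := by
            refine Finset.sum_le_sum fun x hx => ?_
            have hxA := (Finset.mem_inter.mp hx).2
            obtain ⟨j, hj, hxj, hjβ⟩ := hβ x (h.subset_universal hxA)
            have hone : 1 ≤ (I.sets j ∩ A).card :=
              Finset.card_pos.mpr ⟨x, Finset.mem_inter.mpr ⟨hxj, hxA⟩⟩
            calc I.cost q ≤ (I.sets j ∩ A).card * I.cost q := Nat.le_mul_of_pos_left _ hone
              _ ≤ (I.sets q ∩ A).card * I.cost j := hbest j hj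
              _ ≤ _ := Nat.mul_le_mul_left _ hjβ
        _ = _ := (Finset.mul_sum _ _ _).symm
    have h2 := h.cost_le_sum β hβ
    have h3 : ∑ x ∈ I.universal \ (A \ I.sets q), β x =
        ∑ x ∈ I.universal \ A, β x + ∑ x ∈ I.sets q ∩ A, β x := by
      rw [← Finset.sum_union]
      · refine Finset.sum_congr ?_ fun _ _ => rfl
        ext x
        have := @h.subset_universal x
        simp only [Finset.mem_sdiff, Finset.mem_union, Finset.mem_inter]
        tauto
      · rw [Finset.disjoint_left]
        intro x hx hx'
        exact (Finset.mem_sdiff.mp hx).2 (Finset.mem_inter.mp hx').2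
    omega

end SetCover

/-- The arithmetic of the size bound: `p` and `m` are the sizes of `F` and of `S \ F`, and `d` is
the number of elements of `F` that cost two. For `p ≥ 3`, where the harmonic number is at least
`11/6`, the first bound for the cost suffices if `11 d ≤ 5 p`, the second one if `p ≤ 5 d`. -/
theorem size_bound (p m d c : ℕ) (hdp : d ≤ p) (hdm : d ≤ m) (h2 : 0 < d → 2 ≤ m)
    (h1 : (c : ℚ) ≤ (m + d) * harmonic p) (hc : c ≤ p + d) :
    (p + c : ℚ) ≤ harmonic p * (p + m) := by
  have hc' : (c : ℚ) ≤ p + d := by exact_mod_cast hc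
  have hdm' : (d : ℚ) ≤ m := by exact_mod_cast hdm
  have hd0 : (0 : ℚ) ≤ d := Nat.cast_nonneg _
  rcases Nat.lt_or_ge p 3 with hp | hp
  · have hm2 : d = 0 ∨ (2 : ℚ) ≤ m := by
      rcases Nat.eq_zero_or_pos d with h | h
      · exact .inl h
      · exact .inr (by exact_mod_cast h2 h)
    interval_cases p
    · have : d = 0 := by omega
      subst this
      simp at *
      omega
    · have e : harmonic 1 = 1 := by norm_num [harmonic_succ]
      rw [e] at h1 ⊢
      have hd1 : (d : ℚ) ≤ 1 := by exact_mod_cast hdp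
      push_cast at *
      rcases hm2 with rfl | hm2
      · push_cast at *; linarith
      · linarith
    · have e : harmonic 2 = 3 / 2 := by norm_num [harmonic_succ]
      rw [e] at h1 ⊢
      have hd2 : (d : ℚ) ≤ 2 := by exact_mod_cast hdp
      push_cast at *
      rcases hm2 with rfl | hm2
      · push_cast at *; linarith
      · linarith
  · have hH : (11 / 6 : ℚ) ≤ harmonic p := by
      have h3 : harmonic 3 = 11 / 6 := by norm_num [harmonic_succ]
      rw [← h3]
      refine monotone_nat_of_le_succ (fun k => ?_) hp
      rw [harmonic_succ]
      exact le_add_of_nonneg_right (by positivity)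
    have hdp' : (d : ℚ) ≤ p := by exact_mod_cast hdp
    rcases le_total ((11 : ℚ) * d) (5 * p) with h | h
    · nlinarith [mul_nonneg (sub_nonneg.mpr hH) (sub_nonneg.mpr hdp')]
    · nlinarith [mul_nonneg (sub_nonneg.mpr hH) (add_nonneg hd0 (hd0.trans hdp')),
        mul_nonneg (sub_nonneg.mpr hdm') (by linarith : (0 : ℚ) ≤ harmonic p)]

/-! ### Matchings by auction -/

/-- The elements below `n` outside `X` can be matched along `E` to distinct numbers below `n`. -/
def MatchableBelow (n : ℕ) (E : ℕ → ℕ → Prop) (X : ℕ → Prop) : Prop :=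
  ∃ g : ℕ → ℕ, (∀ u < n, ¬ X u → g u < n ∧ E u (g u)) ∧
    ∀ u < n, ∀ u' < n, ¬ X u → ¬ X u' → g u = g u' → u = u'

theorem matchable_iff_matchableBelow {n : ℕ} {P : Pattern n} {S : Finset (Fin n)}
    {E : ℕ → ℕ → Prop} {X : ℕ → Prop} (hE : ∀ i j : Fin n, E i j ↔ Edge P i j)
    (hX : ∀ i : Fin n, X i ↔ i ∈ S) : Matchable P S ↔ MatchableBelow n E X := by
  classical
  constructor
  · rintro ⟨π, hπ⟩
    refine ⟨fun u => if h : u < n then (π ⟨u, h⟩ : ℕ) else 0, fun u hu hXu => ?_,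
      fun u hu u' hu' _ _ h => ?_⟩
    · simp only [hu, dif_pos, Fin.is_lt, true_and]
      exact (hE ⟨u, hu⟩ _).mpr (hπ ⟨u, hu⟩ fun h => hXu ((hX ⟨u, hu⟩).mpr h))
    · simp only [hu, hu', dif_pos] at h
      simpa using π.injective (Fin.ext h)
  · rintro ⟨g, hg, hinj⟩
    have hg' : ∀ i : Fin n, i ∉ S → ∃ j : Fin n, (j : ℕ) = g i ∧ Edge P i j := by
      intro i hi
      obtain ⟨h1, h2⟩ := hg i i.2 (fun h => hi ((hX i).mp h))
      exact ⟨⟨g i, h1⟩, rfl, (hE i ⟨g i, h1⟩).mp h2⟩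
    choose! f hf hfE using hg'
    obtain ⟨φ, hφ⟩ := Finset.exists_equiv_extend_of_card_eq (t := (Finset.univ : Finset (Fin n)))
      (by simp) (s := Sᶜ) (f := f) (Finset.subset_univ _) (by
        intro a ha b hb hab
        have ha' : a ∉ S := by simpa using ha
        have hb' : b ∉ S := by simpa using hb
        refine Fin.ext (hinj a a.2 b b.2 (fun h => ha' ((hX a).mp h))
          (fun h => hb' ((hX b).mp h)) ?_)
        rw [← hf a ha', ← hf b hb', hab])
    refine ⟨φ.trans (Equiv.subtypeUnivEquiv (fun x => Finset.mem_univ x)), fun i hi => ?_⟩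
    have := hφ i (by simpa using hi)
    rw [Equiv.trans_apply, Equiv.subtypeUnivEquiv_apply, this]
    exact hfE i hi

/-- The state of an auction. The bidders are the numbers below `n` outside `X`, the objects the
numbers below `n`; object `v` has the price `p v` and the owner `ow v`, where `n` and more stand for
no owner, and `as u` tells whether `u` owns an object or lies in `X`. The last condition says that
every owner paid at most one more than the price of any other acceptable object. -/
structure Auction (n : ℕ) (E : ℕ → ℕ → Prop) (X : ℕ → Prop) (p ow as : ℕ → ℕ) : Prop where
  owner : ∀ v < n, ow v < n → E (ow v) v ∧ ¬ X (ow v) ∧ as (ow v) ≠ 0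
  inj : ∀ v < n, ∀ v' < n, ow v < n → ow v = ow v' → v = v'
  owns : ∀ u < n, as u ≠ 0 → X u ∨ ∃ v < n, ow v = u
  exempt : ∀ u < n, X u → as u ≠ 0
  sold : ∀ v < n, p v ≠ 0 → ow v < n
  price_le : ∀ v < n, p v ≤ n + 1
  slack : ∀ v < n, ow v < n → ∀ v' < n, E (ow v) v' → p v ≤ p v' + 1

namespace Auction

variable {n : ℕ} {E : ℕ → ℕ → Prop} {X : ℕ → Prop} {p ow as : ℕ → ℕ}

/-- If a complete matching exists, then every bidder without an object has an acceptable object of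
price less than `n`. Otherwise each of the `n` price levels from `n` down to `1` would lose an
object to Hall's condition: the bidder and the owners of the objects of price at least `t + 1` have
all their acceptable objects at prices at least `t`. -/
theorem exists_cheap (h : Auction n E X p ow as) (hm : MatchableBelow n E X) {u : ℕ} (hu : u < n)
    (hau : as u = 0) : ∃ v < n, E u v ∧ p v < n := by
  classical
  by_contra hcon
  push Not at hcon
  obtain ⟨g, hg, hinj⟩ := hm
  have hXu : ¬ X u := fun hX => h.exempt u hu hX hau
  let V : ℕ → Finset ℕ := fun t => (Finset.range n).filter (fun v => t ≤ p v)
  have hV : ∀ {t v}, v ∈ V t ↔ v < n ∧ t ≤ p v := by simp [V]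
  have hgu : ∀ t ≤ n, g u ∈ V t := fun t ht =>
    hV.mpr ⟨(hg u hu hXu).1, ht.trans (hcon _ (hg u hu hXu).1 (hg u hu hXu).2)⟩
  have hstep : ∀ t < n, (V (t + 1)).card + 1 ≤ (V t).card := by
    intro t ht
    have hown : ∀ v ∈ V (t + 1), v < n ∧ ow v < n ∧ t + 1 ≤ p v := by
      intro v hv
      obtain ⟨h1, h2⟩ := hV.mp hv
      exact ⟨h1, h.sold v h1 (by omega), h2⟩
    have hnot : u ∉ (V (t + 1)).image ow := by
      intro hmem
      obtain ⟨v, hv, hvu⟩ := Finset.mem_image.mp hmem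
      obtain ⟨h1, h2, _⟩ := hown v hv
      exact (h.owner v h1 h2).2.2 (by rw [hvu, hau])
    have hU : (insert u ((V (t + 1)).image ow)).card = (V (t + 1)).card + 1 := by
      rw [Finset.card_insert_of_notMem hnot, Finset.card_image_of_injOn]
      intro a ha b hb hab
      exact h.inj a (hown a ha).1 b (hown b hb).1 (hown a ha).2.1 hab
    have hbid : ∀ a ∈ insert u ((V (t + 1)).image ow), a < n ∧ ¬ X a ∧ g a ∈ V t := by
      intro a ha
      rcases Finset.mem_insert.mp ha with rfl | ha
      · exact ⟨hu, hXu, hgu t ht.le⟩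
      · obtain ⟨v, hv, rfl⟩ := Finset.mem_image.mp ha
        obtain ⟨h1, h2, h3⟩ := hown v hv
        have hXv := (h.owner v h1 h2).2.1
        obtain ⟨h4, h5⟩ := hg _ h2 hXv
        have := h.slack v h1 h2 _ h4 h5
        exact ⟨h2, hXv, hV.mpr ⟨h4, by omega⟩⟩
    rw [← hU]
    refine Finset.card_le_card_of_injOn g (fun a ha => (hbid a ha).2.2) ?_
    intro a ha b hb hab
    exact hinj a (hbid a ha).1 b (hbid b hb).1 (hbid a ha).2.1 (hbid b hb).2.1 hab
  have hsum : ∀ k ≤ n, k + 1 ≤ (V (n - k)).card := by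
    intro k
    induction k with
    | zero => intro _; exact Finset.card_pos.mpr ⟨_, hgu n le_rfl⟩
    | succ k ih =>
      intro hk
      have h1 := ih (by omega)
      have h2 := hstep (n - (k + 1)) (by omega)
      have h3 : n - (k + 1) + 1 = n - k := by omega
      rw [h3] at h2
      omega
  have h1 := hsum n le_rfl
  have h2 : (V (n - n)).card ≤ n := (Finset.card_filter_le _ _).trans (by simp)
  omega

theorem start (as : ℕ → ℕ) (has : ∀ u < n, as u ≠ 0 ↔ X u) (hp : ∀ v < n, p v = 0)
    (how : ∀ v < n, ow v = n) : Auction n E X p ow as where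
  owner v hv h := by have := how v hv; omega
  inj v hv _ _ h := by have := how v hv; omega
  owns u hu h := .inl ((has u hu).mp h)
  exempt u hu h := (has u hu).mpr h
  sold v hv h := absurd (hp v hv) h
  price_le v hv := by have := hp v hv; omega
  slack v hv h := by have := how v hv; omega

/-- A bid: the unassigned bidder `u` takes a cheapest acceptable object `v` from its owner, and the
price of `v` increases by one. The cap at `n` keeps the prices bounded even when no complete
matching exists. -/
theorem bid (h : Auction n E X p ow as) {u v : ℕ} (hu : u < n) (hau : as u = 0) (hv : v < n)
    (huv : E u v) (hmin : ∀ j < n, E u j → p v ≤ p j) {p' ow' as' : ℕ → ℕ}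
    (hp' : ∀ j < n, p' j = if j = v then min (p v) n + 1 else p j)
    (how' : ∀ j < n, ow' j = if j = v then u else ow j)
    (has' : ∀ i < n, as' i = if i = u then 1 else if i = ow v then 0 else as i) :
    Auction n E X p' ow' as' := by
  have hXu : ¬ X u := fun hX => h.exempt u hu hX hau
  have hne : ∀ j < n, ow j < n → ow j ≠ u := by
    intro j hj hj' he
    exact (h.owner j hj hj').2.2 (by rw [he, hau])
  have hpv := h.price_le v hv
  refine ⟨?_, ?_, ?_, ?_, ?_, ?_, ?_⟩
  · intro j hj hlt
    rw [how' j hj] at hlt ⊢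
    split_ifs at hlt ⊢ with hjv
    · subst hjv
      exact ⟨huv, hXu, by rw [has' u hu]; simp⟩
    · obtain ⟨h1, h2, h3⟩ := h.owner j hj hlt
      refine ⟨h1, h2, ?_⟩
      rw [has' _ hlt, if_neg (hne j hj hlt), if_neg]
      · exact h3
      · intro he
        exact hjv (h.inj j hj v hv hlt he)
  · intro j hj j' hj' hlt he
    rw [how' j hj] at hlt he
    rw [how' j' hj'] at he
    split_ifs at hlt he with h1 h2 h2
    · rw [h1, h2]
    · exact absurd he.symm (hne j' hj' (he ▸ hu))
    · exact absurd he (hne j hj hlt)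
    · exact h.inj j hj j' hj' hlt he
  · intro i hi hne0
    rw [has' i hi] at hne0
    split_ifs at hne0 with h1 h2
    · exact .inr ⟨v, hv, by rw [how' v hv, if_pos rfl, h1]⟩
    · exact absurd rfl hne0
    · rcases h.owns i hi hne0 with hX | ⟨j, hj, hji⟩
      · exact .inl hX
      · refine .inr ⟨j, hj, ?_⟩
        rw [how' j hj, if_neg, hji]
        rintro rfl
        exact h2 hji.symm
  · intro i hi hX
    rw [has' i hi]
    have h1 : i ≠ u := by rintro rfl; exact hXu hX
    have h2 : i ≠ ow v := by
      rintro rfl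
      exact (h.owner v hv hi).2.1 hX
    rw [if_neg h1, if_neg h2]
    exact h.exempt i hi hX
  · intro j hj hpj
    rw [how' j hj]
    rw [hp' j hj] at hpj
    split_ifs at hpj ⊢ with h1
    · exact hu
    · exact h.sold j hj hpj
  · intro j hj
    rw [hp' j hj]
    split_ifs
    · omega
    · exact h.price_le j hj
  · intro j hj hlt j' hj' hE
    rw [how' j hj] at hlt hE
    rw [hp' j hj, hp' j' hj']
    split_ifs at hlt hE ⊢ with h1 h2 h2
    · omega
    · have := hmin j' hj' hE
      omega
    · rw [h2] at hE
      have := h.slack j hj hlt v hv hE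
      omega
    · exact h.slack j hj hlt j' hj' hE

/-- When everybody is assigned, the owners form a complete matching. -/
theorem matchableBelow (h : Auction n E X p ow as) (hall : ∀ u < n, as u ≠ 0) :
    MatchableBelow n E X := by
  have hex : ∀ u, u < n → ¬ X u → ∃ v < n, ow v = u := fun u hu hX =>
    (h.owns u hu (hall u hu)).resolve_left hX
  choose! g hg how using hex
  refine ⟨g, fun u hu hX => ⟨hg u hu hX, ?_⟩, fun u hu u' hu' hX hX' he => ?_⟩
  · have h1 := how u hu hX
    have := (h.owner (g u) (hg u hu hX) (by rw [h1]; exact hu)).1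
    rwa [h1] at this
  · rw [← how u hu hX, he, how u' hu' hX']

end Auction

/-- Progress of the auction after `r` rounds, if a complete matching exists: everybody is assigned,
or the prices add up to at least `r`. No price exceeds `n`, whence `n ^ 2` rounds suffice. -/
structure AuctionRound (n : ℕ) (E : ℕ → ℕ → Prop) (X : ℕ → Prop) (p ow as : ℕ → ℕ) (r : ℕ) :
    Prop where
  auction : Auction n E X p ow as
  price_le : MatchableBelow n E X → ∀ v < n, p v ≤ n
  progress : MatchableBelow n E X → (∀ u < n, as u ≠ 0) ∨ r ≤ ∑ v ∈ Finset.range n, p v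

namespace AuctionRound

variable {n : ℕ} {E : ℕ → ℕ → Prop} {X : ℕ → Prop} {p ow as : ℕ → ℕ} {r : ℕ}

theorem start (as : ℕ → ℕ) (has : ∀ u < n, as u ≠ 0 ↔ X u) (hp : ∀ v < n, p v = 0)
    (how : ∀ v < n, ow v = n) : AuctionRound n E X p ow as 0 where
  auction := .start as has hp how
  price_le _ v hv := by have := hp v hv; omega
  progress _ := .inr (Nat.zero_le _)

theorem idle (h : AuctionRound n E X p ow as r)
    (hidle : MatchableBelow n E X → ∀ u < n, as u ≠ 0) : AuctionRound n E X p ow as (r + 1) where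
  auction := h.auction
  price_le := h.price_le
  progress hm := .inl (hidle hm)

theorem bid (h : AuctionRound n E X p ow as r) {u v : ℕ} (hu : u < n) (hau : as u = 0)
    (hv : v < n) (huv : E u v) (hmin : ∀ j < n, E u j → p v ≤ p j) {p' ow' as' : ℕ → ℕ}
    (hp' : ∀ j < n, p' j = if j = v then min (p v) n + 1 else p j)
    (how' : ∀ j < n, ow' j = if j = v then u else ow j)
    (has' : ∀ i < n, as' i = if i = u then 1 else if i = ow v then 0 else as i) :
    AuctionRound n E X p' ow' as' (r + 1) where
  auction := h.auction.bid hu hau hv huv hmin hp' how' has'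
  price_le hm j hj := by
    obtain ⟨w, hw, hEw, hpw⟩ := h.auction.exists_cheap hm hu hau
    have h1 := hmin w hw hEw
    rw [hp' j hj]
    split_ifs
    · omega
    · exact h.price_le hm j hj
  progress hm := by
    right
    have hr : r ≤ ∑ j ∈ Finset.range n, p j := by
      rcases h.progress hm with hall | hr
      · exact absurd hau (hall u hu)
      · exact hr
    obtain ⟨w, hw, hEw, hpw⟩ := h.auction.exists_cheap hm hu hau
    have h1 := hmin w hw hEw
    have h2 : ∑ j ∈ Finset.range n, p j < ∑ j ∈ Finset.range n, p' j := by
      refine Finset.sum_lt_sum (fun j hj => ?_) ⟨v, Finset.mem_range.mpr hv, ?_⟩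
      · rw [hp' j (Finset.mem_range.mp hj)]
        split_ifs with hjv
        · subst hjv; omega
        · exact le_rfl
      · rw [hp' v hv, if_pos rfl]; omega
    omega

theorem matchableBelow_iff (h : AuctionRound n E X p ow as (n * n)) :
    MatchableBelow n E X ↔ ∀ u < n, as u ≠ 0 := by
  refine ⟨fun hm => ?_, h.auction.matchableBelow⟩
  rcases h.progress hm with hall | hsum
  · exact hall
  · intro u hu hau
    obtain ⟨w, hw, _, hpw⟩ := h.auction.exists_cheap hm hu hau
    have h1 : ∑ v ∈ Finset.range n, p v < ∑ _v ∈ Finset.range n, n :=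
      Finset.sum_lt_sum (fun j hj => h.price_le hm j (Finset.mem_range.mp hj))
        ⟨w, Finset.mem_range.mpr hw, hpw⟩
    simp at h1
    omega

end AuctionRound

/-! ### Tests, addresses and tables in the language -/

namespace Ex

/-- The test `a = b`. -/
def eqE (a b : Ex) : Ex := ite (minus a b) (lit 0) (ite (minus b a) (lit 0) (lit 1))

/-- The test `a < b`. -/
def ltE (a b : Ex) : Ex := ite (minus b a) (lit 1) (lit 0)

/-- Conjunction of tests. -/
def andE (a b : Ex) : Ex := ite a (ite b (lit 1) (lit 0)) (lit 0)

/-- Disjunction of tests. -/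
def orE (a b : Ex) : Ex := ite a (lit 1) (ite b (lit 1) (lit 0))

/-- Negation of a test. -/
def notE (a : Ex) : Ex := ite a (lit 0) (lit 1)

/-- The minimum of `a` and `n`, which turns a value from the memory into a bounded one. -/
def cap (a : Ex) : Ex := minus (var 0) (minus (var 0) a)

/-- The address of the entry `(a, b)` of a table with rows of length `n`. -/
def idx2 (a b : Ex) : Ex := plus (times a (var 0)) b

/-- The address of the entry `(a, b, c)` of a table with three indices. -/
def idx3 (a b c : Ex) : Ex := idx2 (idx2 a b) c

variable (ρ : List ℕ) (M : Mem) (a b c : Ex)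

@[simp] theorem eval_var (r : ℕ) : (var r).eval ρ M = ρ.getD r 0 := rfl

@[simp] theorem eval_lit (r : ℕ) : (lit r).eval ρ M = r := rfl

@[simp] theorem eval_plus : (plus a b).eval ρ M = a.eval ρ M + b.eval ρ M := rfl

@[simp] theorem eval_get (k : ℕ) : (get k a).eval ρ M = M k (a.eval ρ M) := rfl

@[simp] theorem eval_ite :
    (ite c a b).eval ρ M = if c.eval ρ M ≠ 0 then a.eval ρ M else b.eval ρ M := rfl

@[simp] theorem eval_eqE : (eqE a b).eval ρ M = if a.eval ρ M = b.eval ρ M then 1 else 0 := by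
  have : ∀ x y : ℕ, (if x - y ≠ 0 then 0 else if y - x ≠ 0 then 0 else 1) =
      if x = y then 1 else 0 := by
    intro x y
    rcases lt_trichotomy x y with h | rfl | h
    · rw [if_neg (by omega), if_pos (by omega), if_neg h.ne]
    · simp
    · rw [if_pos (by omega), if_neg h.ne']
  exact this _ _

@[simp] theorem eval_ltE : (ltE a b).eval ρ M = if a.eval ρ M < b.eval ρ M then 1 else 0 := by
  simp only [ltE, eval, ne_eq, Nat.sub_eq_zero_iff_le, not_le]

@[simp] theorem eval_andE :
    (andE a b).eval ρ M = if a.eval ρ M ≠ 0 ∧ b.eval ρ M ≠ 0 then 1 else 0 := by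
  simp only [andE, eval]
  split_ifs <;> tauto

@[simp] theorem eval_orE :
    (orE a b).eval ρ M = if a.eval ρ M ≠ 0 ∨ b.eval ρ M ≠ 0 then 1 else 0 := by
  simp only [orE, eval]
  split_ifs <;> tauto

@[simp] theorem eval_notE : (notE a).eval ρ M = if a.eval ρ M = 0 then 1 else 0 := by
  simp only [notE, eval]
  split_ifs <;> tauto

theorem ne_zero_ite : (ite c a b).eval ρ M ≠ 0 ↔
    if c.eval ρ M ≠ 0 then a.eval ρ M ≠ 0 else b.eval ρ M ≠ 0 := by
  rw [eval_ite]; split_ifs <;> rfl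

theorem ne_zero_eqE : (eqE a b).eval ρ M ≠ 0 ↔ a.eval ρ M = b.eval ρ M := by simp

theorem ne_zero_ltE : (ltE a b).eval ρ M ≠ 0 ↔ a.eval ρ M < b.eval ρ M := by simp

theorem ne_zero_andE : (andE a b).eval ρ M ≠ 0 ↔ a.eval ρ M ≠ 0 ∧ b.eval ρ M ≠ 0 := by simp

theorem ne_zero_orE : (orE a b).eval ρ M ≠ 0 ↔ a.eval ρ M ≠ 0 ∨ b.eval ρ M ≠ 0 := by
  simp [or_iff_not_imp_left]

theorem ne_zero_notE : (notE a).eval ρ M ≠ 0 ↔ ¬ a.eval ρ M ≠ 0 := by simp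

@[simp] theorem eval_cap : (cap a).eval ρ M = min (a.eval ρ M) (ρ.getD 0 0) := by
  simp only [cap, eval]
  omega

@[simp] theorem eval_idx2 :
    (idx2 a b).eval ρ M = a.eval ρ M * ρ.getD 0 0 + b.eval ρ M := rfl

@[simp] theorem eval_idx3 :
    (idx3 a b c).eval ρ M = (a.eval ρ M * ρ.getD 0 0 + b.eval ρ M) * ρ.getD 0 0 + c.eval ρ M := rfl

/-- The arrays that an expression reads. -/
def reads : Ex → List ℕ
  | var _ => []
  | lit _ => []
  | plus a b => a.reads ++ b.reads
  | minus a b => a.reads ++ b.reads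
  | times a b => a.reads ++ b.reads
  | get k a => k :: a.reads
  | ite c a b => c.reads ++ (a.reads ++ b.reads)

theorem eval_congr {M M' : Mem} {ρ : List ℕ} {e : Ex} (h : ∀ k ∈ e.reads, M k = M' k) :
    e.eval ρ M = e.eval ρ M' := by
  induction e with
  | var r => rfl
  | lit c => rfl
  | plus a b iha ihb =>
    simp only [reads, List.mem_append] at h
    simp only [eval]
    rw [iha fun k hk => h k (.inl hk), ihb fun k hk => h k (.inr hk)]
  | minus a b iha ihb =>
    simp only [reads, List.mem_append] at h
    simp only [eval]
    rw [iha fun k hk => h k (.inl hk), ihb fun k hk => h k (.inr hk)]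
  | times a b iha ihb =>
    simp only [reads, List.mem_append] at h
    simp only [eval]
    rw [iha fun k hk => h k (.inl hk), ihb fun k hk => h k (.inr hk)]
  | get k a ih =>
    simp only [reads, List.mem_cons] at h
    simp only [eval]
    rw [ih fun k hk => h k (.inr hk), h k (.inl rfl)]
  | ite c a b ihc iha ihb =>
    simp only [reads, List.mem_append] at h
    simp only [eval]
    rw [ihc fun k hk => h k (.inl hk), iha fun k hk => h k (.inr (.inl hk)),
      ihb fun k hk => h k (.inr (.inr hk))]

end Ex

open Ex

theorem getD_zero_snoc {ρ : List ℕ} {n i : ℕ} (h : ρ.getD 0 0 = n) (hi : i < n) :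
    (ρ ++ [i]).getD 0 0 = n := by
  rcases ρ with _ | ⟨a, ρ⟩
  · simp at h; omega
  · simpa using h

theorem run_loop {ρ : List ℕ} {n : ℕ} (h0 : ρ.getD 0 0 = n) (b : St) (M : Mem) :
    (St.loop b).run ρ M = iter n (fun i M => b.run (ρ ++ [i]) M) M := by
  rw [St.run, h0]

/-- Two memories agree outside the arrays in `W`. -/
def AgreeOff (W : List ℕ) (M M' : Mem) : Prop := ∀ k, k ∉ W → M k = M' k

theorem AgreeOff.refl (W : List ℕ) (M : Mem) : AgreeOff W M M := fun _ _ => rfl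

theorem AgreeOff.trans {W : List ℕ} {M M' M'' : Mem} (h : AgreeOff W M M')
    (h' : AgreeOff W M' M'') : AgreeOff W M M'' := fun k hk => (h k hk).trans (h' k hk)

theorem AgreeOff.mono {W W' : List ℕ} {M M' : Mem} (h : AgreeOff W M M') (hW : W ⊆ W') :
    AgreeOff W' M M' := fun k hk => h k (fun hk' => hk (hW hk'))

theorem AgreeOff.set {W : List ℕ} {M M' : Mem} (h : AgreeOff W M M') {k : ℕ} (hk : k ∈ W)
    (a v : ℕ) : AgreeOff W (M.set k a v) M' := fun k' hk' => by
  rw [Mem.set_ne_arr _ _ _ (by rintro rfl; exact hk' hk)]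
  exact h k' hk'

/-- Run on a memory that agrees with `M₀` outside `W`, the transformation `f` preserves this
property, writes `v` into cell `a` of array `k`, and leaves the rest of array `k` alone. -/
def WritesCell (f : Mem → Mem) (W : List ℕ) (k : ℕ) (M₀ : Mem) (a v : ℕ) : Prop :=
  ∀ M, AgreeOff W M M₀ → AgreeOff W (f M) M₀ ∧ f M k = Function.update (M k) a v

/-- Run on a memory that agrees with `M₀` outside `W`, the transformation `f` preserves this
property, fills the cells in `D` of array `k` with the values `g`, and leaves the rest of array `k`
alone. -/
def Fills (f : Mem → Mem) (W : List ℕ) (k : ℕ) (M₀ : Mem) (D : Set ℕ) (g : ℕ → ℕ) : Prop :=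
  ∀ M, AgreeOff W M M₀ →
    AgreeOff W (f M) M₀ ∧ (∀ a ∈ D, f M k a = g a) ∧ ∀ a, a ∉ D → f M k a = M k a

theorem WritesCell.fills {f : Mem → Mem} {W : List ℕ} {k : ℕ} {M₀ : Mem} {a v : ℕ} {g : ℕ → ℕ}
    (h : WritesCell f W k M₀ a v) (hg : g a = v) : Fills f W k M₀ {a} g := by
  intro M hM
  obtain ⟨h1, h2⟩ := h M hM
  refine ⟨h1, fun a' ha' => ?_, fun a' ha' => ?_⟩
  · rw [Set.mem_singleton_iff] at ha'
    rw [h2, ha', Function.update_self, hg]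
  · rw [h2, Function.update_of_ne ha']

theorem Fills.loop {ρ : List ℕ} {n : ℕ} (h0 : ρ.getD 0 0 = n) {b : St} {W : List ℕ} {k : ℕ}
    {M₀ : Mem} {D : ℕ → Set ℕ} {g : ℕ → ℕ}
    (h : ∀ i < n, Fills (b.run (ρ ++ [i])) W k M₀ (D i) g) :
    Fills ((St.loop b).run ρ) W k M₀ {a | ∃ i < n, a ∈ D i} g := by
  intro M hM
  rw [run_loop h0]
  refine iter_invariant (fun i M' => AgreeOff W M' M₀ ∧
    (∀ a ∈ {a | ∃ i' < i, a ∈ D i'}, M' k a = g a) ∧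
    ∀ a, a ∉ {a | ∃ i' < i, a ∈ D i'} → M' k a = M k a) ⟨hM, by simp, by simp⟩ ?_
  rintro i hi M' ⟨h1, h2, h3⟩
  obtain ⟨h4, h5, h6⟩ := h i hi M' h1
  refine ⟨h4, ?_, ?_⟩
  · rintro a ⟨i', hi', ha⟩
    by_cases hai : a ∈ D i
    · exact h5 a hai
    · rw [h6 a hai]
      refine h2 a ⟨i', ?_, ha⟩
      rcases Nat.lt_succ_iff_lt_or_eq.mp hi' with h | rfl
      · exact h
      · exact absurd ha hai
  · intro a ha
    rw [h6 a fun hai => ha ⟨i, by omega, hai⟩]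
    exact h3 a fun ⟨i', hi', ha'⟩ => ha ⟨i', by omega, ha'⟩

theorem add_mul_div_mod {n i j : ℕ} (hj : j < n) : (i * n + j) / n = i ∧ (i * n + j) % n = j := by
  have hn : 0 < n := by omega
  constructor
  · rw [mul_comm, Nat.mul_add_div hn, Nat.div_eq_of_lt hj, add_zero]
  · rw [mul_comm, Nat.mul_add_mod, Nat.mod_eq_of_lt hj]

theorem table1 {ρ : List ℕ} {n : ℕ} (h0 : ρ.getD 0 0 = n) {b : St} {W : List ℕ} {k : ℕ}
    {M : Mem} {val : ℕ → ℕ} (h : ∀ i < n, WritesCell (b.run (ρ ++ [i])) W k M i (val i)) :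
    AgreeOff W ((St.loop b).run ρ M) M ∧ ∀ i < n, (St.loop b).run ρ M k i = val i := by
  obtain ⟨h1, h2, _⟩ := Fills.loop h0 (g := val) (fun i hi => (h i hi).fills rfl) M (.refl _ _)
  exact ⟨h1, fun i hi => h2 i ⟨i, hi, rfl⟩⟩

theorem table2 {ρ : List ℕ} {n : ℕ} (h0 : ρ.getD 0 0 = n) {b : St} {W : List ℕ} {k : ℕ}
    {M : Mem} {val : ℕ → ℕ → ℕ}
    (h : ∀ i < n, ∀ j < n, WritesCell (b.run (ρ ++ [i] ++ [j])) W k M (i * n + j) (val i j)) :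
    AgreeOff W ((St.loop (.loop b)).run ρ M) M ∧
      ∀ i < n, ∀ j < n, (St.loop (.loop b)).run ρ M k (i * n + j) = val i j := by
  obtain ⟨h1, h2, _⟩ := Fills.loop h0 (g := fun a => val (a / n) (a % n))
    (fun i hi => Fills.loop (getD_zero_snoc h0 hi) fun j hj => (h i hi j hj).fills (by
      rw [(add_mul_div_mod hj).1, (add_mul_div_mod hj).2])) M (.refl _ _)
  refine ⟨h1, fun i hi j hj => ?_⟩
  rw [h2 _ ⟨i, hi, j, hj, rfl⟩]
  simp only [add_mul_div_mod hj]

theorem table3 {ρ : List ℕ} {n : ℕ} (h0 : ρ.getD 0 0 = n) {b : St} {W : List ℕ} {k : ℕ}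
    {M : Mem} {val : ℕ → ℕ → ℕ → ℕ}
    (h : ∀ i < n, ∀ j < n, ∀ l < n,
      WritesCell (b.run (ρ ++ [i] ++ [j] ++ [l])) W k M ((i * n + j) * n + l) (val i j l)) :
    AgreeOff W ((St.loop (.loop (.loop b))).run ρ M) M ∧ ∀ i < n, ∀ j < n, ∀ l < n,
      (St.loop (.loop (.loop b))).run ρ M k ((i * n + j) * n + l) = val i j l := by
  obtain ⟨h1, h2, _⟩ := Fills.loop h0 (g := fun a => val (a / n / n) (a / n % n) (a % n))
    (fun i hi => Fills.loop (getD_zero_snoc h0 hi) fun j hj =>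
      Fills.loop (getD_zero_snoc (getD_zero_snoc h0 hi) hj) fun l hl =>
      (h i hi j hj l hl).fills (by
        rw [(add_mul_div_mod hl).1, (add_mul_div_mod hl).2, (add_mul_div_mod hj).1,
          (add_mul_div_mod hj).2])) M (.refl _ _)
  refine ⟨h1, fun i hi j hj l hl => ?_⟩
  rw [h2 _ ⟨i, hi, j, hj, l, hl, rfl⟩]
  simp only [add_mul_div_mod hl, add_mul_div_mod hj]

theorem WritesCell.put {ρ : List ℕ} {W : List ℕ} {k : ℕ} {M₀ : Mem} {a e : Ex} {A : ℕ}
    (hk : k ∈ W) (ha : ∀ M, a.eval ρ M = A) (he : ∀ l ∈ e.reads, l ∉ W) :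
    WritesCell ((St.put k a e).run ρ) W k M₀ A (e.eval ρ M₀) := by
  intro M hM
  refine ⟨hM.set hk _ _, ?_⟩
  rw [St.run, ha, Mem.set, Function.update_self, eval_congr fun l hl => hM l (he l hl)]

/-- Store in cell `a` of array `k` whether some value of a new variable satisfies the test `c`. -/
def St.putAny (k : ℕ) (a c : Ex) : St :=
  .seq (.put k a (.lit 0)) (.loop (.ite c (.put k a (.lit 1)) .skip))

open Classical in
theorem WritesCell.putAny {ρ : List ℕ} {n : ℕ} (h0 : ρ.getD 0 0 = n) {W : List ℕ} {k : ℕ}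
    {M₀ : Mem} {a c : Ex} {A : ℕ} (hk : k ∈ W) (ha : ∀ M, a.eval ρ M = A)
    (ha' : ∀ i M, a.eval (ρ ++ [i]) M = A) (hc : ∀ l ∈ c.reads, l ∉ W) :
    WritesCell ((St.putAny k a c).run ρ) W k M₀ A
      (if ∃ i < n, c.eval (ρ ++ [i]) M₀ ≠ 0 then 1 else 0) := by
  intro M hM
  rw [St.putAny, St.run, St.run, run_loop h0, ha]
  have key := iter_invariant (m := n)
    (f := fun i M => (St.ite c (.put k a (.lit 1)) .skip).run (ρ ++ [i]) M)
    (M := M.set k A ((Ex.lit 0).eval ρ M))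
    (fun m M' => AgreeOff W M' M₀ ∧
      M' k = Function.update (M k) A (if ∃ i < m, c.eval (ρ ++ [i]) M₀ ≠ 0 then 1 else 0))
    ⟨hM.set hk _ _, by simp [Mem.set]⟩ (by
      rintro i hi M' ⟨h1, h2⟩
      have hci : c.eval (ρ ++ [i]) M' = c.eval (ρ ++ [i]) M₀ :=
        eval_congr fun l hl => h1 l (hc l hl)
      by_cases hci0 : c.eval (ρ ++ [i]) M₀ = 0
      · have : (∃ i' < i + 1, c.eval (ρ ++ [i']) M₀ ≠ 0) ↔ ∃ i' < i, c.eval (ρ ++ [i']) M₀ ≠ 0 := by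
          constructor
          · rintro ⟨i', h3, h4⟩
            refine ⟨i', ?_, h4⟩
            rcases Nat.lt_succ_iff_lt_or_eq.mp h3 with h | rfl
            · exact h
            · exact absurd hci0 h4
          · rintro ⟨i', h3, h4⟩
            exact ⟨i', by omega, h4⟩
        simp only [St.run, hci, hci0, ne_eq, not_true_eq_false, if_false]
        refine ⟨h1, ?_⟩
        rw [h2]
        simp only [ne_eq] at this
        simp only [this]
      · have : ∃ i' < i + 1, c.eval (ρ ++ [i']) M₀ ≠ 0 := ⟨i, by omega, hci0⟩
        rw [if_pos this]
        simp only [St.run, hci, ne_eq, hci0, not_false_eq_true, if_true, ha', eval_lit]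
        refine ⟨h1.set hk _ _, ?_⟩
        rw [Mem.set, Function.update_self, h2, Function.update_idem])
  exact key

/-! ### A program for reachability -/

/-- Array 10 receives the reflexive closure of the edge relation. -/
def reflexiveEdges : St :=
  .loop (.loop (.put 10 (idx2 (var 1) (var 2))
    (orE (eqE (var 1) (var 2)) (get 0 (idx2 (var 2) (var 1))))))

/-- One round of the algorithm of Floyd and Warshall, with the value of variable `1` as pivot. The
new relation is built in array 11, so that the entries are updated simultaneously. -/
def warshallRound : St :=
  .seq
    (.loop (.loop (.put 11 (idx2 (var 2) (var 3)) (orE (get 10 (idx2 (var 2) (var 3)))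
      (andE (get 10 (idx2 (var 2) (var 1))) (get 10 (idx2 (var 1) (var 3))))))))
    (.loop (.loop (.put 10 (idx2 (var 2) (var 3)) (get 11 (idx2 (var 2) (var 3))))))

/-- Array 10 receives the reachability relation of the digraph in array 0. -/
def reachability : St := .seq reflexiveEdges (.loop warshallRound)

theorem run_warshallRound {n k : ℕ} (M : Mem) :
    AgreeOff [10, 11] (warshallRound.run [n, k] M) M ∧
      ∀ i < n, ∀ j < n, (warshallRound.run [n, k] M 10 (i * n + j) ≠ 0 ↔
        M 10 (i * n + j) ≠ 0 ∨ (M 10 (i * n + k) ≠ 0 ∧ M 10 (k * n + j) ≠ 0)) := by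
  obtain ⟨h1, h2⟩ := table2 (ρ := [n, k]) (n := n) rfl (W := [11]) (k := 11) (M := M)
    (b := .put 11 (idx2 (var 2) (var 3)) (orE (get 10 (idx2 (var 2) (var 3)))
      (andE (get 10 (idx2 (var 2) (var 1))) (get 10 (idx2 (var 1) (var 3))))))
    fun i _ j _ => .put (by decide) (fun _ => rfl) (by decide)
  set M' := (St.loop (.loop (.put 11 (idx2 (var 2) (var 3)) (orE (get 10 (idx2 (var 2) (var 3)))
      (andE (get 10 (idx2 (var 2) (var 1))) (get 10 (idx2 (var 1) (var 3)))))))).run [n, k] M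
  obtain ⟨h3, h4⟩ := table2 (ρ := [n, k]) (n := n) rfl (W := [10]) (k := 10) (M := M')
    (b := .put 10 (idx2 (var 2) (var 3)) (get 11 (idx2 (var 2) (var 3))))
    fun i _ j _ => .put (by decide) (fun _ => rfl) (by decide)
  refine ⟨(h3.mono (by simp)).trans (h1.mono (by simp)), fun i hi j hj => ?_⟩
  have h5 := h4 i hi j hj
  have h6 := h2 i hi j hj
  change warshallRound.run [n, k] M 10 (i * n + j) = M' 11 (i * n + j) at h5
  rw [h5, h6]
  simp
  by_cases a : M 10 (i * n + j) = 0 <;> simp [a]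

theorem run_reachability {n : ℕ} {P : Pattern n} {M : Mem}
    (hP : ∀ i j : Fin n, M 0 ((i : ℕ) * n + j) = if P i j = true then 1 else 0) :
    AgreeOff [10, 11] (reachability.run [n] M) M ∧
      ∀ i j : Fin n, reachability.run [n] M 10 ((i : ℕ) * n + j) ≠ 0 ↔ Reach P i j := by
  obtain ⟨h1, h2⟩ := table2 (ρ := [n]) (n := n) rfl (W := [10]) (k := 10) (M := M)
    (b := .put 10 (idx2 (var 1) (var 2))
      (orE (eqE (var 1) (var 2)) (get 0 (idx2 (var 2) (var 1)))))
    fun i _ j _ => .put (by decide) (fun _ => rfl) (by decide)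
  set M' := reflexiveEdges.run [n] M with hM'
  have hstart : ∀ i j : Fin n, M' 10 ((i : ℕ) * n + j) ≠ 0 ↔ i = j ∨ Edge P i j := by
    intro i j
    have := h2 i i.2 j j.2
    rw [hM', reflexiveEdges, this]
    simp [hP j i, Edge, Fin.ext_iff, or_iff_not_imp_left]
  have key : AgreeOff [10, 11] (reachability.run [n] M) M ∧
      (∀ i j : Fin n, reachability.run [n] M 10 ((i : ℕ) * n + j) ≠ 0 → Reach P i j) ∧
      (∀ i j : Fin n, i = j ∨ Edge P i j → reachability.run [n] M 10 ((i : ℕ) * n + j) ≠ 0) ∧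
      ∀ p : Fin n, (p : ℕ) < n → ∀ i j : Fin n,
        reachability.run [n] M 10 ((i : ℕ) * n + p) ≠ 0 →
        reachability.run [n] M 10 ((p : ℕ) * n + j) ≠ 0 →
        reachability.run [n] M 10 ((i : ℕ) * n + j) ≠ 0 := by
    -- after `k` rounds the relation is transitive through the first `k` vertices
    rw [reachability, St.run, run_loop rfl]
    refine iter_invariant (fun k N => AgreeOff [10, 11] N M ∧
      (∀ i j : Fin n, N 10 ((i : ℕ) * n + j) ≠ 0 → Reach P i j) ∧
      (∀ i j : Fin n, i = j ∨ Edge P i j → N 10 ((i : ℕ) * n + j) ≠ 0) ∧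
      ∀ p : Fin n, (p : ℕ) < k → ∀ i j : Fin n, N 10 ((i : ℕ) * n + p) ≠ 0 →
        N 10 ((p : ℕ) * n + j) ≠ 0 → N 10 ((i : ℕ) * n + j) ≠ 0) ?_ ?_
    · refine ⟨h1.mono (by simp), fun i j h => ?_, fun i j h => (hstart i j).mpr h, by simp⟩
      rcases (hstart i j).mp h with rfl | h
      · exact .refl
      · exact .single h
    · rintro k hk N ⟨a1, a2, a3, a4⟩
      obtain ⟨b1, b2⟩ := run_warshallRound (n := n) (k := k) N
      replace b2 : ∀ i j : Fin n, warshallRound.run ([n] ++ [k]) N 10 ((i : ℕ) * n + j) ≠ 0 ↔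
          N 10 (i * n + j) ≠ 0 ∨ (N 10 (i * n + k) ≠ 0 ∧ N 10 (k * n + j) ≠ 0) :=
        fun i j => b2 i i.2 j j.2
      refine ⟨b1.trans a1, fun i j h => ?_, fun i j h => (b2 i j).mpr (.inl (a3 i j h)),
        fun p hp i j h h' => ?_⟩
      · rcases (b2 i j).mp h with h | ⟨h, h'⟩
        · exact a2 i j h
        · exact (a2 i ⟨k, hk⟩ h).trans (a2 ⟨k, hk⟩ j h')
      · rw [b2] at h h' ⊢
        rcases Nat.lt_succ_iff_lt_or_eq.mp hp with hp | hp
        · rcases h with h | ⟨h, h''⟩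
          · rcases h' with h' | ⟨h', h'''⟩
            · exact .inl (a4 p hp i j h h')
            · exact .inr ⟨a4 p hp i ⟨k, hk⟩ h h', h'''⟩
          · rcases h' with h' | ⟨h', h'''⟩
            · exact .inr ⟨h, a4 p hp ⟨k, hk⟩ j h'' h'⟩
            · exact .inr ⟨h, h'''⟩
        · subst hp
          exact .inr ⟨h.elim id And.left, h'.elim id And.right⟩
  obtain ⟨k1, k2, k3, k4⟩ := key
  refine ⟨k1, fun i j => ⟨k2 i j, fun h => ?_⟩⟩
  induction h with
  | refl => exact k3 i i (.inl rfl)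
  | tail _ he ih => exact k4 _ (Fin.is_lt _) _ _ ih (k3 _ _ (.inr he))

/-! ### A program for the matching tests -/

/-- Array 18 receives, in cell 0, an unassigned bidder, or `n` if there is none. -/
def selectBidder : St :=
  .seq (.put 18 (lit 0) (var 0))
    (.loop (.ite (get 17 (var 5)) .skip (.put 18 (lit 0) (var 5))))

/-- Array 18 receives, in cell 1, a cheapest object that the bidder in cell 0 accepts, or `n` if
there is none. -/
def selectObject : St :=
  .seq (.put 18 (lit 1) (var 0))
    (.loop (.ite (andE (get 0 (idx2 (var 5) (cap (get 18 (lit 0)))))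
      (orE (eqE (get 18 (lit 1)) (var 0)) (ltE (get 15 (var 5)) (get 15 (get 18 (lit 1))))))
      (.put 18 (lit 1) (var 5)) .skip))

/-- The bidder in cell 0 of array 18 takes the object in cell 1, whose old owner becomes unassigned.
-/
def takeObject : St :=
  .seq (.ite (ltE (get 16 (get 18 (lit 1))) (var 0)) (.put 17 (get 16 (get 18 (lit 1))) (lit 0))
    .skip) (.seq (.put 16 (get 18 (lit 1)) (get 18 (lit 0))) (.seq
    (.put 17 (get 18 (lit 0)) (lit 1))
    (.put 15 (get 18 (lit 1)) (plus (cap (get 15 (get 18 (lit 1)))) (lit 1)))))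

/-- One round of the auction. The arrays 15, 16 and 17 hold the prices, the owners of the objects
and the assignment flags of the bidders. -/
def auctionRound : St :=
  .seq selectBidder (.seq selectObject
    (.ite (andE (ltE (get 18 (lit 0)) (var 0)) (ltE (get 18 (lit 1)) (var 0))) takeObject .skip))

theorem run_selectBidder {n x w r r' : ℕ} (M : Mem) :
    ∃ u, selectBidder.run [n, x, w, r, r'] M = M.set 18 0 u ∧
      ((u = n ∧ ∀ i < n, M 17 i ≠ 0) ∨ (u < n ∧ M 17 u = 0)) := by
  rw [selectBidder, St.run, run_loop rfl]
  refine iter_invariant (fun k N => ∃ u, N = M.set 18 0 u ∧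
    ((u = n ∧ ∀ i < k, M 17 i ≠ 0) ∨ (u < n ∧ M 17 u = 0))) ⟨n, rfl, .inl ⟨rfl, by simp⟩⟩ ?_
  rintro k hk N ⟨u, rfl, hu⟩
  by_cases h : M 17 k = 0
  · refine ⟨k, ?_, .inr ⟨hk, h⟩⟩
    simp [St.run, Mem.set_apply, h, Mem.set_set]
  · refine ⟨u, ?_, ?_⟩
    · simp [St.run, Mem.set_apply, h]
    · rcases hu with ⟨rfl, hu⟩ | hu
      · refine .inl ⟨rfl, fun i hi => ?_⟩
        rcases Nat.lt_succ_iff_lt_or_eq.mp hi with hi | rfl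
        · exact hu i hi
        · exact h
      · exact .inr hu

theorem run_selectObject {n x w r r' u : ℕ} (M : Mem) (hu : M 18 0 = u) (hun : u ≤ n) :
    ∃ v, selectObject.run [n, x, w, r, r'] M = M.set 18 1 v ∧
      ((v = n ∧ ∀ j < n, M 0 (j * n + u) = 0) ∨
        (v < n ∧ M 0 (v * n + u) ≠ 0 ∧ ∀ j < n, M 0 (j * n + u) ≠ 0 → M 15 v ≤ M 15 j)) := by
  rw [selectObject, St.run, run_loop rfl]
  refine iter_invariant (fun k N => ∃ v, N = M.set 18 1 v ∧
    ((v = n ∧ ∀ j < k, M 0 (j * n + u) = 0) ∨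
      (v < n ∧ M 0 (v * n + u) ≠ 0 ∧ ∀ j < k, M 0 (j * n + u) ≠ 0 → M 15 v ≤ M 15 j)))
    ⟨n, rfl, .inl ⟨rfl, by simp⟩⟩ ?_
  rintro k hk N ⟨v, rfl, hv⟩
  by_cases h : M 0 (k * n + u) ≠ 0 ∧ (v = n ∨ M 15 k < M 15 v)
  · refine ⟨k, ?_, .inr ⟨hk, h.1, fun j hj hj' => ?_⟩⟩
    · simp [St.run, Mem.set_apply, h, Mem.set_set, hu, hun]
    · rcases Nat.lt_succ_iff_lt_or_eq.mp hj with hj | rfl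
      · rcases hv with ⟨rfl, hv⟩ | ⟨hvn, hv, hv'⟩
        · exact absurd (hv j hj) hj'
        · have := hv' j hj hj'
          have := h.2.resolve_left hvn.ne
          omega
      · rfl
  · refine ⟨v, ?_, ?_⟩
    · simp [St.run, Mem.set_apply, hu, hun]
      intro h1 h2
      exact absurd ⟨h1, or_iff_not_imp_left.mpr h2⟩ h
    · rcases hv with ⟨rfl, hv⟩ | ⟨hvn, hv, hv'⟩
      · refine .inl ⟨rfl, fun j hj => ?_⟩
        rcases Nat.lt_succ_iff_lt_or_eq.mp hj with hj | rfl
        · exact hv j hj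
        · by_contra hj'
          exact h ⟨hj', .inl rfl⟩
      · refine .inr ⟨hvn, hv, fun j hj hj' => ?_⟩
        rcases Nat.lt_succ_iff_lt_or_eq.mp hj with hj | rfl
        · exact hv' j hj hj'
        · by_contra hlt
          exact h ⟨hj', .inr (by omega)⟩

theorem run_takeObject {n x w r r' u v : ℕ} (M : Mem) (hu : M 18 0 = u) (hv : M 18 1 = v) :
    AgreeOff [15, 16, 17, 18] (takeObject.run [n, x, w, r, r'] M) M ∧
      (∀ j, takeObject.run [n, x, w, r, r'] M 15 j =
        if j = v then min (M 15 v) n + 1 else M 15 j) ∧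
      (∀ j, takeObject.run [n, x, w, r, r'] M 16 j = if j = v then u else M 16 j) ∧
      ∀ i < n, takeObject.run [n, x, w, r, r'] M 17 i =
        if i = u then 1 else if i = M 16 v then 0 else M 17 i := by
  have hrun : ∀ k i, takeObject.run [n, x, w, r, r'] M k i =
      if k = 15 ∧ i = v then min (M 15 v) n + 1 else if k = 17 ∧ i = u then 1 else
      if k = 16 ∧ i = v then u else if M 16 v < n ∧ k = 17 ∧ i = M 16 v then 0 else M k i := by
    intro k i
    by_cases h : M 16 v < n <;>
      simp [takeObject, St.run, Mem.set_apply, hu, hv, h]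
  refine ⟨fun k hk => ?_, fun j => ?_, fun j => ?_, fun i hi => ?_⟩
  · funext i
    simp only [List.mem_cons, not_or] at hk
    simp [hrun, hk]
  · simp [hrun]
  · simp [hrun]
  · rw [hrun]
    by_cases h : i = M 16 v
    · simp [← h, hi]
    · simp [h]

theorem run_auctionRound {n x w r₁ r₂ r : ℕ} {M M₀ : Mem} {X : ℕ → Prop}
    (hM : AgreeOff [15, 16, 17, 18] M M₀)
    (h : AuctionRound n (fun i j => M₀ 0 (j * n + i) ≠ 0) X (M 15) (M 16) (M 17) r) :
    AgreeOff [15, 16, 17, 18] (auctionRound.run [n, x, w, r₁, r₂] M) M₀ ∧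
      AuctionRound n (fun i j => M₀ 0 (j * n + i) ≠ 0) X
        (auctionRound.run [n, x, w, r₁, r₂] M 15) (auctionRound.run [n, x, w, r₁, r₂] M 16)
        (auctionRound.run [n, x, w, r₁, r₂] M 17) (r + 1) := by
  obtain ⟨u, h1, hu⟩ := run_selectBidder (n := n) (x := x) (w := w) (r := r₁) (r' := r₂) M
  have hun : u ≤ n := by rcases hu with ⟨rfl, _⟩ | ⟨hu, _⟩ <;> omega
  obtain ⟨v, h2, hv⟩ := run_selectObject (n := n) (x := x) (w := w) (r := r₁) (r' := r₂)
    (M.set 18 0 u) (Mem.set_same _ _ _ _) hun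
  set N := (M.set 18 0 u).set 18 1 v with hN
  have hNM : AgreeOff [18] N M := ((AgreeOff.refl _ M).set (by simp) _ _).set (by simp) _ _
  have hNM₀ : AgreeOff [15, 16, 17, 18] N M₀ := (hNM.mono (by simp)).trans hM
  have e0 : M 0 = M₀ 0 := hM 0 (by simp)
  simp only [Mem.set_ne_arr _ _ _ (show 0 ≠ 18 by decide),
    Mem.set_ne_arr _ _ _ (show 15 ≠ 18 by decide), e0] at hv
  have hrun : auctionRound.run [n, x, w, r₁, r₂] M =
      if u < n ∧ v < n then takeObject.run [n, x, w, r₁, r₂] N else N := by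
    have hN0 : N 18 0 = u := by simp [hN, Mem.set_apply]
    have hN1 : N 18 1 = v := by simp [hN, Mem.set_apply]
    rw [auctionRound, St.run, h1, St.run, h2]
    by_cases h : u < n ∧ v < n
    · simp [St.run, hN0, hN1, h]
    · rw [if_neg h]
      simp only [St.run, eval_andE, eval_ltE, eval_get, eval_lit, eval_var, hN0, hN1]
      rw [if_neg]
      simpa using h
  rw [hrun]
  split_ifs with hif
  · obtain ⟨hun, hvn⟩ := hif
    have hau : M 17 u = 0 := by
      rcases hu with ⟨rfl, _⟩ | ⟨_, hu⟩
      · omega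
      · exact hu
    obtain ⟨huv, hmin⟩ : M₀ 0 (v * n + u) ≠ 0 ∧ _ := by
      rcases hv with ⟨rfl, _⟩ | ⟨_, hv⟩
      · omega
      · exact hv
    obtain ⟨t1, t2, t3, t4⟩ := run_takeObject (n := n) (x := x) (w := w) (r := r₁) (r' := r₂)
      (u := u) (v := v) N (by simp [hN, Mem.set_apply]) (by simp [hN, Mem.set_apply])
    rw [hNM 15 (by simp)] at t2
    rw [hNM 16 (by simp)] at t3 t4
    rw [hNM 17 (by simp)] at t4
    exact ⟨t1.trans hNM₀, h.bid hun hau hvn huv hmin (fun j _ => t2 j) (fun j _ => t3 j) t4⟩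
  · refine ⟨hNM₀, ?_⟩
    rw [hNM 15 (by simp), hNM 16 (by simp), hNM 17 (by simp)]
    refine h.idle fun hm => ?_
    rcases hu with ⟨rfl, hu⟩ | ⟨hun, hu⟩
    · exact hu
    · rcases hv with ⟨_, hv⟩ | ⟨hvn, _⟩
      · obtain ⟨g, hg, _⟩ := hm
        obtain ⟨hg1, hg2⟩ := hg u hun fun hX => h.auction.exempt u hun hX hu
        exact absurd (hv _ hg1) hg2
      · exact absurd ⟨hun, hvn⟩ hif

/-- The start of the auction for the variables `1` and `2`, with values `x` and `w`: the bidders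
are the vertices outside `T \ {x} ∪ {w}`. -/
def auctionStart : St :=
  .seq (.loop (.put 15 (var 3) (lit 0))) (.seq (.loop (.put 16 (var 3) (var 0)))
    (.loop (.put 17 (var 3) (orE (eqE (var 3) (var 2))
      (andE (get 2 (var 3)) (notE (eqE (var 3) (var 1))))))))

/-- Array 13 receives, at the entry `(x, w)`, whether the set `T \ {x} ∪ {w}` fails to be the set of
unmatched vertices of a matching. After `n ^ 2` rounds of the auction, this is decided by the
existence of an unassigned bidder. -/
def matchingTest : St :=
  .seq auctionStart (.seq (.loop (.loop auctionRound))
    (.putAny 13 (idx2 (var 1) (var 2)) (notE (get 17 (var 3)))))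

theorem run_auctionStart {n x w : ℕ} (M : Mem) :
    AgreeOff [15, 16, 17, 18] (auctionStart.run [n, x, w] M) M ∧
      (∀ v < n, auctionStart.run [n, x, w] M 15 v = 0) ∧
      (∀ v < n, auctionStart.run [n, x, w] M 16 v = n) ∧
      ∀ u < n, (auctionStart.run [n, x, w] M 17 u ≠ 0 ↔ u = w ∨ (M 2 u ≠ 0 ∧ u ≠ x)) := by
  obtain ⟨h1, h2⟩ := table1 (ρ := [n, x, w]) (n := n) rfl (W := [15]) (k := 15) (M := M)
    (b := .put 15 (var 3) (lit 0)) fun i _ => .put (by decide) (fun _ => rfl) (by decide)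
  set M₁ := (St.loop (.put 15 (var 3) (lit 0))).run [n, x, w] M
  obtain ⟨h3, h4⟩ := table1 (ρ := [n, x, w]) (n := n) rfl (W := [16]) (k := 16) (M := M₁)
    (b := .put 16 (var 3) (var 0)) fun i _ => .put (by decide) (fun _ => rfl) (by decide)
  set M₂ := (St.loop (.put 16 (var 3) (var 0))).run [n, x, w] M₁
  obtain ⟨h5, h6⟩ := table1 (ρ := [n, x, w]) (n := n) rfl (W := [17]) (k := 17) (M := M₂)
    (b := .put 17 (var 3) (orE (eqE (var 3) (var 2))
      (andE (get 2 (var 3)) (notE (eqE (var 3) (var 1))))))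
    fun i _ => .put (by decide) (fun _ => rfl) (by decide)
  refine ⟨(h5.mono (by simp)).trans ((h3.mono (by simp)).trans (h1.mono (by simp))),
    fun v hv => ?_, fun v hv => ?_, fun u hu => ?_⟩
  · rw [auctionStart, St.run, St.run, h5 15 (by simp), h3 15 (by simp), h2 v hv, eval_lit]
  · rw [auctionStart, St.run, St.run, h5 16 (by simp), h4 v hv]
    simp
  · rw [auctionStart, St.run, St.run, h6 u hu]
    simp [h3 2 (by simp), h1 2 (by simp), or_iff_not_imp_left]

open Classical in
theorem writesCell_matchingTest {n x w : ℕ} (M₀ : Mem) :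
    WritesCell (matchingTest.run [n, x, w]) [13, 15, 16, 17, 18] 13 M₀ (x * n + w)
      (if MatchableBelow n (fun i j => M₀ 0 (j * n + i) ≠ 0)
        (fun u => u = w ∨ (M₀ 2 u ≠ 0 ∧ u ≠ x)) then 0 else 1) := by
  intro M hM
  obtain ⟨h1, h2, h3, h4⟩ := run_auctionStart (n := n) (x := x) (w := w) M
  set M₁ := auctionStart.run [n, x, w] M
  have key : AgreeOff [15, 16, 17, 18] ((St.loop (.loop auctionRound)).run [n, x, w] M₁) M ∧
      AuctionRound n (fun i j => M 0 (j * n + i) ≠ 0) (fun u => u = w ∨ (M 2 u ≠ 0 ∧ u ≠ x))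
        ((St.loop (.loop auctionRound)).run [n, x, w] M₁ 15)
        ((St.loop (.loop auctionRound)).run [n, x, w] M₁ 16)
        ((St.loop (.loop auctionRound)).run [n, x, w] M₁ 17) (n * n) := by
    rw [run_loop rfl]
    refine iter_invariant (fun k N => AgreeOff [15, 16, 17, 18] N M ∧
      AuctionRound n (fun i j => M 0 (j * n + i) ≠ 0) (fun u => u = w ∨ (M 2 u ≠ 0 ∧ u ≠ x))
        (N 15) (N 16) (N 17) (k * n)) ⟨h1, by rw [zero_mul]; exact .start _ h4 h2 h3⟩ ?_
    rintro k hk N ⟨g1, g2⟩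
    rw [run_loop rfl, Nat.succ_mul]
    refine iter_invariant (fun l N => AgreeOff [15, 16, 17, 18] N M ∧
      AuctionRound n (fun i j => M 0 (j * n + i) ≠ 0) (fun u => u = w ∨ (M 2 u ≠ 0 ∧ u ≠ x))
        (N 15) (N 16) (N 17) (k * n + l)) ⟨g1, g2⟩ ?_
    rintro l hl N ⟨g1, g2⟩
    exact run_auctionRound g1 g2
  set M₂ := (St.loop (.loop auctionRound)).run [n, x, w] M₁
  obtain ⟨h5, h6⟩ := WritesCell.putAny (ρ := [n, x, w]) (n := n) rfl (W := [13]) (k := 13)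
    (M₀ := M₂) (a := idx2 (var 1) (var 2)) (c := notE (get 17 (var 3))) (A := x * n + w)
    (by decide) (fun _ => rfl) (fun _ _ => rfl) (by decide) M₂ (.refl _ _)
  refine ⟨(h5.mono (by simp)).trans ((key.1.mono (by simp)).trans hM), ?_⟩
  rw [matchingTest, St.run, St.run, h6, key.1 13 (by simp)]
  congr 1
  have h7 := key.2.matchableBelow_iff
  rw [hM 0 (by simp), hM 2 (by simp)] at h7
  simp only [h7]
  by_cases hall : ∀ u < n, M₂ 17 u ≠ 0
  · rw [if_pos hall, if_neg]
    rintro ⟨u, hu, hu'⟩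
    exact absurd hu' (by simpa using hall u hu)
  · rw [if_neg hall, if_pos]
    push Not at hall
    obtain ⟨u, hu, hu'⟩ := hall
    exact ⟨u, hu, by simp [hu']⟩

/-! ### The program that constructs the set covering instance -/

section Backups

variable {n : ℕ} {P : Pattern n} {F T : Finset (Fin n)}

/-- The back-ups with index `(a, b)` in terms of tests on vertices and on pairs of vertices. The two
middle cases of a tip `x` cover the two orders in which `a` and `b` may be the tip-alternative and
the member of the component of `x`. -/
theorem zset_mem_backups_iff (hTF : T ⊆ F) (hT : IsTipSet P T) (a b x : Fin n) :
    zset (a, b) ∈ backups P F T x ↔ if x ∈ T then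
      (a = b ∧ (a ≠ x ∧ a ∉ T ∧ Matchable P (insert a (T.erase x))) ∧
        Covers P (insert a (F.erase x))) ∨
      ((a ≠ x ∧ a ∉ T ∧ Matchable P (insert a (T.erase x))) ∧
        ¬ Covers P (insert a (F.erase x)) ∧ b ≠ x ∧ SameSCC P x b) ∨
      ((b ≠ x ∧ b ∉ T ∧ Matchable P (insert b (T.erase x))) ∧
        ¬ Covers P (insert b (F.erase x)) ∧ a ≠ x ∧ SameSCC P x a)
    else a = b ∧ InSinkSCC P x ∧ a ≠ x ∧ SameSCC P x a := by
  have hpair : ∀ w y : Fin n, zset (a, b) = {w, y} ↔ (a = w ∧ b = y) ∨ (a = y ∧ b = w) := by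
    intro w y
    constructor
    · intro h
      have h1 : ∀ i, (i = a ∨ i = b) ↔ (i = w ∨ i = y) := fun i => by
        rw [← mem_zset (j := (a, b)), h]; simp
      have ha := (h1 a).mp (.inl rfl)
      have hb := (h1 b).mp (.inr rfl)
      have hw := (h1 w).mpr (.inl rfl)
      have hy := (h1 y).mpr (.inr rfl)
      grind
    · rintro (⟨rfl, rfl⟩ | ⟨rfl, rfl⟩)
      · rfl
      · exact Finset.pair_comm _ _
  have hsing : ∀ w : Fin n, zset (a, b) = {w} ↔ a = w ∧ b = w := by
    intro w
    rw [← Finset.pair_eq_singleton, hpair]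
    tauto
  split_ifs with hx
  · have hfeas : ∀ w, Matchable P (insert w (T.erase x)) →
        (IsFeasible P (interchanged F T x w) ↔ Covers P (insert w (F.erase x))) := by
      intro w hm
      rw [interchanged_eq hTF hx, isFeasible_iff, and_iff_right]
      exact hm.mono (Finset.insert_subset_insert _ (Finset.erase_subset_erase _ hTF))
    rw [mem_backups_tip hx]
    constructor
    · rintro ⟨w, hwx, hw, h⟩
      obtain ⟨hwT, hm⟩ := (isTipSet_insert_erase_iff hT hx hwx).mp hw
      rw [hfeas w hm, hsing] at h
      rcases h with ⟨h, rfl, rfl⟩ | ⟨h, y, hy, hxy, hz⟩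
      · exact .inl ⟨rfl, ⟨hwx, hwT, hm⟩, h⟩
      · rcases (hpair w y).mp hz with ⟨rfl, rfl⟩ | ⟨rfl, rfl⟩
        · exact .inr (.inl ⟨⟨hwx, hwT, hm⟩, h, hy, hxy⟩)
        · exact .inr (.inr ⟨⟨hwx, hwT, hm⟩, h, hy, hxy⟩)
    · rintro (⟨rfl, ⟨hax, haT, hm⟩, h⟩ | ⟨⟨hax, haT, hm⟩, h, hb⟩ | ⟨⟨hbx, hbT, hm⟩, h, ha⟩)
      · exact ⟨a, hax, (isTipSet_insert_erase_iff hT hx hax).mpr ⟨haT, hm⟩,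
          .inl ⟨(hfeas a hm).mpr h, (hsing a).mpr ⟨rfl, rfl⟩⟩⟩
      · exact ⟨a, hax, (isTipSet_insert_erase_iff hT hx hax).mpr ⟨haT, hm⟩,
          .inr ⟨fun h' => h ((hfeas a hm).mp h'), b, hb.1, hb.2, rfl⟩⟩
      · exact ⟨b, hbx, (isTipSet_insert_erase_iff hT hx hbx).mpr ⟨hbT, hm⟩,
          .inr ⟨fun h' => h ((hfeas b hm).mp h'), a, ha.1, ha.2, (hpair _ _).mpr (.inr ⟨rfl, rfl⟩)⟩⟩
  · rw [mem_backups_sink hx]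
    constructor
    · rintro ⟨w, hwx, hs, hxw, h⟩
      obtain ⟨rfl, rfl⟩ := (hsing w).mp h
      exact ⟨rfl, hs, hwx, hxw⟩
    · rintro ⟨rfl, hs, hax, hxa⟩
      exact ⟨a, hax, hs, hxa, (hsing a).mpr ⟨rfl, rfl⟩⟩

theorem inSinkSCC_iff {x : Fin n} : InSinkSCC P x ↔ ∀ w, Reach P x w → Reach P w x := by
  constructor
  · intro h w hw
    have : SameSCC P x w := by
      induction hw with
      | refl => exact ⟨.refl, .refl⟩
      | tail _ he ih => exact h _ _ ih he
    exact this.2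
  · intro h u w hu he
    have hxw : Reach P x w := hu.1.tail he
    exact ⟨hxw, h w hxw⟩

end Backups

/-- Array 12 receives, at `x`, whether the component of `x` fails to be a sink. -/
def sinkTests : St :=
  .loop (.putAny 12 (var 1) (andE (get 10 (idx2 (var 1) (var 2)))
    (notE (get 10 (idx2 (var 2) (var 1))))))

/-- Array 20 receives, at `(x, w, v)`, whether `v` reaches `F \ {x} ∪ {w}`. -/
def coverTests : St :=
  .loop (.loop (.loop (.putAny 20 (idx3 (var 1) (var 2) (var 3))
    (andE (get 10 (idx2 (var 3) (var 4))) (orE (eqE (var 4) (var 2))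
      (andE (get 1 (var 4)) (notE (eqE (var 4) (var 1)))))))))

/-- Array 14 receives, at `(x, w)`, whether some vertex does not reach `F \ {x} ∪ {w}`. -/
def feasibilityTests : St :=
  .loop (.loop (.putAny 14 (idx2 (var 1) (var 2))
    (notE (get 20 (idx3 (var 1) (var 2) (var 3))))))

/-- All the tests on which the back-ups depend. -/
def tests : St :=
  .seq reachability (.seq sinkTests (.seq (.loop (.loop matchingTest))
    (.seq coverTests feasibilityTests)))

/-- The memory holds the results of the tests. -/
structure HoldsTests {n : ℕ} (P : Pattern n) (F T : Finset (Fin n)) (M : Mem) : Prop where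
  solution : ∀ x : Fin n, M 1 x = if x ∈ F then 1 else 0
  tips : ∀ x : Fin n, M 2 x = if x ∈ T then 1 else 0
  reach : ∀ x y : Fin n, M 10 ((x : ℕ) * n + y) ≠ 0 ↔ Reach P x y
  sink : ∀ x : Fin n, M 12 x = 0 ↔ InSinkSCC P x
  matching : ∀ x w : Fin n,
    M 13 ((x : ℕ) * n + w) = 0 ↔ Matchable P (insert w (T.erase x))
  cover : ∀ x w : Fin n, M 14 ((x : ℕ) * n + w) = 0 ↔ Covers P (insert w (F.erase x))

theorem holdsTests_run {n : ℕ} {P : Pattern n} {F T : Finset (Fin n)} {M : Mem}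
    (hP : ∀ i j : Fin n, M 0 ((i : ℕ) * n + j) = if P i j = true then 1 else 0)
    (hF : ∀ i : Fin n, M 1 i = if i ∈ F then 1 else 0)
    (hT : ∀ i : Fin n, M 2 i = if i ∈ T then 1 else 0) : HoldsTests P F T (tests.run [n] M) := by
  classical
  obtain ⟨a1, a2⟩ := run_reachability hP
  set M₁ := reachability.run [n] M
  obtain ⟨b1, b2⟩ := table1 (ρ := [n]) (n := n) rfl (W := [12]) (k := 12) (M := M₁)
    (b := .putAny 12 (var 1) (andE (get 10 (idx2 (var 1) (var 2)))
      (notE (get 10 (idx2 (var 2) (var 1))))))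
    fun i _ => .putAny (n := n) rfl (by decide) (fun _ => rfl) (fun _ _ => rfl) (by decide)
  change AgreeOff [12] (sinkTests.run [n] M₁) M₁ at b1
  change ∀ i < n, sinkTests.run [n] M₁ 12 i = _ at b2
  set M₂ := sinkTests.run [n] M₁
  obtain ⟨c1, c2⟩ := table2 (ρ := [n]) (n := n) rfl (M := M₂) (b := matchingTest)
    fun i _ j _ => writesCell_matchingTest M₂
  set M₃ := (St.loop (.loop matchingTest)).run [n] M₂
  obtain ⟨d1, d2⟩ := table3 (ρ := [n]) (n := n) rfl (W := [20]) (k := 20) (M := M₃)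
    (b := .putAny 20 (idx3 (var 1) (var 2) (var 3))
      (andE (get 10 (idx2 (var 3) (var 4))) (orE (eqE (var 4) (var 2))
      (andE (get 1 (var 4)) (notE (eqE (var 4) (var 1)))))))
    fun i _ j _ l _ => .putAny (n := n) rfl (by decide) (fun _ => rfl) (fun _ _ => rfl) (by decide)
  change AgreeOff [20] (coverTests.run [n] M₃) M₃ at d1
  change ∀ i < n, ∀ j < n, ∀ l < n, coverTests.run [n] M₃ 20 ((i * n + j) * n + l) = _ at d2
  set M₄ := coverTests.run [n] M₃
  obtain ⟨e1, e2⟩ := table2 (ρ := [n]) (n := n) rfl (W := [14]) (k := 14) (M := M₄)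
    (b := .putAny 14 (idx2 (var 1) (var 2)) (notE (get 20 (idx3 (var 1) (var 2) (var 3)))))
    fun i _ j _ => .putAny (n := n) rfl (by decide) (fun _ => rfl) (fun _ _ => rfl) (by decide)
  change AgreeOff [14] (feasibilityTests.run [n] M₄) M₄ at e1
  change ∀ i < n, ∀ j < n, feasibilityTests.run [n] M₄ 14 (i * n + j) = _ at e2
  have hrun : tests.run [n] M = feasibilityTests.run [n] M₄ := rfl
  rw [hrun]
  set M₅ := feasibilityTests.run [n] M₄
  have hM₂ : AgreeOff [10, 11, 12] M₂ M := (b1.mono (by simp)).trans (a1.mono (by simp))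
  have hM₃ : AgreeOff [10, 11, 12, 13, 15, 16, 17, 18] M₃ M :=
    (c1.mono (by simp)).trans (hM₂.mono (by simp))
  have r2 : M₂ 10 = M₁ 10 := b1 10 (by simp)
  have r3 : M₃ 10 = M₁ 10 := (c1 10 (by simp)).trans r2
  have r5 : M₅ 10 = M₁ 10 := ((e1 10 (by simp)).trans (d1 10 (by simp))).trans r3
  have hreach : ∀ x y : Fin n, M₁ 10 ((x : ℕ) * n + y) = 0 ↔ ¬ Reach P x y := fun x y => by
    rw [← a2 x y, not_not]
  refine ⟨fun x => ?_, fun x => ?_, fun x y => ?_, fun x => ?_, fun x w => ?_, fun x w => ?_⟩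
  · rw [e1 1 (by simp), d1 1 (by simp), hM₃ 1 (by simp), hF]
  · rw [e1 2 (by simp), d1 2 (by simp), hM₃ 2 (by simp), hT]
  · rw [r5, a2]
  · rw [e1 12 (by simp), d1 12 (by simp), c1 12 (by simp), b2 x x.2, inSinkSCC_iff]
    constructor
    · intro h w hxw
      by_contra hwx
      rw [if_pos] at h
      · exact one_ne_zero h
      · exact ⟨w, w.2, by simp [hreach, hxw, hwx]⟩
    · intro h
      rw [if_neg]
      rintro ⟨w, hw, hxw⟩
      have h1 := hreach x ⟨w, hw⟩
      have h2 := hreach ⟨w, hw⟩ x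
      simp only at h1 h2
      simp [h1, h2] at hxw
      exact hxw.2 (h _ hxw.1)
  · rw [e1 13 (by simp), d1 13 (by simp), c2 x x.2 w w.2, hM₂ 0 (by simp), hM₂ 2 (by simp),
      ← matchable_iff_matchableBelow (P := P) (S := insert w (T.erase x))]
    · simp
    · intro i j
      simp [hP, Edge]
    · intro i
      simp [hT, Fin.ext_iff, and_comm]
  · have hc : ∀ v : Fin n, M₄ 20 (((x : ℕ) * n + w) * n + v) ≠ 0 ↔
        ∃ s ∈ insert w (F.erase x), Reach P v s := by
      intro v
      rw [d2 x x.2 w w.2 v v.2]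
      constructor
      · intro h
        by_contra hcon
        refine h (if_neg ?_)
        rintro ⟨s, hs, hvs⟩
        have h1 := hreach v ⟨s, hs⟩
        have h2 := hF ⟨s, hs⟩
        simp only at h1 h2
        simp [r3, h1, hM₃ 1 (by simp), h2] at hvs
        refine hcon ⟨⟨s, hs⟩, ?_, hvs.1⟩
        simp [Fin.ext_iff]
        tauto
      · rintro ⟨s, hs, hvs⟩
        rw [if_pos]
        · exact one_ne_zero
        · refine ⟨s, s.2, ?_⟩
          simp only [Finset.mem_insert, Finset.mem_erase, ne_eq, Fin.ext_iff] at hs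
          simp [r3, hreach, hvs, hM₃ 1 (by simp), hF]
          tauto
    rw [e2 x x.2 w w.2]
    constructor
    · intro h v
      by_contra hv
      rw [if_pos] at h
      · exact one_ne_zero h
      · refine ⟨v, v.2, ?_⟩
        have := (not_congr (hc v)).mpr hv
        simpa using this
    · intro h
      rw [if_neg]
      rintro ⟨v, hv, hv'⟩
      have := (hc ⟨v, hv⟩).mpr (h _)
      simp at hv'
      exact this hv'

/-- The test whether `w` is a tip-alternative to the tip in variable `3`. -/
def tipE (w : Ex) : Ex :=
  andE (notE (eqE w (var 3))) (andE (notE (get 2 w)) (notE (get 13 (idx2 (var 3) w))))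

/-- The test whether `y` is another vertex in the component of the vertex in variable `3`. -/
def componentE (y : Ex) : Ex :=
  andE (notE (eqE y (var 3))) (andE (get 10 (idx2 (var 3) y)) (get 10 (idx2 y (var 3))))

/-- The test whether the set with the index in variables `1` and `2` is a back-up to the vertex in
variable `3`. -/
def backupE : Ex :=
  andE (get 1 (var 3)) (ite (get 2 (var 3))
    (orE (andE (eqE (var 1) (var 2))
        (andE (tipE (var 1)) (notE (get 14 (idx2 (var 3) (var 1))))))
      (orE (andE (tipE (var 1)) (andE (get 14 (idx2 (var 3) (var 1))) (componentE (var 2))))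
        (andE (tipE (var 2)) (andE (get 14 (idx2 (var 3) (var 2))) (componentE (var 1))))))
    (andE (eqE (var 1) (var 2)) (andE (notE (get 12 (var 3))) (componentE (var 1)))))

/-- The program that constructs the instance from the pattern, the solution and the tips. -/
def buildInstance : St :=
  .seq tests (.seq
    (.loop (.loop (.loop (.put 19 (idx3 (var 1) (var 2) (var 3)) backupE)))) (.seq
    (.loop (.loop (.loop (.put 3 (idx3 (var 1) (var 2) (var 3))
      (orE (get 19 (idx3 (var 1) (var 2) (var 3))) (orE (get 19 (idx3 (var 1) (var 1) (var 3)))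
        (get 19 (idx3 (var 2) (var 2) (var 3)))))))))
    (.loop (.loop (.put 4 (idx2 (var 1) (var 2)) (ite (eqE (var 1) (var 2)) (lit 1) (lit 2)))))))

theorem eval_backupE {n : ℕ} {P : Pattern n} {F T : Finset (Fin n)} {M : Mem} (hTF : T ⊆ F)
    (hT : IsTipSet P T) (h : HoldsTests P F T M) (a b x : Fin n) :
    backupE.eval [n, a, b, x] M ≠ 0 ↔ x ∈ F ∧ zset (a, b) ∈ backups P F T x := by
  have h1 : M 1 x ≠ 0 ↔ x ∈ F := by simp [h.solution]
  have h2 : ∀ y : Fin n, M 2 y ≠ 0 ↔ y ∈ T := by simp [h.tips]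
  have h3 : [n, (a : ℕ), b, x].getD 3 0 = x := rfl
  have h4 : [n, (a : ℕ), b, x].getD 2 0 = b := rfl
  have h5 : [n, (a : ℕ), b, x].getD 1 0 = a := rfl
  have h6 : [n, (a : ℕ), b, x].getD 0 0 = n := rfl
  have h7 : ∀ y w : Fin n, M 14 ((y : ℕ) * n + w) ≠ 0 ↔ ¬ Covers P (insert w (F.erase y)) :=
    fun y w => not_congr (h.cover y w)
  have h8 : ∀ y w : Fin n, M 13 ((y : ℕ) * n + w) ≠ 0 ↔ ¬ Matchable P (insert w (T.erase y)) :=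
    fun y w => not_congr (h.matching y w)
  have h9 : M 12 x ≠ 0 ↔ ¬ InSinkSCC P x := not_congr (h.sink x)
  rw [zset_mem_backups_iff hTF hT]
  simp only [backupE, tipE, componentE, ne_zero_ite, ne_zero_andE, ne_zero_orE, ne_zero_notE,
    ne_zero_eqE, eval_get, eval_var, eval_idx2, h3, h4, h5, h6, h1, h2, h7, h8, h9, h.reach,
    SameSCC, Fin.ext_iff, ne_eq, not_not]

theorem holdsInstance_buildInstance {n : ℕ} {P : Pattern n} {F T : Finset (Fin n)} (hTF : T ⊆ F)
    (hT : IsTipSet P T) {s s' : MachineState} (hs : HoldsInput P F T s) (h0 : s'.reg 0 = n)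
    (h : s'.arr = buildInstance.run [n] s.arr) : HoldsInstance (backupInstance P F T) s' := by
  have ht := holdsTests_run hs.pattern hs.solution hs.tips
  set M := tests.run [n] s.arr with hM
  obtain ⟨a1, a2⟩ := table3 (ρ := [n]) (n := n) rfl (W := [19]) (k := 19) (M := M)
    (b := .put 19 (idx3 (var 1) (var 2) (var 3)) backupE)
    fun i _ j _ l _ => .put (by decide) (fun _ => rfl) (by decide)
  set M₁ := (St.loop (.loop (.loop (.put 19 (idx3 (var 1) (var 2) (var 3)) backupE)))).run [n] M
    with hM₁
  obtain ⟨b1, b2⟩ := table3 (ρ := [n]) (n := n) rfl (W := [3]) (k := 3) (M := M₁)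
    (b := .put 3 (idx3 (var 1) (var 2) (var 3))
      (orE (get 19 (idx3 (var 1) (var 2) (var 3))) (orE (get 19 (idx3 (var 1) (var 1) (var 3)))
        (get 19 (idx3 (var 2) (var 2) (var 3))))))
    fun i _ j _ l _ => .put (by decide) (fun _ => rfl) (by decide)
  set M₂ := (St.loop (.loop (.loop (.put 3 (idx3 (var 1) (var 2) (var 3))
      (orE (get 19 (idx3 (var 1) (var 2) (var 3))) (orE (get 19 (idx3 (var 1) (var 1) (var 3)))
        (get 19 (idx3 (var 2) (var 2) (var 3))))))))).run [n] M₁ with hM₂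
  obtain ⟨c1, c2⟩ := table2 (ρ := [n]) (n := n) rfl (W := [4]) (k := 4) (M := M₂)
    (b := .put 4 (idx2 (var 1) (var 2)) (ite (eqE (var 1) (var 2)) (lit 1) (lit 2)))
    fun i _ j _ => .put (by decide) (fun _ => rfl) (by decide)
  set M₃ := (St.loop (.loop (.put 4 (idx2 (var 1) (var 2))
    (ite (eqE (var 1) (var 2)) (lit 1) (lit 2))))).run [n] M₂ with hM₃
  have hrun : s'.arr = M₃ := h
  have hd : ∀ a b x : Fin n, M₁ 19 (((a : ℕ) * n + b) * n + x) ≠ 0 ↔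
      x ∈ F ∧ zset (a, b) ∈ backups P F T x := by
    intro a b x
    rw [a2 a a.2 b b.2 x x.2]
    exact eval_backupE hTF hT ht a b x
  refine ⟨h0, fun i => ?_, fun j hj x => ?_, fun j hj => ?_⟩
  · rw [hrun, c1 1 (by simp), b1 1 (by simp), a1 1 (by simp), ht.solution]
    rfl
  · rw [hrun, c1 3 (by simp), b2 j.1 j.1.2 j.2 j.2.2 x x.2]
    have hz : ∀ k : Fin n, zset (k, k) = {k} := fun k => by simp [zset]
    have hset : x ∈ (backupInstance P F T).sets j ↔ (x ∈ F ∧ zset (j.1, j.2) ∈ backups P F T x) ∨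
        (x ∈ F ∧ zset (j.1, j.1) ∈ backups P F T x) ∨
        (x ∈ F ∧ zset (j.2, j.2) ∈ backups P F T x) := by
      change x ∈ coverSet P F T j ↔ _
      rw [mem_coverSet, hz, hz]
      simp only [mem_zset, exists_eq_or_imp, exists_eq_left]
      tauto
    rw [eval_orE]
    refine if_congr ?_ rfl rfl
    rw [ne_zero_orE, hset]
    exact or_congr (hd _ _ _) (or_congr (hd _ _ _) (hd _ _ _))
  · rw [hrun, c2 j.1 j.1.2 j.2 j.2.2]
    change _ = (zset j).card
    by_cases hj' : j.1 = j.2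
    · simp [zset, hj']
    · simp [zset, hj', Fin.val_ne_of_ne hj']

/-! ### The greedy program -/

/-- Store in cell `a` of array `k` the number of values of a new variable that satisfy the
test `c`. -/
def St.putCount (k : ℕ) (a c : Ex) : St :=
  .seq (.put k a (.lit 0)) (.loop (.ite c (.put k a (plus (cap (get k a)) (lit 1))) .skip))

theorem WritesCell.putCount {ρ : List ℕ} {n : ℕ} (h0 : ρ.getD 0 0 = n) {W : List ℕ} {k : ℕ}
    {M₀ : Mem} {a c : Ex} {A : ℕ} (hk : k ∈ W) (ha : ∀ M, a.eval ρ M = A)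
    (ha' : ∀ i M, a.eval (ρ ++ [i]) M = A) (hc : ∀ l ∈ c.reads, l ∉ W) :
    WritesCell ((St.putCount k a c).run ρ) W k M₀ A
      ((Finset.range n).filter fun i => c.eval (ρ ++ [i]) M₀ ≠ 0).card := by
  intro M hM
  rw [St.putCount, St.run, St.run, run_loop h0, ha]
  refine iter_invariant (m := n) (fun m M' => AgreeOff W M' M₀ ∧ M' k = Function.update (M k) A
      ((Finset.range m).filter fun i => c.eval (ρ ++ [i]) M₀ ≠ 0).card)
    ⟨hM.set hk _ _, by simp [Mem.set]⟩ ?_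
  rintro i hi M' ⟨h1, h2⟩
  have hci : c.eval (ρ ++ [i]) M' = c.eval (ρ ++ [i]) M₀ := eval_congr fun l hl => h1 l (hc l hl)
  have hle : ((Finset.range i).filter fun i => c.eval (ρ ++ [i]) M₀ ≠ 0).card ≤ n :=
    (Finset.card_filter_le _ _).trans (by simpa using hi.le)
  rw [Finset.range_add_one, Finset.filter_insert]
  by_cases hci0 : c.eval (ρ ++ [i]) M₀ = 0
  · rw [if_neg (by simpa using hci0), St.run, hci, if_neg (by simpa using hci0), St.run]
    exact ⟨h1, h2⟩
  · rw [if_pos hci0, Finset.card_insert_of_notMem (by simp), St.run, hci, if_pos hci0, St.run, ha']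
    refine ⟨h1.set hk _ _, ?_⟩
    rw [Mem.set, Function.update_self, h2, Function.update_idem, eval_plus, eval_cap, eval_get, ha',
      getD_zero_snoc h0 hi, h2, Function.update_self, min_eq_left hle, eval_lit]

/-- Array 10 receives the incidence table of the family, with empty sets at the pairs that are not
indices, the arrays 11 and 15 the indicators of the uncovered and of the pending elements, array 12
the number of uncovered elements of each set, and array 5 the empty subfamily. -/
def greedyStart : St :=
  .seq (.loop (.loop (.loop (.put 10 (idx3 (var 1) (var 2) (var 3)) (ite (ltE (var 2) (var 1))
      (lit 0) (get 3 (idx3 (var 1) (var 2) (var 3))))))))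
    (.seq (.loop (.put 11 (var 1) (get 1 (var 1))))
    (.seq (.loop (.put 15 (var 1) (lit 0)))
    (.seq (.loop (.loop (.put 5 (idx2 (var 1) (var 2)) (lit 0))))
    (.loop (.loop (.putCount 12 (idx2 (var 1) (var 2))
      (andE (get 11 (var 3)) (get 10 (idx3 (var 1) (var 2) (var 3))))))))))

/-- Array 14 receives, in cell 1, a pending element, or `n` if there is none. -/
def selectPending : St :=
  .seq (.put 14 (lit 1) (var 0))
    (.loop (.ite (get 15 (var 2)) (.put 14 (lit 1) (var 2)) .skip))

/-- The pending element in cell 1 of array 14 becomes covered, and the counts of the sets that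
contain it decrease. -/
def coverPending : St :=
  .seq (.put 15 (get 14 (lit 1)) (lit 0)) (.seq (.put 11 (get 14 (lit 1)) (lit 0)) (.seq
    (.loop (.loop (.put 16 (idx2 (var 2) (var 3))
      (ite (get 10 (idx3 (var 2) (var 3) (cap (get 14 (lit 1)))))
        (minus (get 12 (idx2 (var 2) (var 3))) (lit 1)) (get 12 (idx2 (var 2) (var 3)))))))
    (.loop (.loop (.put 12 (idx2 (var 2) (var 3)) (get 16 (idx2 (var 2) (var 3))))))))

/-- Twice the number of uncovered elements per cost, for the set with the index in variables `2`
and `3`, whose cost is one on the diagonal and two elsewhere. -/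
def scoreE : Ex :=
  ite (eqE (var 2) (var 3))
    (plus (cap (get 12 (idx2 (var 2) (var 3)))) (cap (get 12 (idx2 (var 2) (var 3)))))
    (get 12 (idx2 (var 2) (var 3)))

/-- Array 14 receives the largest score, in cell 3, and an index where it is attained, in cells 2
and 4. -/
def selectBest : St :=
  .seq (.put 14 (lit 3) (lit 0))
    (.loop (.loop (.ite (ltE (get 14 (lit 3)) scoreE) (.seq (.put 14 (lit 2) (var 2))
      (.seq (.put 14 (lit 4) (var 3)) (.put 14 (lit 3) scoreE))) .skip)))

/-- The set with the index in cells 2 and 4 of array 14 is selected, and its uncovered elements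
become pending. This is run only when no element is pending, so the old contents of array 15 may be
overwritten. -/
def takeBest : St :=
  .seq (.put 5 (idx2 (cap (get 14 (lit 2))) (cap (get 14 (lit 4)))) (lit 1))
    (.loop (.put 15 (var 2) (andE (get 11 (var 2))
      (get 10 (idx3 (cap (get 14 (lit 2))) (cap (get 14 (lit 4))) (var 2))))))

/-- One step of the greedy algorithm. The elements of a selected set are covered one by one, so that
each step takes quadratic time, and there are at most `2 n` steps in which something happens. -/
def greedyStep : St :=
  .seq selectPending (.ite (ltE (get 14 (lit 1)) (var 0)) coverPending
    (.seq selectBest (.ite (get 14 (lit 3)) takeBest .skip)))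

/-- The greedy algorithm. -/
def greedy : St := .seq greedyStart (.loop (.seq greedyStep greedyStep))

/-- The covering set with index `j`, or the empty set if `j` is not an index. -/
def SetCover.setAt {n : ℕ} (I : SetCover (Fin n × Fin n) (Fin n)) (j : Fin n × Fin n) :
    Finset (Fin n) := if j ∈ I.index then I.sets j else ∅

/-- The memory holds a stage of the greedy algorithm: `U` is the set of uncovered elements, the
elements of `D ⊆ U` are pending, which means that they belong to selected sets, and `J` is the
selected subfamily. -/
structure GreedyState {n : ℕ} (I : SetCover (Fin n × Fin n) (Fin n)) (U D : Finset (Fin n))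
    (J : Finset (Fin n × Fin n)) (M : Mem) : Prop where
  incidence : ∀ a b x : Fin n, M 10 (((a : ℕ) * n + b) * n + x) ≠ 0 ↔ x ∈ I.setAt (a, b)
  uncovered : ∀ x : Fin n, M 11 x ≠ 0 ↔ x ∈ U
  pending : ∀ x : Fin n, M 15 x ≠ 0 ↔ x ∈ D
  count : ∀ a b : Fin n, M 12 ((a : ℕ) * n + b) = (I.setAt (a, b) ∩ U).card
  selected : ∀ a b : Fin n, M 5 ((a : ℕ) * n + b) = if (a, b) ∈ J then 1 else 0
  subset : D ⊆ U
  invariant : I.GreedyInvariant (U \ D) J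

theorem card_filter_range {n : ℕ} {p : ℕ → Prop} [DecidablePred p] {s : Finset (Fin n)}
    (h : ∀ x : Fin n, p x ↔ x ∈ s) : ((Finset.range n).filter p).card = s.card := by
  rw [← Finset.card_map Fin.valEmbedding]
  congr 1
  ext i
  simp only [Finset.mem_filter, Finset.mem_range, Finset.mem_map, Fin.valEmbedding_apply]
  constructor
  · rintro ⟨hi, hp⟩
    exact ⟨⟨i, hi⟩, (h ⟨i, hi⟩).mp hp, rfl⟩
  · rintro ⟨x, hx, rfl⟩
    exact ⟨x.2, (h x).mpr hx⟩

theorem greedyState_start {n : ℕ} {I : SetCover (Fin n × Fin n) (Fin n)} {s : MachineState}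
    (hI : ∀ j : Fin n × Fin n, j ∈ I.index ↔ j.1 ≤ j.2) (hs : HoldsInstance I s) :
    GreedyState I I.universal ∅ ∅ (greedyStart.run [n] s.arr) := by
  set M := s.arr
  obtain ⟨a1, a2⟩ := table3 (ρ := [n]) (n := n) rfl (W := [10]) (k := 10) (M := M)
    (b := .put 10 (idx3 (var 1) (var 2) (var 3)) (ite (ltE (var 2) (var 1))
      (lit 0) (get 3 (idx3 (var 1) (var 2) (var 3)))))
    fun i _ j _ l _ => .put (by decide) (fun _ => rfl) (by decide)
  set M₁ := (St.loop (.loop (.loop (.put 10 (idx3 (var 1) (var 2) (var 3))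
    (ite (ltE (var 2) (var 1)) (lit 0) (get 3 (idx3 (var 1) (var 2) (var 3)))))))).run [n] M
  obtain ⟨b1, b2⟩ := table1 (ρ := [n]) (n := n) rfl (W := [11]) (k := 11) (M := M₁)
    (b := .put 11 (var 1) (get 1 (var 1))) fun i _ => .put (by decide) (fun _ => rfl) (by decide)
  set M₂ := (St.loop (.put 11 (var 1) (get 1 (var 1)))).run [n] M₁
  obtain ⟨c1, c2⟩ := table1 (ρ := [n]) (n := n) rfl (W := [15]) (k := 15) (M := M₂)
    (b := .put 15 (var 1) (lit 0)) fun i _ => .put (by decide) (fun _ => rfl) (by decide)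
  set M₃ := (St.loop (.put 15 (var 1) (lit 0))).run [n] M₂
  obtain ⟨d1, d2⟩ := table2 (ρ := [n]) (n := n) rfl (W := [5]) (k := 5) (M := M₃)
    (b := .put 5 (idx2 (var 1) (var 2)) (lit 0))
    fun i _ j _ => .put (by decide) (fun _ => rfl) (by decide)
  set M₄ := (St.loop (.loop (.put 5 (idx2 (var 1) (var 2)) (lit 0)))).run [n] M₃
  obtain ⟨e1, e2⟩ := table2 (ρ := [n]) (n := n) rfl (W := [12]) (k := 12) (M := M₄)
    (b := .putCount 12 (idx2 (var 1) (var 2))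
      (andE (get 11 (var 3)) (get 10 (idx3 (var 1) (var 2) (var 3)))))
    fun i _ j _ => .putCount (n := n) rfl (by decide) (fun _ => rfl) (fun _ _ => rfl) (by decide)
  set M₅ := (St.loop (.loop (.putCount 12 (idx2 (var 1) (var 2))
    (andE (get 11 (var 3)) (get 10 (idx3 (var 1) (var 2) (var 3))))))).run [n] M₄
  have hrun : greedyStart.run [n] M = M₅ := rfl
  rw [hrun]
  have f10 : M₄ 10 = M₁ 10 := ((d1 10 (by simp)).trans (c1 10 (by simp))).trans (b1 10 (by simp))
  have f11 : M₄ 11 = M₂ 11 := (d1 11 (by simp)).trans (c1 11 (by simp))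
  have hinc : ∀ a b x : Fin n, M₁ 10 (((a : ℕ) * n + b) * n + x) ≠ 0 ↔ x ∈ I.setAt (a, b) := by
    intro a b x
    rw [a2 a a.2 b b.2 x x.2, ne_zero_ite, SetCover.setAt]
    simp only [ne_zero_ltE]
    change (if (b : ℕ) < a then (0 : ℕ) ≠ 0 else M 3 (((a : ℕ) * n + b) * n + x) ≠ 0) ↔ _
    by_cases hab : (b : ℕ) < a
    · have : (a, b) ∉ I.index := fun h => absurd ((hI _).mp h) (not_le.mpr hab)
      simp [hab, this]
    · have : (a, b) ∈ I.index := (hI _).mpr (not_lt.mp hab)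
      rw [if_neg hab, if_pos this]
      have := hs.sets (a, b) this x
      simp only at this
      simp [M, this]
  have hunc : ∀ x : Fin n, M₂ 11 x ≠ 0 ↔ x ∈ I.universal := by
    intro x
    rw [b2 x x.2]
    change M₁ 1 x ≠ 0 ↔ _
    rw [a1 1 (by simp)]
    simp [M, hs.universal]
  refine ⟨fun a b x => ?_, fun x => ?_, fun x => ?_, fun a b => ?_, fun a b => ?_, by simp,
    by simpa using SetCover.GreedyInvariant.start I⟩
  · rw [e1 10 (by simp), f10, hinc]
  · rw [e1 11 (by simp), f11, hunc]
  · rw [e1 15 (by simp), d1 15 (by simp), c2 x x.2]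
    simp
  · rw [e2 a a.2 b b.2]
    refine card_filter_range fun x => ?_
    rw [ne_zero_andE, Finset.mem_inter, and_comm]
    refine and_congr ?_ ?_
    · change M₄ 10 (((a : ℕ) * n + b) * n + x) ≠ 0 ↔ _
      rw [f10, hinc]
    · change M₄ 11 x ≠ 0 ↔ _
      rw [f11, hunc]
  · rw [e1 5 (by simp), d2 a a.2 b b.2]
    simp

theorem run_selectPending {n r : ℕ} (M : Mem) :
    ∃ x, selectPending.run [n, r] M = M.set 14 1 x ∧
      ((x = n ∧ ∀ i < n, M 15 i = 0) ∨ (x < n ∧ M 15 x ≠ 0)) := by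
  rw [selectPending, St.run, run_loop rfl]
  refine iter_invariant (fun k N => ∃ x, N = M.set 14 1 x ∧
    ((x = n ∧ ∀ i < k, M 15 i = 0) ∨ (x < n ∧ M 15 x ≠ 0))) ⟨n, rfl, .inl ⟨rfl, by simp⟩⟩ ?_
  rintro k hk N ⟨x, rfl, hx⟩
  by_cases h : M 15 k = 0
  · refine ⟨x, by simp [St.run, Mem.set_apply, h], ?_⟩
    rcases hx with ⟨rfl, hx⟩ | hx
    · refine .inl ⟨rfl, fun i hi => ?_⟩
      rcases Nat.lt_succ_iff_lt_or_eq.mp hi with hi | rfl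
      · exact hx i hi
      · exact h
    · exact .inr hx
  · exact ⟨k, by simp [St.run, Mem.set_apply, h, Mem.set_set], .inr ⟨hk, h⟩⟩

theorem run_selectBest {n r : ℕ} (M : Mem) :
    AgreeOff [14] (selectBest.run [n, r] M) M ∧
      (selectBest.run [n, r] M 14 3 ≠ 0 → selectBest.run [n, r] M 14 2 < n ∧
        selectBest.run [n, r] M 14 4 < n ∧ selectBest.run [n, r] M 14 3 = scoreE.eval
          [n, r, selectBest.run [n, r] M 14 2, selectBest.run [n, r] M 14 4] M) ∧
      ∀ i < n, ∀ j < n, scoreE.eval [n, r, i, j] M ≤ selectBest.run [n, r] M 14 3 := by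
  rw [selectBest, St.run, run_loop rfl]
  refine iter_invariant (m := n) (fun k N => AgreeOff [14] N M ∧
    (N 14 3 ≠ 0 → N 14 2 < n ∧ N 14 4 < n ∧ N 14 3 = scoreE.eval [n, r, N 14 2, N 14 4] M) ∧
    ∀ i < k, ∀ j < n, scoreE.eval [n, r, i, j] M ≤ N 14 3) ?_ ?_
  · exact ⟨(AgreeOff.refl _ _).set (by simp) _ _, by simp [St.run, Mem.set_apply], by simp⟩
  rintro k hk N ⟨h1, h2, h3⟩
  rw [run_loop rfl]
  have key := iter_invariant (m := n)
    (f := fun j N => (St.ite (ltE (get 14 (lit 3)) scoreE) (.seq (.put 14 (lit 2) (var 2))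
      (.seq (.put 14 (lit 4) (var 3)) (.put 14 (lit 3) scoreE))) .skip).run
        ([n, r] ++ [k] ++ [j]) N) (M := N) (fun l N => AgreeOff [14] N M ∧
    (N 14 3 ≠ 0 → N 14 2 < n ∧ N 14 4 < n ∧ N 14 3 = scoreE.eval [n, r, N 14 2, N 14 4] M) ∧
    (∀ i < k, ∀ j < n, scoreE.eval [n, r, i, j] M ≤ N 14 3) ∧
    ∀ j < l, scoreE.eval [n, r, k, j] M ≤ N 14 3) ⟨h1, h2, h3, by simp⟩ (by
      rintro l hl N ⟨h1, h2, h3, h4⟩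
      have hsc : ∀ N', AgreeOff [14] N' M →
          scoreE.eval ([n, r] ++ [k] ++ [l]) N' = scoreE.eval [n, r, k, l] M :=
        fun N' hN' => eval_congr fun a ha => hN' a (by revert a; decide)
      by_cases hlt : N 14 3 < scoreE.eval [n, r, k, l] M
      · have hrun : (St.ite (ltE (get 14 (lit 3)) scoreE) (.seq (.put 14 (lit 2) (var 2))
            (.seq (.put 14 (lit 4) (var 3)) (.put 14 (lit 3) scoreE))) .skip).run
            ([n, r] ++ [k] ++ [l]) N =
            ((N.set 14 2 k).set 14 4 l).set 14 3 (scoreE.eval [n, r, k, l] M) := by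
          have h5 : AgreeOff [14] ((N.set 14 2 k).set 14 4 l) M :=
            (h1.set (by simp) _ _).set (by simp) _ _
          rw [St.run, if_pos (by rw [ne_zero_ltE, hsc N h1]; exact hlt), ← hsc _ h5]
          rfl
        rw [hrun]
        refine ⟨((h1.set (by simp) _ _).set (by simp) _ _).set (by simp) _ _, ?_, ?_, ?_⟩
        · simp [Mem.set_apply, hk, hl]
        · intro i hi j hj
          simpa [Mem.set_apply] using (h3 i hi j hj).trans hlt.le
        · intro j hj
          rcases Nat.lt_succ_iff_lt_or_eq.mp hj with hj | rfl
          · simpa [Mem.set_apply] using (h4 j hj).trans hlt.le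
          · simp [Mem.set_apply]
      · rw [St.run, if_neg (by rw [ne_zero_ltE, hsc N h1]; exact hlt), St.run]
        refine ⟨h1, h2, h3, fun j hj => ?_⟩
        rcases Nat.lt_succ_iff_lt_or_eq.mp hj with hj | rfl
        · exact h4 j hj
        · exact not_lt.mp hlt)
  refine ⟨key.1, key.2.1, fun i hi j hj => ?_⟩
  rcases Nat.lt_succ_iff_lt_or_eq.mp hi with hi | rfl
  · exact key.2.2.1 i hi j hj
  · exact key.2.2.2 j hj

section Steps

variable {n r : ℕ} {I : SetCover (Fin n × Fin n) (Fin n)} {U D : Finset (Fin n)}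
  {J : Finset (Fin n × Fin n)} {M : Mem}

theorem GreedyState.of_agreeOff (h : GreedyState I U D J M) {N : Mem} (hN : AgreeOff [14] N M) :
    GreedyState I U D J N where
  incidence := by rw [hN 10 (by simp)]; exact h.incidence
  uncovered := by rw [hN 11 (by simp)]; exact h.uncovered
  pending := by rw [hN 15 (by simp)]; exact h.pending
  count := by rw [hN 12 (by simp)]; exact h.count
  selected := by rw [hN 5 (by simp)]; exact h.selected
  subset := h.subset
  invariant := h.invariant

theorem GreedyState.coverPending (h : GreedyState I U D J M) {x : Fin n} (hx : x ∈ D)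
    (hM : M 14 1 = x) :
    GreedyState I (U.erase x) (D.erase x) J (coverPending.run [n, r] M) := by
  set N := (M.set 15 x 0).set 11 x 0 with hN
  have hNM : AgreeOff [11, 15] N M :=
    ((AgreeOff.refl _ M).set (by simp) _ _).set (by simp) _ _
  obtain ⟨a1, a2⟩ := table2 (ρ := [n, r]) (n := n) rfl (W := [16]) (k := 16) (M := N)
    (b := .put 16 (idx2 (var 2) (var 3))
      (ite (get 10 (idx3 (var 2) (var 3) (cap (get 14 (lit 1)))))
        (minus (get 12 (idx2 (var 2) (var 3))) (lit 1)) (get 12 (idx2 (var 2) (var 3)))))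
    fun i _ j _ => .put (by decide) (fun _ => rfl) (by decide)
  set N₁ := (St.loop (.loop (.put 16 (idx2 (var 2) (var 3))
      (ite (get 10 (idx3 (var 2) (var 3) (cap (get 14 (lit 1)))))
        (minus (get 12 (idx2 (var 2) (var 3))) (lit 1)) (get 12 (idx2 (var 2) (var 3))))))).run
      [n, r] N with hN₁
  obtain ⟨b1, b2⟩ := table2 (ρ := [n, r]) (n := n) rfl (W := [12]) (k := 12) (M := N₁)
    (b := .put 12 (idx2 (var 2) (var 3)) (get 16 (idx2 (var 2) (var 3))))
    fun i _ j _ => .put (by decide) (fun _ => rfl) (by decide)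
  have hrun : RobustSensor.coverPending.run [n, r] M =
      (St.loop (.loop (.put 12 (idx2 (var 2) (var 3)) (get 16 (idx2 (var 2) (var 3)))))).run
      [n, r] N₁ := by
    rw [RobustSensor.coverPending, St.run, St.run, St.run, hN₁, hN, St.run, St.run]
    simp [Mem.set_apply, hM]
  rw [hrun]
  have hxU := h.subset hx
  have hsdiff : U.erase x \ D.erase x = U \ D := by
    ext y
    simp only [Finset.mem_sdiff, Finset.mem_erase]
    by_cases hy : y = x
    · subst hy; simp [hx]
    · simp [hy]
  refine ⟨fun a b y => ?_, fun y => ?_, fun y => ?_, fun a b => ?_, fun a b => ?_,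
    Finset.erase_subset_erase _ h.subset, by rw [hsdiff]; exact h.invariant⟩
  · rw [b1 10 (by simp), a1 10 (by simp), hNM 10 (by simp), h.incidence]
  · rw [b1 11 (by simp), a1 11 (by simp), hN, Mem.set_apply, Mem.set_ne_arr _ _ _ (by decide),
      Finset.mem_erase, ← h.uncovered]
    by_cases hy : y = x <;> simp [hy, Fin.val_ne_of_ne]
  · rw [b1 15 (by simp), a1 15 (by simp), hN, Mem.set_ne_arr _ _ _ (by decide), Mem.set_apply,
      Finset.mem_erase, ← h.pending]
    by_cases hy : y = x <;> simp [hy, Fin.val_ne_of_ne]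
  · rw [b2 a a.2 b b.2]
    change N₁ 16 ((a : ℕ) * n + b) = _
    rw [a2 a a.2 b b.2, eval_ite]
    have hcell : (get 10 (idx3 (var 2) (var 3) (cap (get 14 (lit 1))))).eval
        ([n, r] ++ [(a : ℕ)] ++ [(b : ℕ)]) N = M 10 (((a : ℕ) * n + b) * n + x) := by
      rw [eval_get, eval_idx3, eval_cap, eval_get, eval_lit, hNM 10 (by simp), hNM 14 (by simp), hM]
      change M 10 (((a : ℕ) * n + b) * n + min (x : ℕ) n) = _
      rw [min_eq_left x.2.le]
    have hcount : (get 12 (idx2 (var 2) (var 3))).eval ([n, r] ++ [(a : ℕ)] ++ [(b : ℕ)]) N =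
        (I.setAt (a, b) ∩ U).card := by
      rw [eval_get, hNM 12 (by simp), ← h.count]
      rfl
    rw [hcell, Finset.inter_erase]
    by_cases hxV : x ∈ I.setAt (a, b)
    · rw [if_pos ((h.incidence a b x).mpr hxV), Finset.card_erase_of_mem
        (Finset.mem_inter.mpr ⟨hxV, hxU⟩), ← hcount]
      rfl
    · rw [if_neg (fun h' => hxV ((h.incidence a b x).mp h')), Finset.erase_eq_of_notMem
        (fun h' => hxV (Finset.mem_inter.mp h').1), hcount]
  · rw [b1 5 (by simp), a1 5 (by simp), hNM 5 (by simp), h.selected]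

theorem GreedyState.takeBest (h : GreedyState I U ∅ J M) {a b : Fin n} (hq : (a, b) ∈ I.index)
    (ha : M 14 2 = a) (hb : M 14 4 = b) (hpos : (I.sets (a, b) ∩ U).Nonempty)
    (hbest : ∀ j ∈ I.index,
      (I.sets j ∩ U).card * I.cost (a, b) ≤ (I.sets (a, b) ∩ U).card * I.cost j) :
    GreedyState I U (I.sets (a, b) ∩ U) (insert (a, b) J) (takeBest.run [n, r] M) := by
  set N := M.set 5 ((a : ℕ) * n + b) 1 with hN
  obtain ⟨a1, a2⟩ := table1 (ρ := [n, r]) (n := n) rfl (W := [15]) (k := 15) (M := N)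
    (b := .put 15 (var 2) (andE (get 11 (var 2))
      (get 10 (idx3 (cap (get 14 (lit 2))) (cap (get 14 (lit 4))) (var 2)))))
    fun i _ => .put (by decide) (fun _ => rfl) (by decide)
  have hrun : RobustSensor.takeBest.run [n, r] M = (St.loop (.put 15 (var 2) (andE (get 11 (var 2))
      (get 10 (idx3 (cap (get 14 (lit 2))) (cap (get 14 (lit 4))) (var 2)))))).run [n, r] N := by
    rw [RobustSensor.takeBest, St.run, hN, St.run]
    simp [ha, hb, a.2.le, b.2.le]
  rw [hrun]
  have hset : I.setAt (a, b) = I.sets (a, b) := if_pos hq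
  refine ⟨fun a' b' y => ?_, fun y => ?_, fun y => ?_, fun a' b' => ?_, fun a' b' => ?_,
    Finset.inter_subset_right, ?_⟩
  · rw [a1 10 (by simp), hN, Mem.set_ne_arr _ _ _ (by decide), h.incidence]
  · rw [a1 11 (by simp), hN, Mem.set_ne_arr _ _ _ (by decide), h.uncovered]
  · rw [a2 y y.2, ne_zero_andE, Finset.mem_inter, and_comm, ← h.uncovered, ← hset, ← h.incidence,
      eval_get, eval_get, eval_idx3, eval_cap, eval_cap, eval_get, eval_get, eval_lit, eval_lit,
      hN, Mem.set_ne_arr _ _ _ (by decide), Mem.set_ne_arr _ _ _ (by decide),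
      Mem.set_ne_arr _ _ _ (by decide), ha, hb]
    change M 10 ((min (a : ℕ) n * n + min (b : ℕ) n) * n + y) ≠ 0 ∧ M 11 y ≠ 0 ↔ _
    rw [min_eq_left a.2.le, min_eq_left b.2.le]
  · rw [a1 12 (by simp), hN, Mem.set_ne_arr _ _ _ (by decide), h.count]
  · rw [a1 5 (by simp), hN, Mem.set_apply, h.selected]
    have : (a' : ℕ) * n + b' = (a : ℕ) * n + b ↔ (a', b') = (a, b) := by
      constructor
      · intro he
        have h1 := add_mul_div_mod (i := a) b.2
        have h2 := add_mul_div_mod (i := a') b'.2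
        rw [he] at h2
        exact Prod.ext (Fin.ext (h2.1.symm.trans h1.1)) (Fin.ext (h2.2.symm.trans h1.2))
      · rintro h; cases h; rfl
    by_cases hab : (a', b') = (a, b)
    · rw [if_pos ⟨rfl, this.mpr hab⟩, if_pos (by simp [hab])]
    · rw [if_neg (fun h' => hab (this.mp h'.2))]
      simp [hab]
  · have := h.invariant
    rw [Finset.sdiff_empty] at this
    have h1 := this.step hq hpos hbest
    rwa [Finset.inter_comm, Finset.sdiff_inter_self_left]

/-- Every step of the greedy algorithm decreases the number of uncovered elements or the number of
uncovered elements that are not pending, as long as there are uncovered elements. -/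
theorem GreedyState.step (hI : ∀ j : Fin n × Fin n, j ∈ I.index ↔ j.1 ≤ j.2)
    (hcost : ∀ j ∈ I.index, I.cost j = if j.1 = j.2 then 1 else 2)
    (h : GreedyState I U D J M) :
    ∃ U' D' J', GreedyState I U' D' J' (greedyStep.run [n, r] M) ∧
      ((∃ K, I.IsCover K) →
        U' = ∅ ∨ U'.card + (U' \ D').card + 1 ≤ U.card + (U \ D).card) := by
  obtain ⟨x, h1, hx⟩ := run_selectPending (n := n) (r := r) M
  set M₁ := M.set 14 1 x with hM₁
  have h' : GreedyState I U D J M₁ := h.of_agreeOff ((AgreeOff.refl _ M).set (by simp) _ _)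
  have hM₁x : M₁ 14 1 = x := Mem.set_same _ _ _ _
  rw [greedyStep, St.run, h1, St.run]
  rcases hx with ⟨rfl, hx⟩ | ⟨hxn, hx⟩
  · have hD : D = ∅ := Finset.eq_empty_of_forall_notMem fun y hy =>
      (h.pending y).mpr hy (hx y y.2)
    subst hD
    rw [if_neg (by rw [ne_zero_ltE, eval_get, eval_lit, hM₁x]; exact lt_irrefl _), St.run]
    obtain ⟨b1, b2, b3⟩ := run_selectBest (n := x) (r := r) M₁
    set M₂ := selectBest.run [x, r] M₁
    have h'' : GreedyState I U ∅ J M₂ := h'.of_agreeOff b1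
    have hscore : ∀ a b : Fin x, scoreE.eval [x, r, a, b] M₁ =
        if a = b then 2 * (I.setAt (a, b) ∩ U).card else (I.setAt (a, b) ∩ U).card := by
      intro a b
      have hle : (I.setAt (a, b) ∩ U).card ≤ x :=
        (Finset.card_le_univ _).trans (by simp)
      have e1 : [x, r, (a : ℕ), b].getD 3 0 = b := rfl
      have e2 : [x, r, (a : ℕ), b].getD 2 0 = a := rfl
      have e3 : [x, r, (a : ℕ), b].getD 0 0 = x := rfl
      simp only [scoreE, eval_ite, ne_zero_eqE, eval_plus, eval_cap, eval_get, eval_idx2, eval_var,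
        e1, e2, e3, h'.count, min_eq_left hle, Fin.ext_iff]
      split_ifs <;> omega
    rw [St.run, eval_get, eval_lit]
    by_cases hzero : M₂ 14 3 = 0
    · rw [if_neg (by simpa using hzero), St.run]
      refine ⟨U, ∅, J, h'', fun ⟨K, hK⟩ => .inl ?_⟩
      refine Finset.eq_empty_of_forall_notMem fun y hy => ?_
      obtain ⟨j, hj, hyj⟩ := hK.2 y (h.invariant.subset_universal (by simpa using hy))
      have h3 := b3 j.1 j.1.2 j.2 j.2.2
      rw [hscore, hzero, SetCover.setAt, if_pos (hK.1 hj)] at h3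
      have : 0 < (I.sets j ∩ U).card := Finset.card_pos.mpr ⟨y, Finset.mem_inter.mpr ⟨hyj, hy⟩⟩
      split_ifs at h3 <;> simp only [Prod.mk.eta] at h3 <;> omega
    · rw [if_pos hzero]
      obtain ⟨c1, c2, c3⟩ := b2 hzero
      obtain ⟨a, ha⟩ : ∃ a : Fin x, M₂ 14 2 = a := ⟨⟨_, c1⟩, rfl⟩
      obtain ⟨b, hb⟩ : ∃ b : Fin x, M₂ 14 4 = b := ⟨⟨_, c2⟩, rfl⟩
      rw [ha, hb, hscore] at c3
      have hq : (a, b) ∈ I.index := by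
        by_contra hq
        rw [SetCover.setAt, if_neg hq] at c3
        simp at c3
        exact hzero c3
      rw [SetCover.setAt, if_pos hq] at c3
      have hpos : (I.sets (a, b) ∩ U).Nonempty := by
        rw [← Finset.card_pos]
        by_contra h0
        have h0' : (I.sets (a, b) ∩ U).card = 0 := by omega
        rw [h0'] at c3
        simp at c3
        exact hzero c3
      refine ⟨U, I.sets (a, b) ∩ U, insert (a, b) J, h''.takeBest hq ha hb hpos fun j hj => ?_,
        fun _ => .inr ?_⟩
      · have h3 := b3 j.1 j.1.2 j.2 j.2.2
        rw [hscore, c3, SetCover.setAt, if_pos hj] at h3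
        rw [hcost _ hq, hcost j hj]
        simp only [Prod.mk.eta] at h3
        split_ifs at h3 ⊢ <;> omega
      · rw [Finset.sdiff_empty]
        have : (U \ (I.sets (a, b) ∩ U)).card < U.card := by
          obtain ⟨y, hy⟩ := hpos
          refine Finset.card_lt_card (Finset.ssubset_iff_of_subset Finset.sdiff_subset |>.mpr
            ⟨y, (Finset.mem_inter.mp hy).2, by simp [(Finset.mem_inter.mp hy).1]⟩)
        omega
  · rw [if_pos (by rw [ne_zero_ltE, eval_get, eval_lit, hM₁x]; exact hxn)]
    have hxD : (⟨x, hxn⟩ : Fin n) ∈ D := (h.pending _).mp hx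
    refine ⟨_, _, J, h'.coverPending hxD hM₁x, fun _ => .inr ?_⟩
    have hxU := h.subset hxD
    have h2 : U.erase ⟨x, hxn⟩ \ D.erase ⟨x, hxn⟩ ⊆ U \ D := by
      intro y hy
      simp only [Finset.mem_sdiff, Finset.mem_erase] at hy ⊢
      exact ⟨hy.1.2, fun hyD => hy.2 ⟨hy.1.1, hyD⟩⟩
    have h3 := Finset.card_le_card h2
    have h4 := Finset.card_erase_add_one hxU
    omega

end Steps

theorem greedy_spec {n : ℕ} {I : SetCover (Fin n × Fin n) (Fin n)} {s s' : MachineState}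
    (hI : ∀ j : Fin n × Fin n, j ∈ I.index ↔ j.1 ≤ j.2)
    (hcost : ∀ j ∈ I.index, I.cost j = if j.1 = j.2 then 1 else 2)
    (hs : HoldsInstance I s) (h : s'.arr = greedy.run [n] s.arr) :
    ∃ J, HoldsSubfamily I J s' ∧ ((∃ K, I.IsCover K) → I.GreedyInvariant ∅ J) := by
  have key : ∃ U D J, GreedyState I U D J (greedy.run [n] s.arr) ∧
      ((∃ K, I.IsCover K) → U = ∅ ∨ U.card + (U \ D).card + 2 * n ≤ 2 * n) := by
    rw [greedy, St.run, run_loop rfl]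
    refine iter_invariant (m := n) (fun k M => ∃ U D J, GreedyState I U D J M ∧
      ((∃ K, I.IsCover K) → U = ∅ ∨ U.card + (U \ D).card + 2 * k ≤ 2 * n))
      ⟨_, _, _, greedyState_start hI hs, fun _ => .inr ?_⟩ ?_
    · have := Finset.card_le_univ I.universal
      simp at this ⊢
      omega
    · rintro k hk M ⟨U, D, J, h1, h2⟩
      obtain ⟨U₁, D₁, J₁, h3, h4⟩ := h1.step (r := k) hI hcost
      obtain ⟨U₂, D₂, J₂, h5, h6⟩ := h3.step (r := k) hI hcost
      refine ⟨U₂, D₂, J₂, h5, fun hK => ?_⟩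
      rcases h6 hK with h6 | h6
      · exact .inl h6
      rcases h4 hK with rfl | h4
      · simp at h6
      rcases h2 hK with rfl | h2
      · simp at h4
      exact .inr (by omega)
  obtain ⟨U, D, J, h1, h2⟩ := key
  refine ⟨J, ⟨h1.invariant.subset_index, fun j _ => by rw [h, h1.selected]⟩, fun hK => ?_⟩
  have hU : U = ∅ := by
    rcases h2 hK with hU | hU
    · exact hU
    · exact Finset.card_eq_zero.mp (by omega)
  have := h1.invariant
  rwa [hU, Finset.empty_sdiff] at this

/-! ### The approximation guarantee -/

section Guarantee

variable {n : ℕ} {P : Pattern n} {F T : Finset (Fin n)} {J : Finset (Fin n × Fin n)}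

theorem backupInstance_index (j : Fin n × Fin n) :
    j ∈ (backupInstance P F T).index ↔ j.1 ≤ j.2 := by
  simp [backupInstance]

theorem backupInstance_cost (j : Fin n × Fin n) :
    (backupInstance P F T).cost j = if j.1 = j.2 then 1 else 2 := by
  change (zset j).card = _
  by_cases hj : j.1 = j.2 <;> simp [zset, hj]

theorem SetCover.GreedyInvariant.isCover (h : (backupInstance P F T).GreedyInvariant ∅ J) :
    (backupInstance P F T).IsCover J :=
  ⟨h.subset_index, fun x hx => h.covered x hx (Finset.notMem_empty x)⟩

theorem SetCover.GreedyInvariant.totalCost_le (h : (backupInstance P F T).GreedyInvariant ∅ J)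
    {K : Finset (Fin n × Fin n)} (hK : (backupInstance P F T).IsCover K) :
    ((backupInstance P F T).totalCost J : ℚ) ≤
      harmonic F.card * (backupInstance P F T).totalCost K := by
  have := h.cost_le K hK
  rw [Finset.card_empty, harmonic_zero, sub_zero, mul_comm] at this
  exact this

/-- The cost of the greedy cover is bounded in two ways, by the harmonic ratio against the cover
obtained from an s-robust solution `S` and by one or two for each element of `F`, and the size of
the augmented solution is bounded by combining both. -/
theorem SetCover.GreedyInvariant.card_augmented_le (hF : IsMinimalFeasible P F) (hTF : T ⊆ F)
    (hT : IsTipSet P T) (h : (backupInstance P F T).GreedyInvariant ∅ J) {S : Finset (Fin n)}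
    (hFS : F ⊆ S) (hS : IsSRobust P S) :
    ((augmented F J).card : ℚ) ≤ harmonic F.card * (S.card : ℚ) := by
  obtain ⟨D, K, hDF, hK, hKcost, hDm, hD2, hsingle⟩ := exists_cover_of_isSRobust hF hTF hT hFS hS
  have h1 : ((backupInstance P F T).totalCost J : ℚ) ≤
      ((S \ F).card + D.card) * harmonic F.card := by
    refine (h.totalCost_le hK).trans ?_
    rw [mul_comm]
    have h0 : (0 : ℚ) ≤ harmonic F.card := by
      rw [harmonic]
      exact Finset.sum_nonneg fun i _ => by positivity
    exact mul_le_mul_of_nonneg_right (by exact_mod_cast hKcost) h0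
  have h2 : (backupInstance P F T).totalCost J ≤ F.card + D.card := by
    refine (h.cost_le_sum (fun x => if x ∈ D then 2 else 1) fun x hx => ?_).trans ?_
    · by_cases hxD : x ∈ D
      · obtain ⟨j, hj, hxj⟩ := hK.2 x hx
        exact ⟨j, hK.1 hj, hxj, by rw [if_pos hxD]; exact cost_le_two j⟩
      · obtain ⟨j, hj, hxj, hc⟩ := hsingle x hx hxD
        exact ⟨j, hj, hxj, by rw [if_neg hxD, hc]⟩
    · change ∑ x ∈ F \ ∅, (if x ∈ D then 2 else 1) ≤ _
      have : ∀ x, (if x ∈ D then 2 else 1) = 1 + if x ∈ D then 1 else 0 := fun x => by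
        split_ifs <;> rfl
      simp only [this, Finset.sdiff_empty, Finset.sum_add_distrib, Finset.sum_const, smul_eq_mul,
        mul_one, Finset.sum_ite_mem, Finset.inter_eq_right.mpr hDF]
      exact le_rfl
  have h3 : (augmented F J).card ≤ F.card + (backupInstance P F T).totalCost J := by
    refine (Finset.card_union_le _ _).trans ?_
    rw [add_comm]
    exact Nat.add_le_add_left Finset.card_biUnion_le _
  have h4 : S.card = F.card + (S \ F).card := by
    rw [Finset.card_sdiff_of_subset hFS]
    have := Finset.card_le_card hFS
    omega
  have h5 := size_bound F.card (S \ F).card D.card _ (Finset.card_le_card hDF) hDm hD2 h1 h2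
  calc ((augmented F J).card : ℚ) ≤ F.card + (backupInstance P F T).totalCost J := by
        exact_mod_cast h3
    _ ≤ _ := h5
    _ = _ := by rw [h4]; push_cast; rfl

end Guarantee

end RobustSensor

theorem theorem5 :
    ∃ (build approximate : Program) (C : ℕ),
      ∀ (n : ℕ) (P : Pattern n) (F T : Finset (Fin n)),
        IsMinimalFeasible P F → T ⊆ F → IsTipSet P T →
          -- the instance is constructed in time `O(n ^ 5)`
          (∀ s : MachineState, HoldsInput P F T s →
            ∃ (t : ℕ) (s' : MachineState),
              Exec ((n + 2) ^ C) build s t s' ∧ t ≤ C * (n ^ 5 + 1) ∧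
              HoldsInstance (backupInstance P F T) s') ∧
          -- it has a cover if and only if `F` extends to an s-robust feasible solution
          ((∃ J, (backupInstance P F T).IsCover J) ↔
            ∃ S : Finset (Fin n), F ⊆ S ∧ IsSRobust P S) ∧
          -- from the instance, an approximate solution is computed in time `O(n ^ 3)`
          (∀ s : MachineState, HoldsInstance (backupInstance P F T) s →
            ∃ (t : ℕ) (s' : MachineState) (J' : Finset (Fin n × Fin n)),
              Exec ((n + 2) ^ C) approximate s t s' ∧ t ≤ C * (n ^ 3 + 1) ∧
              HoldsSubfamily (backupInstance P F T) J' s' ∧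
              ((∃ J, (backupInstance P F T).IsCover J) →
                (backupInstance P F T).IsCover J' ∧
                (∀ J, (backupInstance P F T).IsCover J →
                  ((backupInstance P F T).totalCost J' : ℚ) ≤
                    harmonic F.card * ((backupInstance P F T).totalCost J : ℚ)) ∧
                IsSRobust P (augmented F J') ∧
                ∀ S : Finset (Fin n), F ⊆ S → IsSRobust P S →
                  ((augmented F J').card : ℚ) ≤ harmonic F.card * (S.card : ℚ))) := by
  -- the loops of the two programs are nested five and three deep, which gives the exponents
  obtain ⟨C₁, h₁⟩ := St.exec_program buildInstance (by decide)
  obtain ⟨C₂, h₂⟩ := St.exec_program greedy (by decide)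
  refine ⟨buildInstance.program, greedy.program, max C₁ C₂, fun n P F T hF hTF hT =>
    ⟨fun s hs => ?_, exists_cover_iff hF hTF hT, fun s hs => ?_⟩⟩
  · obtain ⟨t, s', hexec, ht, h0, harr⟩ := h₁ _ (le_max_left _ _) n s hs.size
    exact ⟨t, s', hexec, ht, holdsInstance_buildInstance hTF hT hs h0 harr⟩
  · obtain ⟨t, s', hexec, ht, -, harr⟩ := h₂ _ (le_max_right _ _) n s hs.size
    obtain ⟨J, hJ, hgreedy⟩ :=
      greedy_spec backupInstance_index (fun j _ => backupInstance_cost j) hs harr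
    refine ⟨t, s', J, hexec, ht, hJ, fun hcover => ?_⟩
    have h := hgreedy hcover
    exact ⟨h.isCover, fun K hK => h.totalCost_le hK, isSRobust_augmented hF.1 hTF hT h.isCover,
      fun S hFS hS => h.card_augmented_le hF hTF hT hFS hS⟩
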